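/- Let $SU(1,1)$ be the group of matrices $g=\begin{pmatrix} a & b\\ \bar b&\bar a\end{pmatrix}$ with $a,b\in\mathbb C$, $|a|^2-|b|^2=1$, and let $K_{\mathbb R}=\{\mathrm{diag}(e^{it},e^{-it})\}$. For $\chi=(l,\epsilon)$ with $l\in\mathbb C$, $\epsilon\in\{0,1/2\}$, let $SU(1,1)$ act on the Fréchet space $C^\infty(S^1)$ of smooth complex-valued functions on the unit circle (with the topology of uniform convergence of all derivatives) by $$(\pi_\chi(g)f)(z)=|a-\bar b z|^{2l-2\epsilon}\,(a-\bar b z)^{2\epsilon}\, f\Bigl(\frac{\bar a z-b}{a-\bar b z}\Bigr),\qquad |z|=1 .$$ A subrepresentation is a closed invariant subspace. A representation is irreducible if it is nonzero and its only subrepresentations are $0$ and the whole space. It has finite length if every increasing chain of subrepresentations stabilizes and there is a finite chain $0=V_0\subset V_1\subset\dots\subset V_N$ of subrepresentations, with $V_N$ the whole space, all of whose quotients $V_i/V_{i-1}$ are irreducible. It is admissible if every finite-dimensional irreducible representation of $K_{\mathbb R}$ occurs in it with finite multiplicity. Let $C^\infty(S^1)_{fini}$ be the $(\mathfrak g,K)$-module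 of $K_{\mathbb R}$-finite vectors, with the differentiated action of $\mathfrak{sl}(2,\mathbb C)$, and put $v_n=z^{-n}$ for $n\in\mathbb Z$. With the standard generators $H,E,F$ of $\mathfrak{sl}(2,\mathbb C)$, write $F_d$ for the irreducible $\mathfrak{sl}(2,\mathbb C)$-module of dimension $d+1$, $V_\lambda$ (for $\lambda\neq 0,-1,-2,\dots$) for the irreducible module of lowest weight $\lambda$, and $\bar V_\lambda$ (for $\lambda\ne 0,1,2,\dots$) for the irreducible infinite-dimensional module of highest weight $\lambda$. **Proposition.** The representation $(\pi_\chi,C^\infty(S^1))$ is irreducible if and only if $l+\epsilon\notin\mathbb Z$. For every $\chi$ it is admissible and has finite length. Suppose now that $l+\epsilon\in\mathbb Z$ (so that $2l\in\mathbb Z$), and put $$M^+=\operatorname{span}\{v_n: n\ge -(l+\epsilon)\},\qquad M^-=\operatorname{span}\{v_n: n\le l-\epsilon\}.$$ These are $(\mathfrak g,K)$-submodules of $C^\infty(S^1)_{fini}$; their closures $\mathcal D^{+}$, $\mathcal D^{-}$ in $C^\infty(S^1)$ are subrepresentations, whose $K_{\mathbb R}$-finite vectors are exactly $M^+$ and $M^-$.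 1. Let $l<0$. Then $M^+$ and $M^-$ are irreducible, $M^+\cap M^-=0$, and as $\mathfrak{sl}(2,\mathbb C)$-modules $M^+\simeq V_{-2l}$ and $M^-\simeq\bar V_{2l}$. The subrepresentations $\mathcal D^+$ and $\mathcal D^-$ are irreducible (for $l\le-1$ these are the antiholomorphic and the holomorphic discrete series, for $l=-1/2$ their limits), $\mathcal D^+\cap\mathcal D^-=0$, and $\mathcal D^+\oplus\mathcal D^-$ is the closure of $M^+\oplus M^-$. * If $l\neq-1/2$, the $(\mathfrak g,K)$-submodules of $C^\infty(S^1)_{fini}$ other than $0$ and the whole module are exactly $M^+$, $M^-$, $M^+\oplus M^-$. The quotient $C^\infty(S^1)_{fini}/(M^+\oplus M^-)$ is irreducible of dimension $-(2l+1)$ and isomorphic to $F_{|2(l+1)|}$. On the level of $SU(1,1)$, the quotient $C^\infty(S^1)/(\mathcal D^+\oplus\mathcal D^-)$ is irreducible, and as an $\mathfrak{sl}(2,\mathbb C)$-module it is $F_{|2(l+1)|}$ as well. * If $l=-1/2$ (so $\epsilon=1/2$), the $(\mathfrak g,K)$-submodules other than $0$ and the whole module are exactly $M^+$ and $M^-$;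 moreover $C^\infty(S^1)_{fini}=M^+\oplus M^-$ and $C^\infty(S^1)=\mathcal D^+\oplus\mathcal D^-$. 2. Let $l\ge0$. Then $F:=M^+\cap M^-$ is irreducible of dimension $2l+1$ and isomorphic to $F_{2l}$. The $(\mathfrak g,K)$-submodules of $C^\infty(S^1)_{fini}$ other than $0$ and the whole module are exactly $F$, $M^+$, $M^-$. One has $C^\infty(S^1)_{fini}=M^++M^-$, and $C^\infty(S^1)_{fini}/F$ is the direct sum of the irreducible modules $M^+/F\simeq V_{2l+2}$ and $M^- /F\simeq\bar V_{-(2l+2)}$. On the level of $SU(1,1)$, $F$ is an irreducible subrepresentation, $\mathcal D^+\cap\mathcal D^-=F$, $\mathcal D^++\mathcal D^-=C^\infty(S^1)$ (so that $C^\infty(S^1)/F=\mathcal D^+/F\oplus\mathcal D^- /F$), and $\mathcal D^+/F$ and $\mathcal D^- /F$ are irreducible. -/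

import Mathlib

open scoped Manifold ContDiff

set_option linter.unusedSimpArgs false

noncomputable section

namespace SU11

/-! ### The group `SU(1,1)` and its diagonal subgroup -/

/-- `SU(1,1)`: the matrices `(a b; b̄ ā)` of determinant one. -/
def SU : Subgroup (Matrix.SpecialLinearGroup (Fin 2) ℂ) where
  carrier := {g | g 1 0 = star (g 0 1) ∧ g 1 1 = star (g 0 0)}
  mul_mem' := by
    rintro g h ⟨hg1, hg2⟩ ⟨hh1, hh2⟩
    simp only [Set.mem_ofPred_eq, Matrix.SpecialLinearGroup.coe_mul, Matrix.mul_apply,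
      Fin.sum_univ_two, hg1, hg2, hh1, hh2, star_add, star_mul', star_star]
    constructor <;> ring
  one_mem' := by simp
  inv_mem' := by
    rintro g ⟨hg1, hg2⟩
    simp only [Set.mem_ofPred_eq, Matrix.SpecialLinearGroup.coe_inv, Matrix.adjugate_fin_two,
      Matrix.of_apply, Matrix.cons_val', Matrix.cons_val_zero, Matrix.cons_val_one, hg1, hg2,
      Matrix.cons_val_fin_one, star_neg, star_star]
    exact ⟨trivial, trivial⟩

/-- The matrix entry `g i j` of `g ∈ SU(1,1)`. -/
def ent (g : SU) (i j : Fin 2) : ℂ := (g : Matrix.SpecialLinearGroup (Fin 2) ℂ) i j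

lemma ent_mul (g h : SU) (i j : Fin 2) :
    ent (g * h) i j = ent g i 0 * ent h 0 j + ent g i 1 * ent h 1 j := by
  simp [ent, Matrix.mul_apply, Fin.sum_univ_two]

@[simp] lemma ent_one (i j : Fin 2) : ent 1 i j = (1 : Matrix (Fin 2) (Fin 2) ℂ) i j := by
  simp [ent]

lemma ent_10 (g : SU) : ent g 1 0 = star (ent g 0 1) := g.2.1
lemma ent_11 (g : SU) : ent g 1 1 = star (ent g 0 0) := g.2.2

lemma ent_det (g : SU) : ent g 0 0 * ent g 1 1 - ent g 0 1 * ent g 1 0 = 1 := by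
  have := (g : Matrix.SpecialLinearGroup (Fin 2) ℂ).det_coe
  rwa [Matrix.det_fin_two] at this

/-- The element `k = diag(u, ū)` for `u` on the unit circle. -/
def diagK : Circle →* SU where
  toFun u := ⟨⟨!![(u : ℂ), 0; 0, ((u⁻¹ : Circle) : ℂ)], by simp [Matrix.det_fin_two]⟩, by
    refine ⟨by simp, ?_⟩
    simp only [Matrix.of_apply, Matrix.cons_val', Matrix.cons_val_zero, Matrix.cons_val_one,
      Matrix.cons_val_fin_one]
    exact Circle.coe_inv_eq_conj u⟩
  map_one' := by
    apply Subtype.ext; apply Subtype.ext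
    ext i j; fin_cases i <;> fin_cases j <;> simp
  map_mul' u v := by
    apply Subtype.ext; apply Subtype.ext
    rw [Subgroup.coe_mul, Matrix.SpecialLinearGroup.coe_mul]
    ext i j
    fin_cases i <;> fin_cases j <;> simp [Matrix.mul_apply, Fin.sum_univ_two, mul_comm]

/-- The maximal compact subgroup `K_ℝ = {diag(e^{it}, e^{-it})}`. -/
def KR : Subgroup SU := diagK.range

/-- The factor `a - b̄ z`. -/
def wfac (g : SU) (z : Circle) : ℂ := ent g 0 0 - ent g 1 0 * z

/-- The factor `ā z - b`. -/
def nfac (g : SU) (z : Circle) : ℂ := ent g 1 1 * z - ent g 0 1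

lemma nfac_eq (g : SU) (z : Circle) : nfac g z = z * star (wfac g z) := by
  have hz : (z : ℂ) * star (z : ℂ) = 1 := by
    rw [← starRingEnd_apply, Complex.mul_conj]; simp
  simp only [nfac, wfac, ent_11, ent_10, star_sub, star_mul', star_star]
  linear_combination (ent g 0 1) * hz

lemma wfac_ne (g : SU) (z : Circle) : wfac g z ≠ 0 := by
  intro h
  have h2 : nfac g z = 0 := by rw [nfac_eq, h]; simp
  have hd := ent_det g
  simp only [wfac, nfac] at h h2
  have : (1 : ℂ) = 0 := by
    linear_combination (-hd) + (ent g 1 1) * h + (ent g 1 0) * h2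
  exact one_ne_zero this

/-- The action `z ↦ g⁻¹ · z = (ā z - b) / (a - b̄ z)` on the unit circle. -/
def mob (g : SU) (z : Circle) : Circle :=
  ⟨nfac g z / wfac g z, mem_sphere_zero_iff_norm.2 (by
    have := norm_ne_zero_iff.2 (wfac_ne g z)
    rw [norm_div, nfac_eq, norm_mul, norm_star, Circle.norm_coe, one_mul, div_self this])⟩

lemma coe_mob (g : SU) (z : Circle) : (mob g z : ℂ) = nfac g z / wfac g z := rfl

lemma wfac_mul (g h : SU) (z : Circle) : wfac (g * h) z = wfac g z * wfac h (mob g z) := by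
  have := wfac_ne g z
  conv_rhs => rw [wfac.eq_1 h, coe_mob]
  field_simp
  simp only [wfac, nfac, ent_mul]
  ring

lemma nfac_mul (g h : SU) (z : Circle) : nfac (g * h) z = wfac g z * nfac h (mob g z) := by
  have := wfac_ne g z
  conv_rhs => rw [nfac.eq_1 h, coe_mob]
  field_simp
  simp only [wfac, nfac, ent_mul]
  ring

lemma mob_mul (g h : SU) (z : Circle) : mob (g * h) z = mob h (mob g z) := by
  have h1 := wfac_ne g z
  have h2 := wfac_ne h (mob g z)
  ext
  rw [coe_mob, coe_mob, wfac_mul, nfac_mul]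
  field_simp

@[simp] lemma wfac_one (z : Circle) : wfac 1 z = 1 := by simp [wfac]
@[simp] lemma mob_one (z : Circle) : mob 1 z = z := by
  ext; simp [coe_mob, nfac]

/-! ### Smooth functions on the circle -/

lemma contDiffAt_im_log {E : Type*} [NormedAddCommGroup E] [NormedSpace ℝ E] {h : E → ℂ} {x : E}
    (hh : ContDiffAt ℝ ∞ h x) (hx : h x ∈ Complex.slitPlane) :
    ContDiffAt ℝ ∞ (fun y => (Complex.log (h y)).im) x := by
  have h1 : ContDiffAt ℝ ∞ Complex.log (h x) :=
    (Complex.contDiffAt_log hx).restrict_scalars ℝ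
  have h2 : ContDiffAt ℝ ∞ Complex.imCLM (Complex.log (h x)) := Complex.imCLM.contDiff.contDiffAt
  exact h2.comp x (h1.comp x hh)

lemma contMDiff_iff_pull (f : Circle → ℂ) :
    ContMDiff (𝓡 1) 𝓘(ℝ, ℂ) ∞ f ↔ ContDiff ℝ ∞ (fun θ : ℝ => f (Circle.exp θ)) := by
  constructor
  · intro h
    exact (h.comp contMDiff_circleExp).contDiff
  · intro h z₀
    obtain ⟨θ₀, rfl⟩ : ∃ θ, Circle.exp θ = z₀ := ⟨_, Circle.exp_arg z₀⟩
    have : Fact (Module.finrank ℝ ℂ = 1 + 1) := ⟨Complex.finrank_real_complex⟩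
    have hcoe : ContMDiff (𝓡 1) 𝓘(ℝ, ℂ) ∞ (fun z : Circle => (z : ℂ)) :=
      contMDiff_coe_sphere (E := ℂ) (n := 1)
    have key : f = fun z : Circle =>
        f (Circle.exp (θ₀ + (Complex.log ((z : ℂ) * ((Circle.exp θ₀)⁻¹ : Circle))).im)) := by
      funext z
      congr 1
      have := Circle.exp_arg (z * (Circle.exp θ₀)⁻¹)
      rw [Circle.exp_add, Complex.log_im, ← Circle.coe_mul, this]
      simp
    rw [key]
    have h1 : ContDiffAt ℝ ∞ (fun w : ℂ =>
        f (Circle.exp (θ₀ + (Complex.log (w * ((Circle.exp θ₀)⁻¹ : Circle))).im)))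
        (Circle.exp θ₀ : ℂ) := by
      have h2 : ContDiffAt ℝ ∞ (fun w : ℂ =>
          (θ₀ + (Complex.log (w * ((Circle.exp θ₀)⁻¹ : Circle))).im)) (Circle.exp θ₀ : ℂ) := by
        refine contDiffAt_const.add (contDiffAt_im_log (contDiffAt_id.mul contDiffAt_const) ?_)
        simp [Complex.one_mem_slitPlane]
      exact h.contDiffAt.comp _ h2
    exact h1.contMDiffAt.comp (Circle.exp θ₀) (hcoe _)

/-- `C^∞(S¹)`, as a complex subspace of all functions on the circle. -/
def smoothFun : Submodule ℂ (Circle → ℂ) where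
  carrier := {f | ContMDiff (𝓡 1) 𝓘(ℝ, ℂ) ∞ f}
  add_mem' := by
    intro f g hf hg
    exact ContMDiff.add hf hg
  zero_mem' := contMDiff_const
  smul_mem' := by
    intro c f hf
    simp only [Set.mem_ofPred_eq, contMDiff_iff_pull] at hf ⊢
    exact contDiff_const.mul hf

/-- The parameter `χ = (l, ε)`, `l ∈ ℂ`, `ε ∈ {0, 1/2}`, where `ε = e / 2` with `e ∈ {0, 1}`. -/
structure Param where
  l : ℂ
  e : Fin 2

/-- The number `ε ∈ {0, 1/2}`. -/
def Param.ε (χ : Param) : ℂ := ((χ.e : ℕ) : ℂ) / 2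

/-- The space `C^∞(S¹)`, on which the representation with parameter `χ` acts. -/
def PS (_χ : Param) : Type := smoothFun

variable (χ : Param)

instance : AddCommGroup (PS χ) := inferInstanceAs (AddCommGroup smoothFun)
instance : Module ℂ (PS χ) := inferInstanceAs (Module ℂ smoothFun)
instance : CoeFun (PS χ) (fun _ => Circle → ℂ) := ⟨fun f => f.1⟩

variable {χ}

/-- The function `θ ↦ f(e^{iθ})`. -/
def pull (f : PS χ) (θ : ℝ) : ℂ := f (Circle.exp θ)

lemma pull_contDiff (f : PS χ) : ContDiff ℝ ∞ (pull f) := (contMDiff_iff_pull _).1 f.2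

/-- A function on the circle that is smooth in the angle, as an element of `C^∞(S¹)`. -/
def PS.mk (f : Circle → ℂ) (hf : ContDiff ℝ ∞ (fun θ : ℝ => f (Circle.exp θ))) : PS χ :=
  ⟨f, (contMDiff_iff_pull f).2 hf⟩

@[simp] lemma PS.mk_apply (f : Circle → ℂ) (hf) (z : Circle) : (PS.mk f hf : PS χ) z = f z := rfl
@[simp] lemma PS.add_apply (f g : PS χ) (z : Circle) : (f + g) z = f z + g z := rfl
@[simp] lemma PS.sub_apply (f g : PS χ) (z : Circle) : (f - g) z = f z - g z := rfl
@[simp] lemma PS.neg_apply (f : PS χ) (z : Circle) : (-f) z = -f z := rfl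
@[simp] lemma PS.zero_apply (z : Circle) : (0 : PS χ) z = 0 := rfl
@[simp] lemma PS.smul_apply (c : ℂ) (f : PS χ) (z : Circle) : (c • f) z = c * f z := rfl

@[ext] lemma PS.ext {f g : PS χ} (h : ∀ z, f z = g z) : f = g := Subtype.ext (funext h)

lemma pull_deriv (f : PS χ) (θ : ℝ) :
    deriv (fun t : ℝ => f (Circle.exp θ * Circle.exp t)) 0 = deriv (pull f) θ := by
  have : (fun t : ℝ => f (Circle.exp θ * Circle.exp t)) = fun t => pull f (θ + t) := by
    funext t; simp [pull, Circle.exp_add]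
  rw [this, deriv_comp_const_add]; simp

/-- The derivation `d/dθ` of `C^∞(S¹)`. -/
def ddθ : Module.End ℂ (PS χ) where
  toFun f := PS.mk (fun z => deriv (fun t : ℝ => f (z * Circle.exp t)) 0) (by
    simp only [pull_deriv]
    exact (contDiff_infty_iff_deriv.1 (pull_contDiff f)).2)
  map_add' f g := by
    ext z
    obtain ⟨θ, rfl⟩ : ∃ θ, Circle.exp θ = z := ⟨_, Circle.exp_arg z⟩
    rw [PS.add_apply]
    simp only [PS.mk_apply, pull_deriv]
    have hf := (pull_contDiff f).differentiable (by simp) θ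
    have hg := (pull_contDiff g).differentiable (by simp) θ
    exact deriv_add hf hg
  map_smul' c f := by
    ext z
    obtain ⟨θ, rfl⟩ : ∃ θ, Circle.exp θ = z := ⟨_, Circle.exp_arg z⟩
    rw [PS.smul_apply]
    simp only [PS.mk_apply, pull_deriv, RingHom.id_apply]
    have hf := (pull_contDiff f).differentiable (by simp) θ
    exact deriv_const_mul c hf

lemma ddθ_exp (f : PS χ) (θ : ℝ) : (ddθ f) (Circle.exp θ) = deriv (pull f) θ := pull_deriv f θ

lemma continuous_coe (f : PS χ) : Continuous (fun z => f z) := ContMDiff.continuous f.2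

/-- The inclusion of `C^∞(S¹)` in the continuous functions with the sup norm. -/
def toCont : PS χ →ₗ[ℂ] C(Circle, ℂ) where
  toFun f := ⟨fun z => f z, continuous_coe f⟩
  map_add' _ _ := rfl
  map_smul' _ _ := rfl

/-- The Fréchet topology of `C^∞(S¹)`: uniform convergence of all derivatives. -/
instance : TopologicalSpace (PS χ) :=
  ⨅ k : ℕ, TopologicalSpace.induced (toCont ∘ₗ (ddθ ^ k)) inferInstance

instance : IsTopologicalAddGroup (PS χ) :=
  topologicalAddGroup_iInf fun k => topologicalAddGroup_induced (toCont ∘ₗ (ddθ ^ k))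

instance : ContinuousSMul ℂ (PS χ) :=
  continuousSMul_iInf fun k => continuousSMul_induced (toCont ∘ₗ (ddθ ^ k))

/-! ### The representation -/

/-- The multiplier `|a - b̄ z|^{2l - 2ε} (a - b̄ z)^{2ε}`, which is a single-valued form of
`(a - b̄ z)^{l + ε} (ā - b z̄)^{l - ε}`. -/
def mult (χ : Param) (g : SU) (z : Circle) : ℂ :=
  ((‖wfac g z‖ : ℝ) : ℂ) ^ (2 * χ.l - 2 * χ.ε) * wfac g z ^ (χ.e : ℕ)

lemma mult_mul (g h : SU) (z : Circle) :
    mult χ (g * h) z = mult χ g z * mult χ h (mob g z) := by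
  simp only [mult, wfac_mul, norm_mul, Complex.ofReal_mul, mul_pow]
  rw [Complex.mul_cpow_ofReal_nonneg (norm_nonneg _) (norm_nonneg _)]
  ring

lemma contDiff_circleExp : ContDiff ℝ ∞ (fun θ : ℝ => (Circle.exp θ : ℂ)) := by
  simp only [Circle.coe_exp]
  exact Complex.contDiff_exp.comp (Complex.ofRealCLM.contDiff.mul contDiff_const)

lemma contDiff_wfac (g : SU) : ContDiff ℝ ∞ (fun θ : ℝ => wfac g (Circle.exp θ)) :=
  contDiff_const.sub (contDiff_const.mul contDiff_circleExp)

lemma contDiff_nfac (g : SU) : ContDiff ℝ ∞ (fun θ : ℝ => nfac g (Circle.exp θ)) :=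
  (contDiff_const.mul contDiff_circleExp).sub contDiff_const

lemma contDiff_mult (g : SU) : ContDiff ℝ ∞ (fun θ : ℝ => mult χ g (Circle.exp θ)) := by
  have h0 : ∀ θ : ℝ, ‖wfac g (Circle.exp θ)‖ ≠ 0 := fun θ => norm_ne_zero_iff.2 (wfac_ne g _)
  refine ContDiff.mul ?_ ((contDiff_wfac g).pow _)
  have : (fun θ : ℝ => (((‖wfac g (Circle.exp θ)‖ : ℝ) : ℂ) ^ (2 * χ.l - 2 * χ.ε))) =
      fun θ : ℝ => Complex.exp
        (((Real.log ‖wfac g (Circle.exp θ)‖ : ℝ) : ℂ) * (2 * χ.l - 2 * χ.ε)) := by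
    funext θ
    rw [Complex.cpow_def_of_ne_zero (by exact_mod_cast h0 θ), Complex.ofReal_log (norm_nonneg _)]
  rw [this]
  refine Complex.contDiff_exp.comp (ContDiff.mul (Complex.ofRealCLM.contDiff.comp ?_)
    contDiff_const)
  exact ((contDiff_wfac g).norm ℝ (fun θ => wfac_ne g _)).log h0

/-- If a curve `c` in the circle is smooth as a complex function, then so is `f ∘ c`. -/
lemma comp_curve (f : PS χ) (c : ℝ → Circle) (t₀ : ℝ) :
    (fun t => f (c t)) = fun t => pull f (Complex.arg (c t₀ : ℂ) +
      (Complex.log ((c t : ℂ) * ((c t₀)⁻¹ : Circle))).im) := by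
  funext t
  rw [pull, Complex.log_im, ← Circle.coe_mul, Circle.exp_add, Circle.exp_arg, Circle.exp_arg]
  simp

lemma contDiff_comp_mob (g : SU) (f : PS χ) :
    ContDiff ℝ ∞ (fun θ : ℝ => f (mob g (Circle.exp θ))) := by
  rw [contDiff_iff_contDiffAt]
  intro θ₀
  rw [comp_curve f (fun θ => mob g (Circle.exp θ)) θ₀]
  refine (pull_contDiff f).contDiffAt.comp _ (contDiffAt_const.add ?_)
  have h1 : ContDiffAt ℝ ∞ (fun θ : ℝ => ((mob g (Circle.exp θ) : Circle) : ℂ)) θ₀ := by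
    simp only [coe_mob]
    exact (contDiff_nfac g).contDiffAt.mul ((contDiff_wfac g).contDiffAt.inv (wfac_ne g _))
  refine contDiffAt_im_log (h1.mul contDiffAt_const) ?_
  simp [Complex.one_mem_slitPlane]

/-- The principal series representation `π_χ` of `SU(1,1)` on `C^∞(S¹)`:
`(π_χ(g) f)(z) = (a - b̄ z)^{l + ε} (ā - b z̄)^{l - ε} f((ā z - b) / (a - b̄ z))`. -/
def rep (χ : Param) : Representation ℂ SU (PS χ) where
  toFun g :=
    { toFun := fun f => PS.mk (fun z => mult χ g z * f (mob g z))
        ((contDiff_mult g).mul (contDiff_comp_mob g f))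
      map_add' := fun f h => by ext z; simp [mul_add]
      map_smul' := fun c f => by ext z; simp; ring }
  map_one' := by
    ext f z
    simp [mult]
  map_mul' g h := by
    ext f z
    simp [mult_mul, mob_mul, mul_assoc]

lemma rep_apply (g : SU) (f : PS χ) (z : Circle) :
    (rep χ g f) z = mult χ g z * f (mob g z) := rfl

/-! ### The action of the Lie algebra -/

/-- The Lie algebra `sl(2, ℂ)`, the complexification of the Lie algebra of `SU(1,1)`. -/
abbrev sl2 : Type := LieAlgebra.SpecialLinear.sl (Fin 2) ℂ

lemma sl2_11 (X : sl2) : X.1 1 1 = -X.1 0 0 := by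
  have h : Matrix.trace X.1 = 0 := X.2
  rw [Matrix.trace_fin_two] at h
  linear_combination h

lemma sl2_add (X Y : sl2) (i j : Fin 2) : (X + Y).1 i j = X.1 i j + Y.1 i j := rfl
lemma sl2_smul (c : ℂ) (X : sl2) (i j : Fin 2) : (c • X).1 i j = c * X.1 i j := rfl
lemma sl2_bracket (X Y : sl2) : ⁅X, Y⁆.1 = X.1 * Y.1 - Y.1 * X.1 := rfl

/-- The `sl(2, ℂ)`-module structure in which the standard generators `H`, `E`, `F` act by given
operators with `[H, E] = 2E`, `[H, F] = -2F`, `[E, F] = H`. -/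
abbrev sl2Ring {V : Type*} [AddCommGroup V] [Module ℂ V] (H E F : Module.End ℂ V)
    (hHE : H * E - E * H = (2 : ℂ) • E) (hHF : H * F - F * H = (-2 : ℂ) • F)
    (hEF : E * F - F * E = H) : LieRingModule sl2 V where
  bracket X v := X.1 0 0 • H v + X.1 0 1 • E v + X.1 1 0 • F v
  add_lie X Y v := by
    simp only [sl2_add, add_smul]; abel
  lie_add X v w := by
    simp only [map_add, smul_add]; abel
  leibniz_lie X Y v := by
    have hE : H (E v) = E (H v) + (2 : ℂ) • E v := by
      have := LinearMap.congr_fun hHE v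
      simp only [LinearMap.sub_apply, Module.End.mul_apply, LinearMap.smul_apply] at this
      rw [← this]; abel
    have hF : H (F v) = F (H v) + (-2 : ℂ) • F v := by
      have := LinearMap.congr_fun hHF v
      simp only [LinearMap.sub_apply, Module.End.mul_apply, LinearMap.smul_apply] at this
      rw [← this]; abel
    have hG : E (F v) = F (E v) + H v := by
      have := LinearMap.congr_fun hEF v
      simp only [LinearMap.sub_apply, Module.End.mul_apply] at this
      rw [← this]; abel
    simp only [sl2_bracket, Matrix.sub_apply, Matrix.mul_apply,
      Fin.sum_univ_two, sl2_11, map_add, map_smul, hE, hF, hG]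
    module

theorem sl2Module {V : Type*} [AddCommGroup V] [Module ℂ V] (H E F : Module.End ℂ V)
    (hHE : H * E - E * H = (2 : ℂ) • E) (hHF : H * F - F * H = (-2 : ℂ) • F)
    (hEF : E * F - F * E = H) :
    letI := sl2Ring H E F hHE hHF hEF
    LieModule ℂ sl2 V :=
  letI := sl2Ring H E F hHE hHF hEF
  { smul_lie := fun c X v => by
      change (c • X).1 0 0 • H v + (c • X).1 0 1 • E v + (c • X).1 1 0 • F v =
        c • (X.1 0 0 • H v + X.1 0 1 • E v + X.1 1 0 • F v)
      simp only [sl2_smul, mul_smul, smul_add]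
    lie_smul := fun c X v => by
      change X.1 0 0 • H (c • v) + X.1 0 1 • E (c • v) + X.1 1 0 • F (c • v) =
        c • (X.1 0 0 • H v + X.1 0 1 • E v + X.1 1 0 • F v)
      simp only [map_smul]; module }

/-- Multiplication by `z ^ n` on `C^∞(S¹)`. -/
def zmul (n : ℤ) : Module.End ℂ (PS χ) where
  toFun f := PS.mk (fun z => (z : ℂ) ^ n * f z) (by
    refine ContDiff.mul ?_ (pull_contDiff f)
    have : (fun θ : ℝ => ((Circle.exp θ : Circle) : ℂ) ^ n) =
        fun θ : ℝ => ((Circle.exp (n * θ) : Circle) : ℂ) := by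
      funext θ; simp
    rw [this]
    exact contDiff_circleExp.comp (contDiff_const.mul contDiff_id))
  map_add' f g := by ext z; simp [mul_add]
  map_smul' c f := by ext z; simp; ring

@[simp] lemma zmul_apply (n : ℤ) (f : PS χ) (z : Circle) :
    (zmul n f) z = (z : ℂ) ^ n * f z := rfl

lemma hasDerivAt_pull (f : PS χ) (θ : ℝ) :
    HasDerivAt (pull f) ((ddθ f) (Circle.exp θ)) θ := by
  rw [ddθ_exp]
  exact ((pull_contDiff f).differentiable (by simp) θ).hasDerivAt

lemma hasDerivAt_circleExp (θ : ℝ) :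
    HasDerivAt (fun θ : ℝ => (Circle.exp θ : ℂ)) (Complex.I * Circle.exp θ) θ := by
  simp only [Circle.coe_exp]
  have h : HasDerivAt (fun θ : ℝ => (θ : ℂ) * Complex.I) Complex.I θ := by
    simpa using (Complex.ofRealCLM.hasDerivAt (x := θ)).mul_const Complex.I
  simpa [mul_comm] using h.cexp

lemma ddθ_zmul (n : ℤ) (f : PS χ) :
    ddθ (zmul n f) = zmul n (ddθ f) + (Complex.I * n) • zmul n f := by
  ext z
  obtain ⟨θ, rfl⟩ : ∃ θ, Circle.exp θ = z := ⟨_, Circle.exp_arg z⟩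
  have h1 := hasDerivAt_pull (zmul n f) θ
  have h2 := ((hasDerivAt_zpow n _ (Or.inl (Circle.coe_ne_zero (Circle.exp θ)))).comp θ
    (hasDerivAt_circleExp θ)).mul (hasDerivAt_pull f θ)
  refine (h1.unique h2).trans ?_
  have h0 := Circle.coe_ne_zero (Circle.exp θ)
  simp only [PS.add_apply, PS.smul_apply, zmul_apply, pull, Function.comp_apply]
  rw [zpow_sub_one₀ h0]
  field_simp
  ring

/-- `π_χ(H) = 2 (i d/dθ + ε)`. -/
def opH (χ : Param) : Module.End ℂ (PS χ) := (2 : ℂ) • (Complex.I • ddθ + χ.ε • 1)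

/-- `π_χ(E) = e^{-iθ} (i d/dθ - (l - ε))`. -/
def opE (χ : Param) : Module.End ℂ (PS χ) := zmul (-1) * (Complex.I • ddθ - (χ.l - χ.ε) • 1)

/-- `π_χ(F) = -e^{iθ} (i d/dθ + (l + ε))`. -/
def opF (χ : Param) : Module.End ℂ (PS χ) := -(zmul 1 * (Complex.I • ddθ + (χ.l + χ.ε) • 1))

lemma opH_apply (f : PS χ) (z : Circle) :
    (opH χ f) z = 2 * (Complex.I * (ddθ f) z + χ.ε * f z) := rfl
lemma opE_apply (f : PS χ) (z : Circle) :
    (opE χ f) z = (z : ℂ) ^ (-1 : ℤ) * (Complex.I * (ddθ f) z - (χ.l - χ.ε) * f z) := rfl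
lemma opF_apply (f : PS χ) (z : Circle) :
    (opF χ f) z = -((z : ℂ) ^ (1 : ℤ) * (Complex.I * (ddθ f) z + (χ.l + χ.ε) * f z)) := rfl

lemma op_HE (χ : Param) : opH χ * opE χ - opE χ * opH χ = (2 : ℂ) • opE χ := by
  ext f z
  have h0 := Circle.coe_ne_zero z
  have hI := Complex.I_sq
  simp only [opH, opE, opF, LinearMap.sub_apply, LinearMap.neg_apply, Module.End.mul_apply,
    LinearMap.smul_apply, LinearMap.add_apply, Module.End.one_apply, map_sub, map_add, map_neg,
    map_smul, ddθ_zmul, PS.add_apply, PS.sub_apply, PS.neg_apply, PS.smul_apply, zmul_apply,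
    smul_add, smul_sub, zpow_neg, zpow_one]
  push_cast
  field_simp
  ring_nf
  simp only [Complex.I_pow_three, Complex.I_sq]
  ring

lemma op_HF (χ : Param) : opH χ * opF χ - opF χ * opH χ = (-2 : ℂ) • opF χ := by
  ext f z
  have h0 := Circle.coe_ne_zero z
  have hI := Complex.I_sq
  simp only [opH, opE, opF, LinearMap.sub_apply, LinearMap.neg_apply, Module.End.mul_apply,
    LinearMap.smul_apply, LinearMap.add_apply, Module.End.one_apply, map_sub, map_add, map_neg,
    map_smul, ddθ_zmul, PS.add_apply, PS.sub_apply, PS.neg_apply, PS.smul_apply, zmul_apply,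
    smul_add, smul_sub, zpow_neg, zpow_one]
  push_cast
  field_simp
  ring_nf
  simp only [Complex.I_pow_three, Complex.I_sq]
  ring

lemma op_EF (χ : Param) : opE χ * opF χ - opF χ * opE χ = opH χ := by
  ext f z
  have h0 := Circle.coe_ne_zero z
  have hI := Complex.I_sq
  simp only [opH, opE, opF, LinearMap.sub_apply, LinearMap.neg_apply, Module.End.mul_apply,
    LinearMap.smul_apply, LinearMap.add_apply, Module.End.one_apply, map_sub, map_add, map_neg,
    map_smul, ddθ_zmul, PS.add_apply, PS.sub_apply, PS.neg_apply, PS.smul_apply, zmul_apply,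
    smul_add, smul_sub, zpow_neg, zpow_one]
  push_cast
  field_simp
  ring_nf
  simp only [Complex.I_pow_three, Complex.I_sq]
  ring

/-- The derived action of `sl(2, ℂ)` on `C^∞(S¹)`; see `hasDerivAt_rep` below. -/
instance : LieRingModule sl2 (PS χ) :=
  sl2Ring (opH χ) (opE χ) (opF χ) (op_HE χ) (op_HF χ) (op_EF χ)
instance : LieModule ℂ sl2 (PS χ) :=
  sl2Module (opH χ) (opE χ) (opF χ) (op_HE χ) (op_HF χ) (op_EF χ)

lemma lie_eq (X : sl2) (f : PS χ) :
    ⁅X, f⁆ = X.1 0 0 • opH χ f + X.1 0 1 • opE χ f + X.1 1 0 • opF χ f := rfl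

lemma hasDerivAt_rep_aux (X : sl2) (hX : X.1 1 0 = star (X.1 0 1)) (hX' : X.1 1 1 = star (X.1 0 0))
    (γ : ℝ → SU) (h0 : γ 0 = 1) (hd : ∀ i j, HasDerivAt (fun t => ent (γ t) i j) (X.1 i j) 0)
    (f : PS χ) (z : Circle) :
    HasDerivAt (fun t => (rep χ (γ t) f) z) (⁅X, f⁆ z) 0 := by
  have hz : (z : ℂ) ≠ 0 := Circle.coe_ne_zero z
  have hzs : star (z : ℂ) = (z : ℂ)⁻¹ := by
    rw [← Circle.coe_inv, Circle.coe_inv_eq_conj]; rfl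
  set p : ℂ := X.1 0 0 - X.1 1 0 * z with hp
  have hps : star p = -X.1 0 0 - X.1 0 1 * (z : ℂ)⁻¹ := by
    rw [hp, star_sub, star_mul', ← hX', hX, star_star, hzs, sl2_11]
  have hw : HasDerivAt (fun t => wfac (γ t) z) p 0 := (hd 0 0).sub ((hd 1 0).mul_const _)
  have hn : HasDerivAt (fun t => nfac (γ t) z) (z * star p) 0 := by
    refine (((hd 1 1).mul_const (z : ℂ)).sub (hd 0 1)).congr_deriv ?_
    rw [hps, sl2_11]; field_simp
  have hw0 : wfac (γ 0) z = 1 := by rw [h0, wfac_one]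
  have hc0 : mob (γ 0) z = z := by rw [h0, mob_one]
  have hm : HasDerivAt (fun t => ((mob (γ t) z : Circle) : ℂ)) (z * (star p - p)) 0 := by
    have := hn.div hw (wfac_ne _ _)
    refine this.congr_deriv ?_
    have hn0 : nfac (γ 0) z = z := by rw [nfac_eq, hw0]; simp
    rw [hw0, hn0]; ring
  have h1 : HasDerivAt (fun t => f (mob (γ t) z)) (-(2 * p.im : ℝ) * (ddθ f) z) 0 := by
    rw [comp_curve f (fun t => mob (γ t) z) 0]
    have hl : HasDerivAt (fun t : ℝ => Complex.log (((mob (γ t) z : Circle) : ℂ) *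
        (((mob (γ 0) z)⁻¹ : Circle) : ℂ))) (star p - p) 0 := by
      have := (hm.mul_const (((mob (γ 0) z)⁻¹ : Circle) : ℂ)).clog_real (by
        simp [Complex.one_mem_slitPlane])
      refine this.congr_deriv ?_
      rw [hc0, Circle.coe_inv, mul_inv_cancel₀ hz]
      field_simp
    have hi : HasDerivAt (fun t : ℝ => (Complex.arg ((mob (γ 0) z : Circle) : ℂ)) +
        (Complex.log (((mob (γ t) z : Circle) : ℂ) *
        (((mob (γ 0) z)⁻¹ : Circle) : ℂ))).im) (-(2 * p.im)) 0 := by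
      have := ((Complex.imCLM.hasFDerivAt).comp_hasDerivAt (0 : ℝ) hl).const_add
        (Complex.arg ((mob (γ 0) z : Circle) : ℂ))
      refine this.congr_deriv ?_
      simp
      ring
    have hf := hasDerivAt_pull f (Complex.arg ((mob (γ 0) z : Circle) : ℂ) +
      (Complex.log (((mob (γ 0) z : Circle) : ℂ) * (((mob (γ 0) z)⁻¹ : Circle) : ℂ))).im)
    have := hf.scomp (0 : ℝ) hi
    refine this.congr_deriv ?_
    rw [← Circle.coe_mul, mul_inv_cancel, hc0]
    simp [Circle.exp_arg]
  have h2 : HasDerivAt (fun t => mult χ (γ t) z)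
      ((2 * χ.l - 2 * χ.ε) * (p.re : ℂ) + 2 * χ.ε * p) 0 := by
    have e1 : (fun t => mult χ (γ t) z) = fun t => Complex.exp
        ((((Complex.log (wfac (γ t) z)).re : ℝ) : ℂ) * (2 * χ.l - 2 * χ.ε)) *
          wfac (γ t) z ^ (χ.e : ℕ) := by
      funext t
      rw [mult, Complex.cpow_def_of_ne_zero
        (by exact_mod_cast norm_ne_zero_iff.2 (wfac_ne (γ t) z)),
        ← Complex.ofReal_log (norm_nonneg _), Complex.log_re]
    rw [e1]
    have hl := hw.clog_real (by rw [hw0]; exact Complex.one_mem_slitPlane)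
    have hr := ((Complex.reCLM.hasFDerivAt).comp_hasDerivAt (0 : ℝ) hl).ofReal_comp
    have := ((hr.mul_const (2 * χ.l - 2 * χ.ε)).cexp).mul (hw.pow (χ.e : ℕ))
    refine this.congr_deriv ?_
    simp [hw0, Param.ε]
    ring
  have := h2.mul h1
  refine this.congr_deriv ?_
  have hm0 : mult χ (γ 0) z = 1 := by rw [h0, mult]; simp
  rw [hm0, hc0, lie_eq]
  simp only [PS.add_apply, PS.smul_apply, opH_apply, opE_apply, opF_apply, zpow_neg, zpow_one]
  have hre : (p.re : ℂ) = (p + star p) / 2 := by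
    rw [← starRingEnd_apply, Complex.add_conj]; push_cast; ring
  have him : ((-(2 * p.im : ℝ) : ℂ)) = Complex.I * (p - star p) := by
    rw [← starRingEnd_apply, Complex.sub_conj]
    push_cast
    linear_combination (-(2 * (p.im : ℂ))) * Complex.I_sq
  rw [him, hre, hps, hp]
  ring

open scoped Matrix.Norms.Operator in
/-- For `X` in the Lie algebra of `SU(1,1)`, the operator of `X` on `C^∞(S¹)` is
`(d/dt) π_χ(exp(tX))` at `t = 0`. -/
theorem hasDerivAt_rep (X : sl2) (hX : X.1 1 0 = star (X.1 0 1)) (hX' : X.1 1 1 = star (X.1 0 0))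
    (γ : ℝ → SU)
    (hγ : ∀ t, ((γ t : Matrix.SpecialLinearGroup (Fin 2) ℂ) : Matrix (Fin 2) (Fin 2) ℂ) =
      NormedSpace.exp (t • X.1)) (f : PS χ) (z : Circle) :
    HasDerivAt (fun t => (rep χ (γ t) f) z) (⁅X, f⁆ z) 0 := by
  refine hasDerivAt_rep_aux X hX hX' γ ?_ ?_ f z
  · apply Subtype.ext; apply Subtype.ext
    rw [hγ]; simp
  · intro i j
    have h := hasDerivAt_exp_smul_const (𝕂 := ℝ) X.1 (0 : ℝ)
    rw [zero_smul, NormedSpace.exp_zero, one_mul] at h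
    have h3 := (Matrix.entryLinearMap ℝ ℂ i j).toContinuousLinearMap.hasFDerivAt.comp_hasDerivAt
      (0 : ℝ) h
    have e : (fun t => ent (γ t) i j) = fun t : ℝ => NormedSpace.exp (t • X.1) i j := by
      funext t; rw [← hγ]; rfl
    rw [e]
    exact h3

/-! ### `K`-finite vectors and `(𝔤, K)`-submodules -/

lemma rep_diagK (u : Circle) (f : PS χ) (z : Circle) :
    (rep χ (diagK u) f) z = (u : ℂ) ^ (χ.e : ℕ) * f (z * (u⁻¹ * u⁻¹)) := by
  have h00 : ent (diagK u) 0 0 = u := rfl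
  have h01 : ent (diagK u) 0 1 = 0 := rfl
  have h10 : ent (diagK u) 1 0 = 0 := rfl
  have h11 : ent (diagK u) 1 1 = ((u⁻¹ : Circle) : ℂ) := rfl
  have hm : mob (diagK u) z = z * (u⁻¹ * u⁻¹) := by
    ext
    rw [coe_mob, nfac, wfac, h00, h01, h10, h11]
    simp only [Circle.coe_mul, Circle.coe_inv]
    have := Circle.coe_ne_zero u
    field_simp
    ring
  rw [rep_apply, hm, mult, wfac, h00, h10, zero_mul, sub_zero, Circle.norm_coe, Complex.ofReal_one,
    Complex.one_cpow, one_mul]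

lemma ddθ_rep_diagK (u : Circle) (f : PS χ) :
    ddθ (rep χ (diagK u) f) = rep χ (diagK u) (ddθ f) := by
  ext z
  rw [rep_diagK]
  change deriv (fun t : ℝ => (rep χ (diagK u) f) (z * Circle.exp t)) 0 =
    _ * deriv (fun t : ℝ => f (z * (u⁻¹ * u⁻¹) * Circle.exp t)) 0
  simp only [rep_diagK]
  rw [deriv_const_mul_field]
  congr 3
  funext t
  exact congrArg f.1 (mul_right_comm z _ _)

lemma zmul_rep_diagK (n : ℤ) (u : Circle) (f : PS χ) :
    zmul n (rep χ (diagK u) f) = (u : ℂ) ^ (2 * n) • rep χ (diagK u) (zmul n f) := by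
  ext z
  have := Circle.coe_ne_zero u
  simp only [PS.smul_apply, zmul_apply, rep_diagK, Circle.coe_mul, Circle.coe_inv, mul_zpow,
    inv_zpow, zpow_mul, zpow_ofNat]
  rw [sq, mul_zpow]
  field_simp

lemma opH_rep_diagK (u : Circle) (f : PS χ) :
    opH χ (rep χ (diagK u) f) = rep χ (diagK u) (opH χ f) := by
  simp only [opH, LinearMap.smul_apply, LinearMap.add_apply, Module.End.one_apply, map_add,
    map_smul, ddθ_rep_diagK]

lemma opE_rep_diagK (u : Circle) (f : PS χ) :
    opE χ (rep χ (diagK u) f) = (u : ℂ) ^ (2 * (-1) : ℤ) • rep χ (diagK u) (opE χ f) := by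
  simp only [opE, LinearMap.smul_apply, LinearMap.sub_apply, Module.End.one_apply, map_sub,
    Module.End.mul_apply, map_smul, ddθ_rep_diagK, zmul_rep_diagK]
  module

lemma opF_rep_diagK (u : Circle) (f : PS χ) :
    opF χ (rep χ (diagK u) f) = (u : ℂ) ^ (2 * 1 : ℤ) • rep χ (diagK u) (opF χ f) := by
  simp only [opF, LinearMap.smul_apply, LinearMap.add_apply, LinearMap.neg_apply,
    Module.End.one_apply, map_add, map_neg, Module.End.mul_apply, map_smul, ddθ_rep_diagK,
    zmul_rep_diagK]
  module

/-- A subspace invariant under `K_ℝ`. -/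
def KInvariant (U : Submodule ℂ (PS χ)) : Prop :=
  ∀ k ∈ KR, ∀ f ∈ U, rep χ k f ∈ U

lemma KInvariant.lieImage {U : Submodule ℂ (PS χ)} (hU : KInvariant U) :
    KInvariant (U.map (opH χ) ⊔ U.map (opE χ) ⊔ U.map (opF χ)) := by
  have key : ∀ (T : Module.End ℂ (PS χ)) (c : Circle → ℂ), (∀ u, c u ≠ 0) →
      (∀ u f, T (rep χ (diagK u) f) = c u • rep χ (diagK u) (T f)) → KInvariant (U.map T) := by
    rintro T c hc hT _ ⟨u, rfl⟩ _ ⟨f, hf, rfl⟩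
    refine ⟨(c u)⁻¹ • rep χ (diagK u) f, U.smul_mem _ (hU _ ⟨u, rfl⟩ f hf), ?_⟩
    rw [map_smul, hT, smul_smul, inv_mul_cancel₀ (hc u), one_smul]
  have hs : ∀ A B : Submodule ℂ (PS χ), KInvariant A → KInvariant B → KInvariant (A ⊔ B) := by
    intro A B hA hB k hk f hf
    obtain ⟨a, ha, b, hb, rfl⟩ := Submodule.mem_sup.1 hf
    rw [map_add]
    exact Submodule.add_mem_sup (hA k hk a ha) (hB k hk b hb)
  refine hs _ _ (hs _ _ (key _ (fun _ => 1) (fun _ => one_ne_zero) fun u f => ?_)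
    (key _ _ (fun u => zpow_ne_zero _ (Circle.coe_ne_zero u)) opE_rep_diagK))
    (key _ _ (fun u => zpow_ne_zero _ (Circle.coe_ne_zero u)) opF_rep_diagK)
  rw [opH_rep_diagK, one_smul]

/-- The `(𝔤, K)`-module `C^∞(S¹)_fini` of `K_ℝ`-finite vectors: the vectors that lie in a
finite-dimensional `K_ℝ`-invariant subspace. -/
def HC (χ : Param) : LieSubmodule ℂ sl2 (PS χ) where
  carrier := {f | ∃ U : Submodule ℂ (PS χ), FiniteDimensional ℂ U ∧ KInvariant U ∧ f ∈ U}
  add_mem' := by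
    rintro f g ⟨U, hU, hKU, hf⟩ ⟨W, hW, hKW, hg⟩
    refine ⟨U ⊔ W, inferInstance, ?_, Submodule.add_mem_sup hf hg⟩
    intro k hk x hx
    obtain ⟨a, ha, b, hb, rfl⟩ := Submodule.mem_sup.1 hx
    rw [map_add]
    exact Submodule.add_mem_sup (hKU k hk a ha) (hKW k hk b hb)
  zero_mem' := ⟨⊥, inferInstance, by
    intro k _ f hf
    rw [Submodule.mem_bot] at hf ⊢
    rw [hf, map_zero], Submodule.zero_mem _⟩
  smul_mem' := by
    rintro c f ⟨U, hU, hKU, hf⟩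
    exact ⟨U, hU, hKU, U.smul_mem c hf⟩
  lie_mem := by
    rintro X f ⟨U, hU, hKU, hf⟩
    refine ⟨_, inferInstance, hKU.lieImage, ?_⟩
    rw [lie_eq]
    exact Submodule.add_mem_sup (Submodule.add_mem_sup
      (Submodule.smul_mem _ _ (Submodule.mem_map_of_mem hf))
      (Submodule.smul_mem _ _ (Submodule.mem_map_of_mem hf)))
      (Submodule.smul_mem _ _ (Submodule.mem_map_of_mem hf))

/-- `N` is a `(𝔤, K)`-submodule of `C^∞(S¹)_fini`. -/
def IsGK (N : LieSubmodule ℂ sl2 (PS χ)) : Prop :=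
  N ≤ HC χ ∧ KInvariant (N : Submodule ℂ (PS χ))

/-- The function `v_n = z^{-n}`. -/
def vec (χ : Param) (n : ℤ) : PS χ := zmul (-n) (PS.mk (fun _ => 1) contDiff_const)

lemma vec_apply (n : ℤ) (z : Circle) : (vec χ n) z = (z : ℂ) ^ (-n) := by simp [vec]

lemma zmul_vec (m n : ℤ) : zmul m (vec χ n) = vec χ (n - m) := by
  ext z
  simp only [zmul_apply, vec_apply]
  rw [← zpow_add₀ (Circle.coe_ne_zero z)]
  congr 1; ring

lemma ddθ_vec (n : ℤ) : ddθ (vec χ n) = (-(Complex.I * n)) • vec χ n := by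
  have h : ddθ (PS.mk (fun _ => 1) contDiff_const : PS χ) = 0 := by
    ext z
    change deriv (fun _ : ℝ => (1 : ℂ)) 0 = 0
    simp
  rw [vec, ddθ_zmul, h, map_zero, zero_add]
  push_cast
  congr 1; ring

lemma opH_vec (n : ℤ) : opH χ (vec χ n) = (2 * (n + χ.ε)) • vec χ n := by
  simp only [opH, LinearMap.smul_apply, LinearMap.add_apply, Module.End.one_apply, ddθ_vec,
    smul_smul, ← add_smul]
  congr 1
  linear_combination (-2 * (n : ℂ)) * Complex.I_sq

lemma opE_vec (n : ℤ) : opE χ (vec χ n) = (n - χ.l + χ.ε) • vec χ (n + 1) := by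
  simp only [opE, Module.End.mul_apply, LinearMap.smul_apply, LinearMap.sub_apply,
    Module.End.one_apply, ddθ_vec, smul_smul, ← sub_smul, map_smul, zmul_vec]
  rw [sub_neg_eq_add]
  congr 1
  linear_combination (-(n : ℂ)) * Complex.I_sq

lemma opF_vec (n : ℤ) : opF χ (vec χ n) = (-(n + χ.l + χ.ε)) • vec χ (n - 1) := by
  simp only [opF, Module.End.mul_apply, LinearMap.smul_apply, LinearMap.add_apply,
    LinearMap.neg_apply, Module.End.one_apply, ddθ_vec, smul_smul, ← add_smul, map_smul, zmul_vec,
    ← neg_smul]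
  congr 1
  linear_combination (n : ℂ) * Complex.I_sq

/-- The span of the `v_n`, `n ∈ S`, for a set `S` of integers that is stable under the action. -/
def spanVec (χ : Param) (S : Set ℤ)
    (hE : ∀ n ∈ S, n + 1 ∈ S ∨ (n : ℂ) - χ.l + χ.ε = 0)
    (hF : ∀ n ∈ S, n - 1 ∈ S ∨ (n : ℂ) + χ.l + χ.ε = 0) : LieSubmodule ℂ sl2 (PS χ) where
  toSubmodule := Submodule.span ℂ (vec χ '' S)
  lie_mem := by
    intro X f hf
    have hf' : f ∈ Submodule.span ℂ (vec χ '' S) := hf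
    change ⁅X, f⁆ ∈ Submodule.span ℂ (vec χ '' S)
    induction hf' using Submodule.span_induction with
    | mem x hx =>
      obtain ⟨n, hn, rfl⟩ := hx
      rw [lie_eq, opH_vec, opE_vec, opF_vec]
      have h : ∀ m ∈ S, vec χ m ∈ Submodule.span ℂ (vec χ '' S) := fun m hm =>
        Submodule.subset_span ⟨m, hm, rfl⟩
      refine Submodule.add_mem _ (Submodule.add_mem _ ?_ ?_) ?_
      · exact Submodule.smul_mem _ _ (Submodule.smul_mem _ _ (h n hn))
      · rcases hE n hn with h1 | h1
        · exact Submodule.smul_mem _ _ (Submodule.smul_mem _ _ (h _ h1))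
        · rw [h1, zero_smul, smul_zero]; exact Submodule.zero_mem _
      · rcases hF n hn with h1 | h1
        · exact Submodule.smul_mem _ _ (Submodule.smul_mem _ _ (h _ h1))
        · rw [h1, neg_zero, zero_smul, smul_zero]; exact Submodule.zero_mem _
    | zero => rw [lie_zero]; exact Submodule.zero_mem _
    | add x y _ _ hx hy => rw [lie_add]; exact Submodule.add_mem _ (hx ‹_›) (hy ‹_›)
    | smul c x _ hx => rw [lie_smul]; exact Submodule.smul_mem _ _ (hx ‹_›)

lemma Param.two_ε (χ : Param) : 2 * χ.ε = (((χ.e : ℕ) : ℤ) : ℂ) := by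
  simp [Param.ε]; ring

/-- `M⁺`, the span of the `v_n` with `n ≥ -(l + ε)`, where `m = l + ε` is an integer. -/
def Mplus (χ : Param) (m : ℤ) (h : χ.l + χ.ε = m) : LieSubmodule ℂ sl2 (PS χ) :=
  spanVec χ {n | -m ≤ n} (fun n hn => Or.inl (by simp only [Set.mem_ofPred_eq] at *; omega))
    (fun n hn => by
      simp only [Set.mem_ofPred_eq] at *
      rcases eq_or_lt_of_le hn with h1 | h1
      · right; rw [add_assoc, h, ← h1]; push_cast; ring
      · left; omega)

/-- `M⁻`, the span of the `v_n` with `n ≤ l - ε = m - 2ε`, where `m = l + ε` is an integer. -/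
def Mminus (χ : Param) (m : ℤ) (h : χ.l + χ.ε = m) : LieSubmodule ℂ sl2 (PS χ) :=
  spanVec χ {n | n ≤ m - ((χ.e : ℕ) : ℤ)}
    (fun n hn => by
      simp only [Set.mem_ofPred_eq] at *
      rcases eq_or_lt_of_le hn with h1 | h1
      · right; rw [h1]; push_cast
        have := χ.two_ε
        push_cast at this
        linear_combination this - h
      · left; omega)
    (fun n hn => Or.inl (by simp only [Set.mem_ofPred_eq] at *; omega))

/-- The intersection of `M⁺` and `M⁻`, denoted `F_{2l}` for `l ≥ 0`. -/
def Fsub (χ : Param) (m : ℤ) (h : χ.l + χ.ε = m) : LieSubmodule ℂ sl2 (PS χ) :=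
  Mplus χ m h ⊓ Mminus χ m h

/-- `D_l⁺`, the closure of `M⁺` in `C^∞(S¹)`. For `l ≤ -1` it is the antiholomorphic discrete
series, for `l = -1/2` its limit. -/
def Dplus (χ : Param) (m : ℤ) (h : χ.l + χ.ε = m) : Submodule ℂ (PS χ) :=
  (Mplus χ m h : Submodule ℂ (PS χ)).topologicalClosure

/-- `D_l⁻`, the closure of `M⁻` in `C^∞(S¹)`. For `l ≤ -1` it is the holomorphic discrete
series, for `l = -1/2` its limit. -/
def Dminus (χ : Param) (m : ℤ) (h : χ.l + χ.ε = m) : Submodule ℂ (PS χ) :=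
  (Mminus χ m h : Submodule ℂ (PS χ)).topologicalClosure

/-- The subquotient `N₂ / N₁` of a module, for submodules `N₁ ≤ N₂`. -/
abbrev SubQuot {V : Type} [AddCommGroup V] [Module ℂ V] [LieRingModule sl2 V] [LieModule ℂ sl2 V]
    (N₁ N₂ : LieSubmodule ℂ sl2 V) : Type :=
  N₂ ⧸ LieSubmodule.comap N₂.incl N₁

/-- The image of `N ∩ N₂` in `N₂ / N₁`; it is `N / N₁` when `N₁ ≤ N ≤ N₂`. -/
def SubQuotIm {V : Type} [AddCommGroup V] [Module ℂ V] [LieRingModule sl2 V] [LieModule ℂ sl2 V]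
    (N₁ N₂ N : LieSubmodule ℂ sl2 V) : LieSubmodule ℂ sl2 (SubQuot N₁ N₂) :=
  LieSubmodule.map (LieSubmodule.Quotient.mk' (LieSubmodule.comap N₂.incl N₁))
    (LieSubmodule.comap N₂.incl N)

/-! ### The standard irreducible `sl(2, ℂ)`-modules -/

/-- The module `F_d` with basis `v_0, …, v_d`. -/
def FMod (d : ℕ) : Type := Fin (d + 1) →₀ ℂ

namespace FMod
variable (d : ℕ)

instance : AddCommGroup (FMod d) := inferInstanceAs (AddCommGroup (Fin (d + 1) →₀ ℂ))
instance : Module ℂ (FMod d) := inferInstanceAs (Module ℂ (Fin (d + 1) →₀ ℂ))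

/-- The basis vector `v_k`, and `0` for `k > d`. -/
def v (k : ℕ) : FMod d :=
  if hk : k < d + 1 then Finsupp.single (⟨k, hk⟩ : Fin (d + 1)) (1 : ℂ) else 0

/-- The linear map with given values on the basis `v_0, …, v_d`. -/
def lift (u : ℕ → FMod d) : Module.End ℂ (FMod d) :=
  Finsupp.linearCombination (M := FMod d) ℂ (fun k : Fin (d + 1) => u k)

lemma lift_v (u : ℕ → FMod d) (k : ℕ) (hk : k < d + 1) : lift d u (v d k) = u k := by
  have h : v d k = Finsupp.single (⟨k, hk⟩ : Fin (d + 1)) (1 : ℂ) := dif_pos hk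
  rw [h]
  exact (Finsupp.linearCombination_single ℂ _ _).trans (one_smul _ _)

lemma v_ge (k : ℕ) (hk : ¬ k < d + 1) : v d k = 0 := dif_neg hk

lemma hom_ext {S T : Module.End ℂ (FMod d)} (h : ∀ k, k < d + 1 → S (v d k) = T (v d k)) :
    S = T := by
  refine Finsupp.lhom_ext' (R := ℂ) (α := Fin (d + 1)) (M := ℂ) fun k => ?_
  refine LinearMap.ext_ring ?_
  have h1 := h k k.2
  have h2 : v d k = Finsupp.single k (1 : ℂ) := dif_pos k.2
  rw [h2] at h1
  exact h1

/-- `H v_k = (-d + 2k) v_k`. -/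
def H : Module.End ℂ (FMod d) := lift d fun k => (-(d : ℂ) + 2 * k) • v d k
/-- `E v_k = v_{k+1}` for `k < d` and `E v_d = 0`. -/
def E : Module.End ℂ (FMod d) := lift d fun k => v d (k + 1)
/-- `F v_k = k (d + 1 - k) v_{k-1}` for `k > 0` and `F v_0 = 0`. -/
def F : Module.End ℂ (FMod d) := lift d fun k => ((k : ℂ) * (d + 1 - k)) • v d (k - 1)

lemma H_v (k : ℕ) : H d (v d k) = (-(d : ℂ) + 2 * k) • v d k := by
  by_cases hk : k < d + 1
  · exact lift_v d _ k hk
  · simp [v_ge d k hk]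
lemma E_v (k : ℕ) : E d (v d k) = v d (k + 1) := by
  by_cases hk : k < d + 1
  · exact lift_v d _ k hk
  · simp [v_ge d k hk, v_ge d (k + 1) (by omega)]
lemma F_v (k : ℕ) (hk : k ≤ d + 1) : F d (v d k) = ((k : ℂ) * (d + 1 - k)) • v d (k - 1) := by
  by_cases hk' : k < d + 1
  · exact lift_v d _ k hk'
  · have : k = d + 1 := by omega
    subst this
    rw [v_ge d _ hk', map_zero]
    simp

lemma HE : H d * E d - E d * H d = (2 : ℂ) • E d := by
  refine hom_ext d fun k _ => ?_
  simp only [LinearMap.sub_apply, Module.End.mul_apply, LinearMap.smul_apply, H_v, E_v, map_smul]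
  push_cast
  module
lemma HF : H d * F d - F d * H d = (-2 : ℂ) • F d := by
  refine hom_ext d fun k hk => ?_
  simp only [LinearMap.sub_apply, Module.End.mul_apply, LinearMap.smul_apply, H_v,
    F_v d k hk.le, map_smul]
  rcases k with _ | k
  · simp
  · push_cast; module
lemma EF : E d * F d - F d * E d = H d := by
  refine hom_ext d fun k hk => ?_
  simp only [LinearMap.sub_apply, Module.End.mul_apply, E_v, H_v,
    F_v d k hk.le, F_v d (k + 1) (by omega), map_smul]
  rcases k with _ | k
  · simp
  · push_cast; module

instance : LieRingModule sl2 (FMod d) := sl2Ring (H d) (E d) (F d) (HE d) (HF d) (EF d)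
instance : LieModule ℂ sl2 (FMod d) := sl2Module (H d) (E d) (F d) (HE d) (HF d) (EF d)

end FMod

/-- The lowest weight module `V_w` with basis `v_0, v_1, …` and lowest weight `w`. -/
def LowMod (_w : ℂ) : Type := ℕ →₀ ℂ

namespace LowMod
variable (w : ℂ)

instance : AddCommGroup (LowMod w) := inferInstanceAs (AddCommGroup (ℕ →₀ ℂ))
instance : Module ℂ (LowMod w) := inferInstanceAs (Module ℂ (ℕ →₀ ℂ))

/-- The basis vector `v_k`. -/
def v (k : ℕ) : LowMod w := Finsupp.single k (1 : ℂ)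

/-- The linear map with given values on the basis. -/
def lift (u : ℕ → LowMod w) : Module.End ℂ (LowMod w) :=
  Finsupp.linearCombination (M := LowMod w) ℂ u

lemma lift_v (u : ℕ → LowMod w) (k : ℕ) : lift w u (v w k) = u k :=
  (Finsupp.linearCombination_single ℂ _ _).trans (one_smul _ _)

lemma hom_ext {S T : Module.End ℂ (LowMod w)} (h : ∀ k, S (v w k) = T (v w k)) : S = T :=
  Finsupp.lhom_ext' (R := ℂ) (α := ℕ) (M := ℂ) fun k => LinearMap.ext_ring (h k)

/-- `H v_k = (w + 2k) v_k`. -/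
def H : Module.End ℂ (LowMod w) := lift w fun k => (w + 2 * k) • v w k
/-- `E v_k = v_{k+1}`. -/
def E : Module.End ℂ (LowMod w) := lift w fun k => v w (k + 1)
/-- `F v_k = -k (w + k - 1) v_{k-1}` for `k > 0` and `F v_0 = 0`. -/
def F : Module.End ℂ (LowMod w) := lift w fun k => (-(k : ℂ) * (w + k - 1)) • v w (k - 1)

lemma H_v (k : ℕ) : H w (v w k) = (w + 2 * k) • v w k := lift_v w _ k
lemma E_v (k : ℕ) : E w (v w k) = v w (k + 1) := lift_v w _ k
lemma F_v (k : ℕ) : F w (v w k) = (-(k : ℂ) * (w + k - 1)) • v w (k - 1) := lift_v w _ k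

lemma HE : H w * E w - E w * H w = (2 : ℂ) • E w := by
  refine hom_ext w fun k => ?_
  simp only [LinearMap.sub_apply, Module.End.mul_apply, LinearMap.smul_apply, H_v, E_v, map_smul]
  push_cast
  module
lemma HF : H w * F w - F w * H w = (-2 : ℂ) • F w := by
  refine hom_ext w fun k => ?_
  simp only [LinearMap.sub_apply, Module.End.mul_apply, LinearMap.smul_apply, H_v, F_v, map_smul]
  rcases k with _ | k
  · simp
  · push_cast; module
lemma EF : E w * F w - F w * E w = H w := by
  refine hom_ext w fun k => ?_
  simp only [LinearMap.sub_apply, Module.End.mul_apply, E_v, H_v, F_v, map_smul]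
  rcases k with _ | k
  · simp
  · push_cast; module

instance : LieRingModule sl2 (LowMod w) := sl2Ring (H w) (E w) (F w) (HE w) (HF w) (EF w)
instance : LieModule ℂ sl2 (LowMod w) := sl2Module (H w) (E w) (F w) (HE w) (HF w) (EF w)

end LowMod

/-- The highest weight module with basis `v_0, v_1, …` and highest weight `w`. -/
def HighMod (_w : ℂ) : Type := ℕ →₀ ℂ

namespace HighMod
variable (w : ℂ)

instance : AddCommGroup (HighMod w) := inferInstanceAs (AddCommGroup (ℕ →₀ ℂ))
instance : Module ℂ (HighMod w) := inferInstanceAs (Module ℂ (ℕ →₀ ℂ))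

/-- The basis vector `v_k`. -/
def v (k : ℕ) : HighMod w := Finsupp.single k (1 : ℂ)

/-- The linear map with given values on the basis. -/
def lift (u : ℕ → HighMod w) : Module.End ℂ (HighMod w) :=
  Finsupp.linearCombination (M := HighMod w) ℂ u

lemma lift_v (u : ℕ → HighMod w) (k : ℕ) : lift w u (v w k) = u k :=
  (Finsupp.linearCombination_single ℂ _ _).trans (one_smul _ _)

lemma hom_ext {S T : Module.End ℂ (HighMod w)} (h : ∀ k, S (v w k) = T (v w k)) : S = T :=
  Finsupp.lhom_ext' (R := ℂ) (α := ℕ) (M := ℂ) fun k => LinearMap.ext_ring (h k)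

/-- `H v_k = (w - 2k) v_k`. -/
def H : Module.End ℂ (HighMod w) := lift w fun k => (w - 2 * k) • v w k
/-- `E v_k = k (w - k + 1) v_{k-1}` for `k > 0` and `E v_0 = 0`. -/
def E : Module.End ℂ (HighMod w) := lift w fun k => ((k : ℂ) * (w - k + 1)) • v w (k - 1)
/-- `F v_k = v_{k+1}`. -/
def F : Module.End ℂ (HighMod w) := lift w fun k => v w (k + 1)

lemma H_v (k : ℕ) : H w (v w k) = (w - 2 * k) • v w k := lift_v w _ k
lemma E_v (k : ℕ) : E w (v w k) = ((k : ℂ) * (w - k + 1)) • v w (k - 1) := lift_v w _ k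
lemma F_v (k : ℕ) : F w (v w k) = v w (k + 1) := lift_v w _ k

lemma HE : H w * E w - E w * H w = (2 : ℂ) • E w := by
  refine hom_ext w fun k => ?_
  simp only [LinearMap.sub_apply, Module.End.mul_apply, LinearMap.smul_apply, H_v, E_v, map_smul]
  rcases k with _ | k
  · simp
  · push_cast; module
lemma HF : H w * F w - F w * H w = (-2 : ℂ) • F w := by
  refine hom_ext w fun k => ?_
  simp only [LinearMap.sub_apply, Module.End.mul_apply, LinearMap.smul_apply, H_v, F_v, map_smul]
  push_cast
  module
lemma EF : E w * F w - F w * E w = H w := by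
  refine hom_ext w fun k => ?_
  simp only [LinearMap.sub_apply, Module.End.mul_apply, E_v, H_v, F_v, map_smul]
  rcases k with _ | k
  · simp
  · push_cast; module

instance : LieRingModule sl2 (HighMod w) := sl2Ring (H w) (E w) (F w) (HE w) (HF w) (EF w)
instance : LieModule ℂ sl2 (HighMod w) := sl2Module (H w) (E w) (F w) (HE w) (HF w) (EF w)

end HighMod

/-! ### Subrepresentations, irreducibility, length, admissibility -/

section Topological

variable {G V : Type} [Group G] [AddCommGroup V] [Module ℂ V] [TopologicalSpace V]

/-- A subrepresentation: a closed invariant subspace. -/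
def IsSubrep (ρ : Representation ℂ G V) (W : Submodule ℂ V) : Prop :=
  IsClosed (W : Set V) ∧ ∀ g, ∀ v ∈ W, ρ g v ∈ W

/-- The representation is nonzero and has no closed invariant subspace other than `0` and `V`. -/
def IsIrred (ρ : Representation ℂ G V) : Prop :=
  Nontrivial V ∧ ∀ W : Submodule ℂ V, IsSubrep ρ W → W = ⊥ ∨ W = ⊤

/-- `A ⊂ B` are subrepresentations and the representation on `B / A` is irreducible, i.e. `A ≠ B`
and there is no subrepresentation strictly between `A` and `B`. -/
def IsIrredQuot (ρ : Representation ℂ G V) (A B : Submodule ℂ V) : Prop :=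
  IsSubrep ρ A ∧ IsSubrep ρ B ∧ A < B ∧
    ∀ W : Submodule ℂ V, IsSubrep ρ W → A ≤ W → W ≤ B → W = A ∨ W = B

/-- Finite length: every increasing chain of subrepresentations breaks off, and there is a finite
chain `0 = V_0 ⊂ V_1 ⊂ ⋯ ⊂ V_N = V` of subrepresentations with irreducible quotients. -/
def HasFiniteLength (ρ : Representation ℂ G V) : Prop :=
  (∀ c : ℕ → Submodule ℂ V, (∀ n, IsSubrep ρ (c n)) → Monotone c → ∃ N, ∀ n, N ≤ n → c n = c N) ∧
  ∃ (N : ℕ) (c : ℕ → Submodule ℂ V), c 0 = ⊥ ∧ c N = ⊤ ∧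
    ∀ i < N, IsIrredQuot ρ (c i) (c (i + 1))

/-- Admissibility with respect to a subgroup `K`: every finite-dimensional irreducible
representation of `K` occurs with finite multiplicity. -/
def IsAdmissible (ρ : Representation ℂ G V) (K : Subgroup G) : Prop :=
  ∀ (U : Type) [AddCommGroup U] [Module ℂ U] [FiniteDimensional ℂ U] (τ : Representation ℂ K U),
    τ.IsIrreducible →
      FiniteDimensional ℂ (Representation.IntertwiningMap τ (ρ.comp K.subtype))

end Topological

end SU11

end

open SU11

noncomputable section

namespace SU11

open Filter Topology

variable {χ : Param}

/-! ### Fourier coefficients of smooth functions -/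

/-! Everything reduces to the combinatorics of sets of weights. The functions `v_n` are eigenvectors
of `K_ℝ` with pairwise distinct characters `u ^ (2ε + 2n)`, and of `H` with pairwise distinct
eigenvalues `2(n + ε)`. Hence a closed `K_ℝ`-invariant subspace is the space `coefSupported χ S` of
functions whose Fourier coefficients vanish off some `S ⊆ ℤ` (`eq_coefSupported`), and a Lie
submodule of the `K`-finite vectors is the span `vecSpan χ S` of the `v_n`, `n ∈ S`
(`toSubmodule_eq_vecSpan`).

Since `E v_n = (n - l + ε) v_{n+1}` and `F v_n = -(n + l + ε) v_{n-1}`, the sets that occur are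
closed under `n ↦ n + 1` except at `n = l - ε`, and under `n ↦ n - 1` except at `n = -(l + ε)`; this
is `Stable`. If `l + ε` is not an integer there is no exception, and only `∅` and `ℤ` are stable
(`Stable.eq_of_not_int`). If `l + ε = m`, the two barriers cut `ℤ` into at most three intervals, and
at most six sets are stable (`Stable.eq_of_int`). Irreducibility of a subquotient means that one
stable set covers another (`StableCover`), and finite length follows from the finiteness of the
list.

Group and Lie algebra are tied together in both directions (`isSubrep_iff`). A subrepresentation has
a stable weight set because the Fourier coefficients can be differentiated along the one-parameter
group generated by `E + F` (`IsSubrep.stable`). Conversely, the weights of `M⁺` and `M⁻` give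
invariant subspaces by Cauchy's theorem: `π(g) v_n` is, up to a power of `z`, holomorphic in `z⁻¹`
or in `z` on the closed disc, so the forbidden coefficients vanish (`coef_rep_vec_weightsPlus`,
`coef_rep_vec_weightsMinus`). The other stable sets are unions and intersections of these two.

The analytic input is that Fourier coefficients of smooth functions decay rapidly, so that bounded
multipliers act on `C^∞(S¹)` and pointwise convergence of uniformly bounded multipliers implies
convergence in the Fréchet topology (`exists_multiplier`, `tendsto_of_multiplier`). The modules
`F_d`, `V_λ`, `V̄_λ` are matched by rescaling the `v_n` (`WeightModel`). Admissibility is Frobenius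
reciprocity: `K_ℝ` is transitive on the circle, so an intertwining map is determined by its values
at one point. -/

lemma continuous_pull (f : PS χ) : Continuous (pull f) := (pull_contDiff f).continuous

/-- The mean value of a function on the circle. -/
def avg : PS χ →ₗ[ℂ] ℂ where
  toFun f := ((2 * Real.pi : ℝ) : ℂ)⁻¹ * ∫ θ in (0 : ℝ)..(2 * Real.pi), pull f θ
  map_add' f g := by
    rw [← mul_add, ← intervalIntegral.integral_add ((continuous_pull f).intervalIntegrable _ _)
      ((continuous_pull g).intervalIntegrable _ _)]
    rfl
  map_smul' c f := by
    have : ∀ θ, pull (c • f) θ = c * pull f θ := fun θ => rfl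
    simp only [this, intervalIntegral.integral_const_mul, RingHom.id_apply, smul_eq_mul]
    ring

lemma avg_apply (f : PS χ) :
    avg f = ((2 * Real.pi : ℝ) : ℂ)⁻¹ * ∫ θ in (0 : ℝ)..(2 * Real.pi), pull f θ := rfl

lemma norm_avg_le (f : PS χ) {C : ℝ} (hC : ∀ z, ‖f z‖ ≤ C) : ‖avg f‖ ≤ C := by
  have h := intervalIntegral.norm_integral_le_of_norm_le_const (a := (0 : ℝ)) (b := 2 * Real.pi)
    (f := pull f) (C := C) (fun θ _ => hC _)
  rw [sub_zero, abs_of_pos Real.two_pi_pos] at h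
  rw [avg_apply, norm_mul, norm_inv, Complex.norm_real, Real.norm_of_nonneg Real.two_pi_pos.le,
    inv_mul_le_iff₀ Real.two_pi_pos]
  linarith

lemma avg_ddθ (f : PS χ) : avg (ddθ f) = 0 := by
  have h := intervalIntegral.integral_eq_sub_of_hasDerivAt (a := 0) (b := 2 * Real.pi)
    (fun θ _ => hasDerivAt_pull f θ) ((continuous_pull (ddθ f)).intervalIntegrable _ _)
  have h2 : pull f (2 * Real.pi) = pull f 0 := by simp [pull]
  rw [h2, sub_self] at h
  rw [avg_apply]
  exact mul_eq_zero_of_right _ h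

/-- The coefficient of `f` at `v_n = z^{-n}`. -/
def coef (n : ℤ) : PS χ →ₗ[ℂ] ℂ := avg ∘ₗ zmul n

lemma coef_apply (n : ℤ) (f : PS χ) : coef n f = avg (zmul n f) := rfl

lemma zmul_zmul (m n : ℤ) (f : PS χ) : zmul m (zmul n f) = zmul (m + n) f := by
  ext z
  simp only [zmul_apply, zpow_add₀ (Circle.coe_ne_zero z), mul_assoc]

lemma coef_zmul (m n : ℤ) (f : PS χ) : coef m (zmul n f) = coef (m + n) f := by
  rw [coef_apply, zmul_zmul, coef_apply]

lemma norm_coef_le (n : ℤ) (f : PS χ) {C : ℝ} (hC : ∀ z, ‖f z‖ ≤ C) : ‖coef n f‖ ≤ C :=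
  norm_avg_le _ fun z => by
    rw [zmul_apply, norm_mul, norm_zpow, Circle.norm_coe, one_zpow, one_mul]
    exact hC z

lemma coef_ddθ (n : ℤ) (f : PS χ) : coef n (ddθ f) = -(Complex.I * n) * coef n f := by
  have h := avg_ddθ (zmul n f)
  rw [ddθ_zmul, map_add, map_smul, ← coef_apply, ← coef_apply, smul_eq_mul] at h
  linear_combination h

lemma coef_ddθ_pow (n : ℤ) (k : ℕ) (f : PS χ) :
    coef n ((ddθ ^ k) f) = (-(Complex.I * n)) ^ k * coef n f := by
  induction k with
  | zero => simp
  | succ k ih => rw [pow_succ', Module.End.mul_apply, coef_ddθ, ih]; ring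

lemma avg_vec (n : ℤ) : avg (vec χ n) = if n = 0 then 1 else 0 := by
  split_ifs with h
  · subst h
    have : ∀ θ, pull (vec χ 0) θ = 1 := fun θ => by simp [pull, vec_apply]
    rw [avg_apply]
    simp only [this, intervalIntegral.integral_const, sub_zero, Complex.real_smul, mul_one]
    exact inv_mul_cancel₀ (by exact_mod_cast Real.two_pi_pos.ne')
  -- For `n ≠ 0` the function `v_n` is a nonzero multiple of its own derivative, and derivatives
  -- have mean zero.
  · have h1 := avg_ddθ (vec χ n)
    rw [ddθ_vec, map_smul, smul_eq_mul] at h1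
    exact (mul_eq_zero.1 h1).resolve_left (by simp [h])

lemma coef_vec (m n : ℤ) : coef m (vec χ n) = if n = m then 1 else 0 := by
  rw [coef_apply, zmul_vec, avg_vec]
  simp [sub_eq_zero]

lemma exists_norm_le (f : PS χ) : ∃ C : ℝ, ∀ z, ‖f z‖ ≤ C :=
  ⟨‖toCont f‖, fun z => ContinuousMap.norm_coe_le_norm (toCont f) z⟩

lemma exists_pow_mul_norm_coef_le (k : ℕ) (f : PS χ) :
    ∃ C : ℝ, ∀ n : ℤ, |(n : ℝ)| ^ k * ‖coef n f‖ ≤ C := by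
  obtain ⟨C, hC⟩ := exists_norm_le ((ddθ ^ k) f)
  refine ⟨C, fun n => ?_⟩
  have := norm_coef_le n _ hC
  simpa [coef_ddθ_pow] using this

/-- Two extra derivatives give a comparison with `∑ 1 / n²`; the term `n = 0` is discarded because
the comparison divides by `n²`. -/
lemma summable_pow_mul_coef (k : ℕ) (f : PS χ) :
    Summable fun n : ℤ => |(n : ℝ)| ^ k * ‖coef n f‖ := by
  obtain ⟨C, hC⟩ := exists_pow_mul_norm_coef_le (k + 2) f
  have hs : Summable fun n : ℤ => C * (1 / (n : ℝ) ^ 2) :=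
    (Real.summable_one_div_int_pow.2 one_lt_two).mul_left C
  refine hs.of_norm_bounded_eventually ?_
  have : ∀ᶠ n : ℤ in cofinite, n ≠ 0 := (Set.finite_singleton (0 : ℤ)).compl_mem_cofinite
  filter_upwards [this] with n hn
  have h0 : (0 : ℝ) < (n : ℝ) ^ 2 := by positivity
  rw [Real.norm_of_nonneg (by positivity), mul_one_div, le_div_iff₀ h0]
  have := hC n
  rw [pow_add, sq_abs] at this
  linarith

lemma summable_norm_coef (f : PS χ) : Summable fun n : ℤ => ‖coef n f‖ := by
  simpa using summable_pow_mul_coef 0 f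

/-- This is the Fourier series on `AddCircle (2π)`. The reflection `n ↦ -n` appears because `v_n =
z^{-n}`, so that `coef n` is the classical coefficient of index `-n`. -/
lemma hasSum_coef (f : PS χ) (z : Circle) :
    HasSum (fun n : ℤ => coef n f * (z : ℂ) ^ (-n)) (f z) := by
  have : Fact (0 < 2 * Real.pi) := ⟨Real.two_pi_pos⟩
  let F : C(AddCircle (2 * Real.pi), ℂ) :=
    (toCont f).comp ⟨AddCircle.toCircle, AddCircle.continuous_toCircle⟩
  have hexp : ∀ θ : ℝ, AddCircle.toCircle (T := 2 * Real.pi) (θ : AddCircle (2 * Real.pi)) =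
      Circle.exp θ := by
    intro θ
    rw [AddCircle.toCircle_apply_mk, div_self Real.two_pi_pos.ne', one_mul]
  have hfour : ∀ (n : ℤ) (θ : ℝ), fourier n (θ : AddCircle (2 * Real.pi)) =
      ((Circle.exp θ : Circle) : ℂ) ^ n := by
    intro n θ
    rw [fourier_apply, AddCircle.toCircle_zsmul, hexp, Circle.coe_zpow]
  have hF : ∀ θ : ℝ, F (θ : AddCircle (2 * Real.pi)) = f (Circle.exp θ) := by
    intro θ
    rw [← hexp]; rfl
  have hc : ∀ n, fourierCoeff F n = coef (-n) f := by
    intro n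
    rw [fourierCoeff_eq_intervalIntegral F n 0, coef_apply, avg_apply, zero_add,
      Complex.real_smul, one_div, Complex.ofReal_inv]
    congr 1
    refine intervalIntegral.integral_congr fun θ _ => ?_
    simp only [hfour, hF, pull, zmul_apply, smul_eq_mul]
  have hs : Summable (fourierCoeff F) := by
    have h := (summable_norm_coef f).of_norm
    have h2 := (Equiv.neg ℤ).summable_iff.2 h
    exact h2.congr fun n => (hc n).symm
  obtain ⟨θ, rfl⟩ : ∃ θ, Circle.exp θ = z := ⟨_, Circle.exp_arg z⟩
  have h := has_pointwise_sum_fourier_series_of_summable hs (θ : AddCircle (2 * Real.pi))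
  rw [hF] at h
  have h2 := (Equiv.neg ℤ).hasSum_iff.2 h
  have h3 : (fun n : ℤ => coef n f * ((Circle.exp θ : Circle) : ℂ) ^ (-n)) =
      (fun n => fourierCoeff F n • fourier n (θ : AddCircle (2 * Real.pi))) ∘ Equiv.neg ℤ := by
    funext n
    simp only [Function.comp_apply, Equiv.neg_apply, hc, neg_neg, hfour, smul_eq_mul]
  rw [h3]
  exact h2

lemma ext_coef {f g : PS χ} (h : ∀ n, coef n f = coef n g) : f = g := by
  ext z
  have hf := hasSum_coef f z
  simp only [h] at hf
  exact hf.unique (hasSum_coef g z)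

/-- Bounds the sup norm by the `ℓ¹` norm of the coefficients, so that convergence in `C^∞(S¹)` can
be proved by dominated convergence of series. -/
lemma norm_le_tsum_coef (f : PS χ) (z : Circle) : ‖f z‖ ≤ ∑' n, ‖coef n f‖ := by
  rw [← (hasSum_coef f z).tsum_eq]
  have h : ∀ n : ℤ, ‖coef n f * (z : ℂ) ^ (-n)‖ = ‖coef n f‖ := fun n => by
    rw [norm_mul, norm_zpow, Circle.norm_coe, one_zpow, mul_one]
  refine (norm_tsum_le_tsum_norm ((summable_norm_coef f).congr fun n => (h n).symm)).trans ?_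
  simp only [h, le_refl]

/-! ### The topology in terms of the coefficients -/

lemma tendsto_PS_iff {ι : Type*} {F : Filter ι} {g : ι → PS χ} {f : PS χ} :
    Tendsto g F (𝓝 f) ↔
      ∀ k : ℕ, Tendsto (fun i => toCont ((ddθ ^ k) (g i))) F (𝓝 (toCont ((ddθ ^ k) f))) := by
  simp only [nhds_iInf, nhds_induced, tendsto_iInf, tendsto_comap_iff]
  rfl

lemma continuous_toCont_ddθ_pow (k : ℕ) :
    Continuous fun f : PS χ => toCont ((ddθ ^ k) f) :=
  continuous_iff_continuousAt.2 fun _ => (tendsto_PS_iff.1 tendsto_id) k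

lemma continuous_toCont : Continuous (toCont : PS χ → C(Circle, ℂ)) :=
  continuous_toCont_ddθ_pow 0

lemma toCont_injective : Function.Injective (toCont : PS χ → C(Circle, ℂ)) := by
  intro f g h
  ext z
  exact congrArg (fun u : C(Circle, ℂ) => u z) h

instance : T2Space (PS χ) := T2Space.of_injective_continuous toCont_injective continuous_toCont

lemma continuous_of_bound (φ : PS χ →ₗ[ℂ] ℂ) (C : ℝ)
    (h : ∀ f : PS χ, ‖φ f‖ ≤ C * ‖toCont f‖) : Continuous φ := by
  refine continuous_of_continuousAt_zero φ ?_
  rw [ContinuousAt, map_zero]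
  have h0 : Tendsto (fun f : PS χ => C * ‖toCont f‖) (𝓝 0) (𝓝 0) := by
    have := ((continuous_toCont (χ := χ)).norm.const_mul C).tendsto 0
    simpa using this
  exact squeeze_zero_norm h h0

lemma continuous_coef (n : ℤ) : Continuous (coef n : PS χ → ℂ) :=
  continuous_of_bound (coef n) 1 fun f => by
    rw [one_mul]
    exact norm_coef_le n f fun z => ContinuousMap.norm_coe_le_norm (toCont f) z

/-- Bounded Fourier multipliers that converge pointwise converge strongly on `C^∞(S¹)`. -/
lemma tendsto_of_multiplier {ι : Type*} {F : Filter ι} {g : ι → PS χ} {f h : PS χ}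
    (a : ι → ℤ → ℂ) (b : ℤ → ℂ) {C : ℝ} (ha : ∀ i n, ‖a i n‖ ≤ C)
    (hab : ∀ n, Tendsto (fun i => a i n) F (𝓝 (b n)))
    (hg : ∀ i n, coef n (g i) = a i n * coef n f) (hh : ∀ n, coef n h = b n * coef n f) :
    Tendsto g F (𝓝 h) := by
  rw [tendsto_PS_iff]
  intro k
  rw [tendsto_iff_norm_sub_tendsto_zero]
  -- The trivial filter is treated apart, since `0 ≤ C` is read off from some index `i`.
  rcases F.eq_or_neBot with rfl | hF
  · exact tendsto_bot
  have hC0 : 0 ≤ C := by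
    obtain ⟨i⟩ := F.nonempty_of_neBot
    exact (norm_nonneg _).trans (ha i 0)
  have hb : ∀ n, ‖b n‖ ≤ C := fun n => le_of_tendsto' (hab n).norm fun i => ha i n
  -- Dominated convergence for series, with majorant `2C |n|^k ‖coef n f‖`.
  have hlim : Tendsto (fun i => ∑' n : ℤ, ‖a i n - b n‖ * (|(n : ℝ)| ^ k * ‖coef n f‖)) F
      (𝓝 (∑' n : ℤ, 0)) := by
    refine tendsto_tsum_of_dominated_convergence
      ((summable_pow_mul_coef k f).mul_left (C + C)) (fun n => ?_)
      (Eventually.of_forall fun i n => ?_)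
    · have := (((hab n).sub_const (b n)).norm).mul_const (|(n : ℝ)| ^ k * ‖coef n f‖)
      simpa using this
    · rw [norm_mul, norm_norm, Real.norm_of_nonneg (by positivity)]
      gcongr
      exact (norm_sub_le _ _).trans (add_le_add (ha i n) (hb n))
  rw [tsum_zero] at hlim
  refine squeeze_zero (fun _ => norm_nonneg _) (fun i => ?_) hlim
  rw [← map_sub, ← map_sub, ContinuousMap.norm_le _ (tsum_nonneg fun n => by positivity)]
  intro z
  refine (norm_le_tsum_coef _ z).trans (le_of_eq (tsum_congr fun n => ?_))
  rw [coef_ddθ_pow, map_sub, hg, hh, ← sub_mul, norm_mul, norm_mul, norm_pow, norm_neg, norm_mul,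
    Complex.norm_I, one_mul, Complex.norm_intCast]
  ring

lemma iteratedDeriv_circleExp_zpow (n : ℤ) (k : ℕ) :
    iteratedDeriv k (fun θ : ℝ => ((Circle.exp θ : Circle) : ℂ) ^ n) =
      fun θ => (Complex.I * n) ^ k * ((Circle.exp θ : Circle) : ℂ) ^ n := by
  induction k with
  | zero => simp
  | succ k ih =>
    rw [iteratedDeriv_succ, ih]
    funext θ
    have h0 := Circle.coe_ne_zero (Circle.exp θ)
    have h := ((hasDerivAt_zpow n _ (Or.inl h0)).comp θ
      (hasDerivAt_circleExp θ)).const_mul ((Complex.I * n) ^ k)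
    refine h.deriv.trans ?_
    rw [zpow_sub_one₀ h0]
    field_simp
    ring

lemma contDiff_circleExp_zpow (n : ℤ) :
    ContDiff ℝ ∞ (fun θ : ℝ => ((Circle.exp θ : Circle) : ℂ) ^ n) := by
  -- The parameter is a dummy: smoothness of `z^n` does not involve it.
  have h : (fun θ : ℝ => ((Circle.exp θ : Circle) : ℂ) ^ n) = pull (vec ⟨0, 0⟩ (-n)) := by
    funext θ
    rw [pull, vec_apply, neg_neg]
  rw [h]
  exact pull_contDiff _

/-- A bounded Fourier multiplier maps `C^∞(S¹)` to itself. -/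
lemma exists_multiplier (a : ℤ → ℂ) {C : ℝ} (ha : ∀ n, ‖a n‖ ≤ C) (f : PS χ) :
    ∃ g : PS χ, ∀ n, coef n g = a n * coef n f := by
  have hC0 : 0 ≤ C := (norm_nonneg _).trans (ha 0)
  have hsmooth : ContDiff ℝ ∞ (fun θ : ℝ => ∑' n : ℤ,
      a n * coef n f * ((Circle.exp θ : Circle) : ℂ) ^ (-n)) := by
    refine contDiff_tsum (v := fun k (n : ℤ) => C * (|(n : ℝ)| ^ k * ‖coef n f‖))
      (fun n => contDiff_const.mul (contDiff_circleExp_zpow _))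
      (fun k _ => (summable_pow_mul_coef k f).mul_left C) (fun k n θ _ => ?_)
    rw [norm_iteratedFDeriv_eq_norm_iteratedDeriv, iteratedDeriv_const_mul_field,
      iteratedDeriv_circleExp_zpow]
    simp only [norm_mul, norm_pow, norm_zpow, Circle.norm_coe, one_zpow, mul_one, Complex.norm_I,
      one_mul, Complex.norm_intCast, Int.cast_neg, norm_neg]
    have := ha n
    have h1 : 0 ≤ |(n : ℝ)| ^ k * ‖coef n f‖ := by positivity
    calc ‖a n‖ * ‖coef n f‖ * |(n : ℝ)| ^ k = ‖a n‖ * (|(n : ℝ)| ^ k * ‖coef n f‖) := by ring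
      _ ≤ _ := mul_le_mul_of_nonneg_right this h1
  let g : PS χ := PS.mk (fun z => ∑' n : ℤ, a n * coef n f * (z : ℂ) ^ (-n)) hsmooth
  refine ⟨g, fun m => ?_⟩
  have hs : Summable fun n => ‖a n * coef n f‖ := by
    refine Summable.of_nonneg_of_le (fun _ => norm_nonneg _) (fun n => ?_)
      ((summable_norm_coef f).mul_left C)
    rw [norm_mul]
    exact mul_le_mul_of_nonneg_right (ha n) (norm_nonneg _)
  -- Sum and integral are interchanged; orthogonality of the `v_n` then leaves only the term `n =
  -- m`.
  have hI : HasSum (fun n : ℤ => ∫ θ in (0 : ℝ)..(2 * Real.pi),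
      a n * coef n f * ((Circle.exp θ : Circle) : ℂ) ^ (m - n))
      (∫ θ in (0 : ℝ)..(2 * Real.pi), pull (zmul m g) θ) := by
    refine intervalIntegral.hasSum_integral_of_dominated_convergence
      (fun n _ => ‖a n * coef n f‖) (fun n => ?_) (fun n => ?_) ?_ ?_ ?_
    · exact (continuous_const.mul (contDiff_circleExp_zpow _).continuous).aestronglyMeasurable
    · exact Eventually.of_forall fun θ _ => by
        rw [norm_mul, norm_zpow, Circle.norm_coe, one_zpow, mul_one]
    · exact Eventually.of_forall fun θ _ => hs
    · exact intervalIntegrable_const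
    · refine Eventually.of_forall fun θ _ => ?_
      have h1 : HasSum (fun n : ℤ => a n * coef n f * ((Circle.exp θ : Circle) : ℂ) ^ (-n))
          (g (Circle.exp θ)) := by
        refine Summable.hasSum (Summable.of_norm (hs.congr fun n => ?_))
        rw [norm_mul _ (_ ^ _), norm_zpow, Circle.norm_coe, one_zpow, mul_one]
      have h2 := h1.mul_left (((Circle.exp θ : Circle) : ℂ) ^ m)
      refine (congrArg (HasSum · _) (funext fun n => ?_)).mp h2
      rw [sub_eq_add_neg, zpow_add₀ (Circle.coe_ne_zero _)]
      ring
  have hI2 := hI.mul_left ((2 * Real.pi : ℝ) : ℂ)⁻¹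
  rw [← avg_apply, ← coef_apply] at hI2
  refine hI2.unique ?_
  have h3 : (fun n : ℤ => ((2 * Real.pi : ℝ) : ℂ)⁻¹ * ∫ θ in (0 : ℝ)..(2 * Real.pi),
      a n * coef n f * ((Circle.exp θ : Circle) : ℂ) ^ (m - n)) =
      fun n => if n = m then a m * coef m f else 0 := by
    funext n
    have h4 : ∀ θ : ℝ, ((Circle.exp θ : Circle) : ℂ) ^ (m - n) = pull (vec χ (n - m)) θ := by
      intro θ
      rw [pull, vec_apply, neg_sub]
    simp only [h4, intervalIntegral.integral_const_mul]
    rw [mul_left_comm, ← avg_apply, avg_vec]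
    split_ifs with h5 h6 h6
    · rw [sub_eq_zero.1 h5, mul_one]
    · omega
    · omega
    · rw [mul_zero]
  rw [h3]
  exact hasSum_ite_eq m _

/-! ### Subspaces cut out by Fourier coefficients -/

/-- The functions whose coefficients vanish outside of `S`. -/
def coefSupported (χ : Param) (S : Set ℤ) : Submodule ℂ (PS χ) where
  carrier := {f | ∀ n, n ∉ S → coef n f = 0}
  add_mem' hf hg n hn := by rw [map_add, hf n hn, hg n hn, add_zero]
  zero_mem' n _ := map_zero _
  smul_mem' c f hf n hn := by rw [map_smul, hf n hn, smul_zero]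

lemma mem_coefSupported {S : Set ℤ} {f : PS χ} :
    f ∈ coefSupported χ S ↔ ∀ n, n ∉ S → coef n f = 0 := Iff.rfl

lemma isClosed_coefSupported (S : Set ℤ) : IsClosed (coefSupported χ S : Set (PS χ)) := by
  have : (coefSupported χ S : Set (PS χ)) = ⋂ n ∈ Sᶜ, {f | coef n f = 0} := by
    ext f
    simp only [SetLike.mem_coe, mem_coefSupported, Set.mem_iInter, Set.mem_compl_iff,
      Set.mem_ofPred_eq]
  rw [this]
  exact isClosed_biInter fun n _ => isClosed_eq (continuous_coef n) continuous_const

lemma vec_mem_coefSupported {S : Set ℤ} {n : ℤ} : vec χ n ∈ coefSupported χ S ↔ n ∈ S := by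
  constructor
  · intro h
    by_contra hn
    have := h n hn
    simp [coef_vec] at this
  · intro h m hm
    rw [coef_vec, if_neg]
    rintro rfl
    exact hm h

lemma coefSupported_mono {S T : Set ℤ} (h : S ⊆ T) : coefSupported χ S ≤ coefSupported χ T :=
  fun _ hf n hn => hf n fun hS => hn (h hS)

lemma coefSupported_le_iff {S T : Set ℤ} : coefSupported χ S ≤ coefSupported χ T ↔ S ⊆ T :=
  ⟨fun h _ hn => vec_mem_coefSupported.1 (h (vec_mem_coefSupported.2 hn)), coefSupported_mono⟩

lemma coefSupported_injective : Function.Injective (coefSupported χ) := fun _ _ h =>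
  (coefSupported_le_iff.1 h.le).antisymm (coefSupported_le_iff.1 h.ge)

lemma coefSupported_empty : coefSupported χ ∅ = ⊥ := by
  rw [eq_bot_iff]
  intro f hf
  rw [Submodule.mem_bot]
  exact ext_coef fun n => by rw [hf n (Set.notMem_empty n), map_zero]

lemma coefSupported_univ : coefSupported χ Set.univ = ⊤ :=
  eq_top_iff.2 fun _ _ n hn => absurd (Set.mem_univ n) hn

lemma coefSupported_inf (S T : Set ℤ) :
    coefSupported χ S ⊓ coefSupported χ T = coefSupported χ (S ∩ T) := by
  refine le_antisymm ?_ (le_inf (coefSupported_mono Set.inter_subset_left)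
    (coefSupported_mono Set.inter_subset_right))
  rintro f ⟨h1, h2⟩ n hn
  by_cases h : n ∈ S
  · exact h2 n fun hT => hn ⟨h, hT⟩
  · exact h1 n h

open Classical in
-- The indicator function of `S` is a bounded multiplier, so a smooth function splits smoothly into
-- its part on `S` and the rest. In particular the sum of two such closed subspaces is closed
-- without taking a closure.
lemma coefSupported_sup (S T : Set ℤ) :
    coefSupported χ S ⊔ coefSupported χ T = coefSupported χ (S ∪ T) := by
  refine le_antisymm (sup_le (coefSupported_mono Set.subset_union_left)
    (coefSupported_mono Set.subset_union_right)) fun f hf => ?_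
  obtain ⟨g, hg⟩ := exists_multiplier (fun n => if n ∈ S then 1 else 0) (C := 1)
    (fun n => by split_ifs <;> simp) f
  refine Submodule.mem_sup.2 ⟨g, fun n hn => by simp [hg, hn], f - g, fun n hn => ?_, by abel⟩
  rw [map_sub, hg]
  split_ifs with h
  · simp
  · rw [hf n (by simp [h, hn])]; simp

/-! ### Trigonometric polynomials -/

/-- The span of the `v_n` with `n ∈ S`. -/
def vecSpan (χ : Param) (S : Set ℤ) : Submodule ℂ (PS χ) := Submodule.span ℂ (vec χ '' S)

lemma vec_mem_vecSpan {S : Set ℤ} {n : ℤ} (h : n ∈ S) : vec χ n ∈ vecSpan χ S :=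
  Submodule.subset_span ⟨n, h, rfl⟩

lemma vecSpan_mono {S T : Set ℤ} (h : S ⊆ T) : vecSpan χ S ≤ vecSpan χ T :=
  Submodule.span_mono (Set.image_mono h)

lemma vecSpan_le_coefSupported (S : Set ℤ) : vecSpan χ S ≤ coefSupported χ S :=
  Submodule.span_le.2 (by rintro _ ⟨n, hn, rfl⟩; exact vec_mem_coefSupported.2 hn)

lemma coef_sum_vec (s : Finset ℤ) (c : ℤ → ℂ) (m : ℤ) :
    coef m (∑ n ∈ s, c n • vec χ n) = if m ∈ s then c m else 0 := by
  simp [map_sum, coef_vec]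

lemma finite_of_mem_vecSpan {S : Set ℤ} {f : PS χ} (h : f ∈ vecSpan χ S) :
    {n | coef n f ≠ 0}.Finite := by
  refine Submodule.span_induction ?_ ?_ ?_ ?_ h
  · rintro _ ⟨n, -, rfl⟩
    refine (Set.finite_singleton n).subset fun m hm => ?_
    by_contra h
    exact hm (by rw [coef_vec, if_neg (fun h' => h h'.symm)])
  · simp
  · intro f g _ _ hf hg
    refine (hf.union hg).subset fun n hn => ?_
    by_contra h
    simp only [Set.mem_union, Set.mem_ofPred_eq, not_or, not_not] at h
    exact hn (by rw [map_add, h.1, h.2, add_zero])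
  · intro c f _ hf
    refine hf.subset fun n hn h => hn ?_
    rw [map_smul, h, smul_zero]

lemma eq_sum_of_finite {f : PS χ} (h : {n | coef n f ≠ 0}.Finite) :
    f = ∑ n ∈ h.toFinset, coef n f • vec χ n := by
  refine ext_coef fun n => ?_
  rw [coef_sum_vec]
  split_ifs with hn
  · rfl
  · simpa using hn

lemma mem_vecSpan_iff {S : Set ℤ} {f : PS χ} :
    f ∈ vecSpan χ S ↔ {n | coef n f ≠ 0}.Finite ∧ f ∈ coefSupported χ S := by
  refine ⟨fun h => ⟨finite_of_mem_vecSpan h, vecSpan_le_coefSupported S h⟩, fun ⟨h1, h2⟩ => ?_⟩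
  rw [eq_sum_of_finite h1]
  refine Submodule.sum_mem _ fun n hn => Submodule.smul_mem _ _ (vec_mem_vecSpan ?_)
  by_contra h
  exact (h1.mem_toFinset.1 hn) (h2 n h)

lemma vec_mem_vecSpan_iff {S : Set ℤ} {n : ℤ} : vec χ n ∈ vecSpan χ S ↔ n ∈ S :=
  ⟨fun h => vec_mem_coefSupported.1 (vecSpan_le_coefSupported S h), vec_mem_vecSpan⟩

lemma vecSpan_le_iff {S T : Set ℤ} : vecSpan χ S ≤ vecSpan χ T ↔ S ⊆ T :=
  ⟨fun h _ hn => vec_mem_vecSpan_iff.1 (h (vec_mem_vecSpan hn)), vecSpan_mono⟩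

lemma vecSpan_injective : Function.Injective (vecSpan χ) := fun _ _ h =>
  (vecSpan_le_iff.1 h.le).antisymm (vecSpan_le_iff.1 h.ge)

lemma vecSpan_sup (S T : Set ℤ) : vecSpan χ S ⊔ vecSpan χ T = vecSpan χ (S ∪ T) := by
  rw [vecSpan, vecSpan, vecSpan, Set.image_union, Submodule.span_union]

lemma vecSpan_inf (S T : Set ℤ) : vecSpan χ S ⊓ vecSpan χ T = vecSpan χ (S ∩ T) := by
  ext f
  simp only [Submodule.mem_inf, mem_vecSpan_iff, ← coefSupported_inf]
  tauto

lemma vecSpan_empty : vecSpan χ ∅ = ⊥ := by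
  rw [vecSpan, Set.image_empty, Submodule.span_empty]

lemma vecSpan_univ_inf_coefSupported (S : Set ℤ) :
    vecSpan χ Set.univ ⊓ coefSupported χ S = vecSpan χ S := by
  ext f
  simp only [Submodule.mem_inf, mem_vecSpan_iff, coefSupported_univ, Submodule.mem_top, and_true]

/-- For finitely many weights the algebraic and the topological description agree; this is what
makes `F = M⁺ ∩ M⁻` closed when `l ≥ 0`. -/
lemma vecSpan_eq_coefSupported {S : Set ℤ} (h : S.Finite) : vecSpan χ S = coefSupported χ S := by
  ext f
  rw [mem_vecSpan_iff]
  refine ⟨fun h => h.2, fun hf => ⟨h.subset fun n hn => ?_, hf⟩⟩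
  by_contra hS
  exact hn (hf n hS)

lemma linearIndependent_vec : LinearIndependent ℂ (vec χ) := by
  rw [linearIndependent_iff']
  intro s c hc n hn
  have := congrArg (coef n) hc
  rwa [coef_sum_vec, if_pos hn, map_zero] at this

/-- The partial sums of the Fourier series converge in `C^∞(S¹)`. -/
lemma tendsto_partialSum (f : PS χ) :
    Tendsto (fun s : Finset ℤ => ∑ n ∈ s, coef n f • vec χ n) atTop (𝓝 f) := by
  refine tendsto_of_multiplier (fun s n => if n ∈ s then 1 else 0) (fun _ => 1) (C := 1) (f := f)
    (fun s n => by split_ifs <;> simp) (fun n => ?_) (fun s n => ?_) (fun n => (one_mul _).symm)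
  · refine tendsto_const_nhds.congr' ?_
    filter_upwards [eventually_ge_atTop {n}] with s hs
    rw [if_pos (Finset.singleton_subset_iff.1 hs)]
  · rw [coef_sum_vec]
    split_ifs <;> simp

lemma topologicalClosure_vecSpan (S : Set ℤ) :
    (vecSpan χ S).topologicalClosure = coefSupported χ S := by
  refine le_antisymm (Submodule.topologicalClosure_minimal _ (vecSpan_le_coefSupported S)
    (isClosed_coefSupported S)) fun f hf => ?_
  refine mem_closure_of_tendsto (tendsto_partialSum f) (Eventually.of_forall fun s => ?_)
  refine Submodule.sum_mem _ fun n _ => ?_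
  by_cases hn : n ∈ S
  · exact Submodule.smul_mem _ _ (vec_mem_vecSpan hn)
  · rw [hf n hn, zero_smul]
    exact Submodule.zero_mem _

/-! ### Subspaces invariant under the diagonal subgroup -/

lemma avg_rep_diagK (u : Circle) (f : PS χ) :
    avg (rep χ (diagK u) f) = (u : ℂ) ^ (χ.e : ℕ) * avg f := by
  obtain ⟨α, rfl⟩ : ∃ α, Circle.exp α = u := ⟨_, Circle.exp_arg u⟩
  have h : ∀ θ, pull (rep χ (diagK (Circle.exp α)) f) θ =
      ((Circle.exp α : Circle) : ℂ) ^ (χ.e : ℕ) * pull f (θ - 2 * α) := by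
    intro θ
    rw [pull, rep_diagK, pull, Circle.exp_sub, two_mul, Circle.exp_add, div_eq_mul_inv, mul_inv]
  have hper : Function.Periodic (pull f) (2 * Real.pi) := fun θ => by simp [pull]
  rw [avg_apply, avg_apply]
  simp only [h, intervalIntegral.integral_const_mul]
  -- The element `diag(u, u⁻¹)` rotates the circle by twice its angle; by periodicity the shifted
  -- integral over a full period is unchanged.
  rw [intervalIntegral.integral_comp_sub_right (fun θ => pull f θ)]
  have := hper.intervalIntegral_add_eq (0 - 2 * α) 0
  rw [show 0 - 2 * α + 2 * Real.pi = 2 * Real.pi - 2 * α by ring, zero_add] at this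
  rw [this]
  ring

/-- The characters `u ^ (2ε + 2n)` are distinct for distinct `n`, which allows `K_ℝ` to separate the
Fourier modes. -/
lemma coef_rep_diagK (n : ℤ) (u : Circle) (f : PS χ) :
    coef n (rep χ (diagK u) f) = (u : ℂ) ^ (((χ.e : ℕ) : ℤ) + 2 * n) * coef n f := by
  rw [coef_apply, zmul_rep_diagK, map_smul, avg_rep_diagK, ← coef_apply, smul_eq_mul,
    zpow_add₀ (Circle.coe_ne_zero u), zpow_natCast]
  ring

lemma rep_diagK_vec (n : ℤ) (u : Circle) :
    rep χ (diagK u) (vec χ n) = (u : ℂ) ^ (((χ.e : ℕ) : ℤ) + 2 * n) • vec χ n := by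
  refine ext_coef fun m => ?_
  rw [coef_rep_diagK, map_smul, smul_eq_mul, coef_vec]
  split_ifs with h
  · rw [h]
  · simp

/-- The squares of the powers of `e^{iπ/N}` run through the `N`-th roots of unity, so the average is
a geometric sum that is exactly `0` as soon as `N > |k|`. -/
lemma tendsto_average_zpow {k : ℤ} (hk : k ≠ 0) :
    Tendsto (fun N : ℕ => (N : ℂ)⁻¹ * ∑ j ∈ Finset.range N,
      (((Circle.exp (Real.pi / N) : Circle) : ℂ) ^ j) ^ (2 * k)) atTop (𝓝 0) := by
  refine tendsto_const_nhds.congr' ?_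
  filter_upwards [eventually_gt_atTop k.natAbs] with N hN
  have hN0 : N ≠ 0 := by omega
  have hN1 : (N : ℂ) ≠ 0 := by exact_mod_cast hN0
  have hprim := Complex.isPrimitiveRoot_exp N hN0
  have hsq : ((Circle.exp (Real.pi / N) : Circle) : ℂ) ^ 2 =
      Complex.exp (2 * Real.pi * Complex.I / N) := by
    rw [Circle.coe_exp, ← Complex.exp_nat_mul]
    congr 1
    push_cast
    ring
  set q := Complex.exp (2 * Real.pi * Complex.I / N) ^ k with hq
  have hterm : ∀ j : ℕ, (((Circle.exp (Real.pi / N) : Circle) : ℂ) ^ j) ^ (2 * k) = q ^ j := by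
    intro j
    rw [hq, ← hsq, ← zpow_natCast, ← zpow_natCast, ← zpow_natCast, ← zpow_mul, ← zpow_mul,
      ← zpow_mul]
    congr 1
    push_cast
    ring
  have hq1 : q ≠ 1 := by
    intro h
    have := (hprim.zpow_eq_one_iff_dvd k).1 h
    exact hk (Int.eq_zero_of_abs_lt_dvd this (by rw [Int.abs_eq_natAbs]; exact_mod_cast hN))
  have hqN : q ^ N = 1 := by
    rw [hq, ← zpow_natCast, ← zpow_mul, mul_comm k, zpow_mul, zpow_natCast, hprim.pow_eq_one,
      one_zpow]
  have hsum : ∑ j ∈ Finset.range N, q ^ j = 0 := by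
    have := mul_geom_sum q N
    rw [hqN, sub_self] at this
    exact (mul_eq_zero.1 this).resolve_left (sub_ne_zero.2 hq1)
  simp only [hterm, hsum, mul_zero]

/-- The projection to weight `n` is integration over `K_ℝ` against a character. Here it is a limit
of finite averages over the powers of `e^{iπ/N}`: each average is a linear combination of translates
of `f`, hence in `W`, and on Fourier coefficients it is a multiplier bounded by `1` that tends to
the indicator of `n`. Thus no vector-valued integral is needed. -/
lemma coef_smul_vec_mem {W : Submodule ℂ (PS χ)} (hW : IsClosed (W : Set (PS χ)))
    (hK : KInvariant W) {f : PS χ} (hf : f ∈ W) (n : ℤ) : coef n f • vec χ n ∈ W := by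
  set w : ℕ → Circle := fun N => Circle.exp (Real.pi / N) with hw
  let g : ℕ → PS χ := fun N => (N : ℂ)⁻¹ • ∑ j ∈ Finset.range N,
    (((w N : ℂ) ^ j) ^ (-(((χ.e : ℕ) : ℤ) + 2 * n))) • rep χ (diagK (w N ^ j)) f
  have hg : ∀ N, g N ∈ W := fun N => W.smul_mem _ (W.sum_mem fun j _ =>
    W.smul_mem _ (hK _ ⟨_, rfl⟩ f hf))
  have hnorm : ∀ (N : ℕ) (m : ℤ), ‖(N : ℂ)⁻¹ * ∑ j ∈ Finset.range N,
      ((w N : ℂ) ^ j) ^ (2 * (m - n))‖ ≤ 1 := by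
    intro N m
    rw [norm_mul, norm_inv, Complex.norm_natCast]
    refine (mul_le_mul_of_nonneg_left (norm_sum_le _ _) (by positivity)).trans ?_
    simp only [norm_zpow, norm_pow, Circle.norm_coe, one_pow, one_zpow, Finset.sum_const,
      Finset.card_range, nsmul_eq_mul, mul_one]
    exact inv_mul_le_one
  refine hW.mem_of_tendsto (f := g) (b := atTop) ?_ (Eventually.of_forall hg)
  refine tendsto_of_multiplier (f := f) (C := 1) (fun N m => (N : ℂ)⁻¹ * ∑ j ∈ Finset.range N,
    ((w N : ℂ) ^ j) ^ (2 * (m - n))) (fun m => if m = n then 1 else 0) hnorm (fun m => ?_)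
    (fun N m => ?_) (fun m => ?_)
  · split_ifs with h
    · refine tendsto_const_nhds.congr' ?_
      filter_upwards [eventually_gt_atTop 0] with N hN
      have : (N : ℂ) ≠ 0 := by exact_mod_cast hN.ne'
      simp [h, this]
    · exact tendsto_average_zpow (sub_ne_zero.2 h)
  · simp only [g, map_smul, map_sum, smul_eq_mul, coef_rep_diagK, Circle.coe_pow]
    rw [mul_assoc, Finset.sum_mul]
    congr 1
    refine Finset.sum_congr rfl fun j _ => ?_
    rw [← mul_assoc, ← zpow_add₀ (pow_ne_zero _ (Circle.coe_ne_zero _))]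
    congr 2
    ring
  · rw [map_smul, coef_vec, smul_eq_mul]
    by_cases h : m = n
    · simp [h]
    · simp [h, Ne.symm h]

/-- A nonzero coefficient at `n` forces `v_n ∈ W` by weight projection; conversely a closed space
containing certain `v_n` contains the closure of their span. -/
lemma eq_coefSupported {W : Submodule ℂ (PS χ)} (hW : IsClosed (W : Set (PS χ)))
    (hK : KInvariant W) : W = coefSupported χ {n | vec χ n ∈ W} := by
  refine le_antisymm (fun f hf n hn => ?_) ?_
  · by_contra h
    refine hn ?_
    have := W.smul_mem (coef n f)⁻¹ (coef_smul_vec_mem hW hK hf n)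
    rwa [smul_smul, inv_mul_cancel₀ h, one_smul] at this
  · rw [← topologicalClosure_vecSpan]
    refine Submodule.topologicalClosure_minimal _ (Submodule.span_le.2 ?_) hW
    rintro _ ⟨n, hn, rfl⟩
    exact hn

lemma kInvariant_vecSpan (S : Set ℤ) : KInvariant (vecSpan χ S) := by
  rintro _ ⟨u, rfl⟩ f hf
  have : (vecSpan χ S) ≤ (vecSpan χ S).comap (rep χ (diagK u)) := by
    refine Submodule.span_le.2 ?_
    rintro _ ⟨n, hn, rfl⟩
    change rep χ (diagK u) (vec χ n) ∈ vecSpan χ S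
    rw [rep_diagK_vec]
    exact Submodule.smul_mem _ _ (vec_mem_vecSpan hn)
  exact this hf

lemma coe_HC : (HC χ : Submodule ℂ (PS χ)) = vecSpan χ Set.univ := by
  refine le_antisymm ?_ (Submodule.span_le.2 ?_)
  · rintro f ⟨U, hU, hK, hf⟩
    -- A finite-dimensional subspace is closed, so the description of closed `K_ℝ`-invariant
    -- subspaces applies to it, and linear independence of the `v_n` leaves only finitely many
    -- weights.
    have hcl : IsClosed (U : Set (PS χ)) := U.closed_of_finiteDimensional
    have hfin : {n | vec χ n ∈ U}.Finite := by
      have hli : LinearIndependent ℂ (fun n : {n | vec χ n ∈ U} => (⟨vec χ n, n.2⟩ : U)) := by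
        refine LinearIndependent.of_comp U.subtype ?_
        exact linearIndependent_vec.comp _ Subtype.val_injective
      exact Set.finite_coe_iff.1 hli.finite
    rw [eq_coefSupported hcl hK, ← vecSpan_eq_coefSupported hfin] at hf
    exact vecSpan_mono (Set.subset_univ _) hf
  · rintro _ ⟨n, -, rfl⟩
    refine ⟨vecSpan χ {n}, ?_, kInvariant_vecSpan _, vec_mem_vecSpan rfl⟩
    exact FiniteDimensional.span_of_finite ℂ ((Set.finite_singleton n).image _)

/-! ### Differentiating the Fourier coefficients along a hyperbolic one-parameter group -/

/-- The one-parameter group of the matrices `(cosh t, sinh t; sinh t, cosh t)`. -/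
def hyp (t : ℝ) : SU :=
  ⟨⟨!![(Real.cosh t : ℂ), (Real.sinh t : ℂ); (Real.sinh t : ℂ), (Real.cosh t : ℂ)], by
    rw [Matrix.det_fin_two_of]
    norm_cast
    have := Real.cosh_sq t
    nlinarith⟩, by
    refine ⟨?_, ?_⟩
    · exact (Complex.conj_ofReal _).symm
    · exact (Complex.conj_ofReal _).symm⟩

lemma ent_hyp (t : ℝ) (i j : Fin 2) : ent (hyp t) i j =
    !![(Real.cosh t : ℂ), (Real.sinh t : ℂ); (Real.sinh t : ℂ), (Real.cosh t : ℂ)] i j := rfl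

lemma hyp_add (s t : ℝ) : hyp (s + t) = hyp s * hyp t := by
  have h : ∀ i j, ent (hyp (s + t)) i j = ent (hyp s * hyp t) i j := by
    intro i j
    rw [ent_mul]
    simp only [ent_hyp]
    fin_cases i <;> fin_cases j <;> simp [Complex.sinh_add, Complex.cosh_add] <;> ring
  apply Subtype.ext
  apply Subtype.ext
  ext i j
  exact h i j

lemma hyp_zero : hyp 0 = 1 := by
  have := hyp_add 0 0
  rw [add_zero] at this
  exact (mul_eq_left.1 this.symm)

/-- The generator `E + F` of `hyp`. -/
def hypGen : sl2 := ⟨!![0, 1; 1, 0], by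
  change Matrix.trace (!![0, 1; 1, 0] : Matrix (Fin 2) (Fin 2) ℂ) = 0
  simp [Matrix.trace_fin_two]⟩

lemma hypGen_lie (f : PS χ) : ⁅hypGen, f⁆ = opE χ f + opF χ f := by
  rw [lie_eq]
  simp [hypGen]

lemma hasDerivAt_rep_hyp_zero (f : PS χ) (z : Circle) :
    HasDerivAt (fun t => (rep χ (hyp t) f) z) (⁅hypGen, f⁆ z) 0 := by
  refine hasDerivAt_rep_aux hypGen (by simp [hypGen]) (by simp [hypGen]) hyp hyp_zero ?_ f z
  have hc := (Real.hasDerivAt_cosh 0).ofReal_comp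
  have hs := (Real.hasDerivAt_sinh 0).ofReal_comp
  rw [Real.sinh_zero] at hc
  rw [Real.cosh_zero] at hs
  intro i j
  simp only [ent_hyp, hypGen]
  fin_cases i <;> fin_cases j <;> simp [-Complex.ofReal_cosh, -Complex.ofReal_sinh]
  · simpa using hc
  · simpa using hs
  · simpa using hs
  · simpa using hc

/-- The group law `hyp (t + s) = hyp t * hyp s` carries the derivative at `0`, taken at the moved
point `mob (hyp t) z`, to the time `t`. -/
lemma hasDerivAt_rep_hyp (f : PS χ) (z : Circle) (t : ℝ) :
    HasDerivAt (fun t => (rep χ (hyp t) f) z) ((rep χ (hyp t) ⁅hypGen, f⁆) z) t := by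
  have h := (hasDerivAt_rep_hyp_zero f (mob (hyp t) z)).const_mul (mult χ (hyp t) z)
  have h2 : HasDerivAt (fun s : ℝ => (rep χ (hyp (t + s)) f) z)
      (mult χ (hyp t) z * ⁅hypGen, f⁆ (mob (hyp t) z)) 0 := by
    refine h.congr_of_eventuallyEq (Eventually.of_forall fun s => ?_)
    simp only [hyp_add, map_mul]
    rfl
  have h3 := HasDerivAt.comp_sub_const (x := t) (a := t)
    (f := fun s : ℝ => (rep χ (hyp (t + s)) f) z)
    (by rw [sub_self]; exact h2)
  simp only [add_sub_cancel] at h3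
  exact h3

lemma continuous_mult_hyp : Continuous fun p : ℝ × Circle => mult χ (hyp p.1) p.2 := by
  have hw : Continuous fun p : ℝ × Circle => wfac (hyp p.1) p.2 := by
    have h1 : Continuous fun p : ℝ × Circle => ((Real.cosh p.1 : ℝ) : ℂ) :=
      Complex.continuous_ofReal.comp (Real.continuous_cosh.comp continuous_fst)
    have h2 : Continuous fun p : ℝ × Circle => ((Real.sinh p.1 : ℝ) : ℂ) :=
      Complex.continuous_ofReal.comp (Real.continuous_sinh.comp continuous_fst)
    exact h1.sub (h2.mul (continuous_subtype_val.comp continuous_snd))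
  refine Continuous.mul (Continuous.cpow (Complex.continuous_ofReal.comp hw.norm)
    continuous_const fun p => ?_) (hw.pow _)
  exact Complex.ofReal_mem_slitPlane.2 (norm_pos_iff.2 (wfac_ne _ _))

/-- Supplies the constant dominating function for differentiating under the integral: the multiplier
is continuous on the compact set `[-1, 1] × S¹`. -/
lemma exists_norm_rep_hyp_le (f : PS χ) :
    ∃ C : ℝ, ∀ t ∈ Set.Icc (-1 : ℝ) 1, ∀ z, ‖(rep χ (hyp t) f) z‖ ≤ C := by
  obtain ⟨C, hC⟩ := ((isCompact_Icc (a := (-1 : ℝ)) (b := 1)).prod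
    (isCompact_univ (X := Circle))).exists_bound_of_continuousOn
      (continuous_mult_hyp (χ := χ)).continuousOn
  obtain ⟨D, hD⟩ := exists_norm_le f
  refine ⟨C * D, fun t ht z => ?_⟩
  rw [rep_apply, norm_mul]
  have := hC (t, z) ⟨ht, trivial⟩
  exact mul_le_mul this (hD _) (norm_nonneg _) ((norm_nonneg _).trans this)

lemma hasDerivAt_coef_rep_hyp (k : ℤ) (f : PS χ) :
    HasDerivAt (fun t => coef k (rep χ (hyp t) f)) (coef k ⁅hypGen, f⁆) 0 := by
  obtain ⟨C, hC⟩ := exists_norm_rep_hyp_le ⁅hypGen, f⁆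
  have h := intervalIntegral.hasDerivAt_integral_of_dominated_loc_of_deriv_le
    (μ := MeasureTheory.volume) (a := 0) (b := 2 * Real.pi)
    (F := fun t θ => pull (zmul k (rep χ (hyp t) f)) θ)
    (F' := fun t θ => pull (zmul k (rep χ (hyp t) ⁅hypGen, f⁆)) θ) (x₀ := (0 : ℝ))
    (s := Set.Icc (-1) 1) (bound := fun _ => C) (Icc_mem_nhds (by norm_num) (by norm_num))
    (Eventually.of_forall fun t => (continuous_pull _).aestronglyMeasurable)
    ((continuous_pull _).intervalIntegrable _ _) (continuous_pull _).aestronglyMeasurable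
    (Eventually.of_forall fun θ _ t ht => by
      rw [pull, zmul_apply, norm_mul, norm_zpow, Circle.norm_coe, one_zpow, one_mul]
      exact hC t ht _)
    intervalIntegrable_const
    (Eventually.of_forall fun θ _ t _ => (hasDerivAt_rep_hyp f (Circle.exp θ) t).const_mul _)
  have h2 := h.2.const_mul ((2 * Real.pi : ℝ) : ℂ)⁻¹
  rw [hyp_zero, map_one] at h2
  exact h2

/-! ### Stable sets of weights -/

/-- A set of weights is stable if the span of the corresponding `v_n` is. -/
def Stable (χ : Param) (S : Set ℤ) : Prop :=
  (∀ n ∈ S, n + 1 ∈ S ∨ (n : ℂ) - χ.l + χ.ε = 0) ∧ (∀ n ∈ S, n - 1 ∈ S ∨ (n : ℂ) + χ.l + χ.ε = 0)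

lemma IsSubrep.kInvariant {W : Submodule ℂ (PS χ)} (hW : IsSubrep (rep χ) W) : KInvariant W :=
  fun k _ f hf => hW.2 k f hf

lemma IsSubrep.eq_coefSupported {W : Submodule ℂ (PS χ)} (hW : IsSubrep (rep χ) W) :
    W = coefSupported χ {n | vec χ n ∈ W} := SU11.eq_coefSupported hW.1 hW.kInvariant

/-- The coefficient at a weight missing from `W` vanishes along the whole curve `π(hyp t) f`, hence
so does its derivative at `0`. Only scalar functions are differentiated, not curves in the Fréchet
space. -/
lemma IsSubrep.coef_lie {W : Submodule ℂ (PS χ)} (hW : IsSubrep (rep χ) W) {f : PS χ} (hf : f ∈ W)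
    {k : ℤ} (hk : vec χ k ∉ W) : coef k ⁅hypGen, f⁆ = 0 := by
  have h : ∀ t, coef k (rep χ (hyp t) f) = 0 := fun t => by
    have := hW.2 (hyp t) f hf
    rw [hW.eq_coefSupported] at this
    exact this k hk
  have h2 := hasDerivAt_coef_rep_hyp k f
  simp only [h] at h2
  exact h2.unique (hasDerivAt_const _ _)

lemma coef_hypGen_vec (k n : ℤ) : coef k ⁅hypGen, vec χ n⁆ =
    (n - χ.l + χ.ε) * (if n + 1 = k then 1 else 0) -
      (n + χ.l + χ.ε) * (if n - 1 = k then 1 else 0) := by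
  rw [hypGen_lie, opE_vec, opF_vec, map_add, map_smul, map_smul, coef_vec, coef_vec]
  simp only [smul_eq_mul]
  ring

/-- The single generator `E + F` suffices: `E v_n` and `F v_n` have the different weights `n + 1`
and `n - 1`, so they are read off separately from the coefficients. -/
lemma IsSubrep.stable {W : Submodule ℂ (PS χ)} (hW : IsSubrep (rep χ) W) :
    Stable χ {n | vec χ n ∈ W} := by
  refine ⟨fun n hn => ?_, fun n hn => ?_⟩
  · rw [or_iff_not_imp_left]
    intro h
    have := hW.coef_lie hn h
    rw [coef_hypGen_vec, if_pos rfl, if_neg (by omega)] at this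
    simpa using this
  · rw [or_iff_not_imp_left]
    intro h
    have := hW.coef_lie hn h
    rw [coef_hypGen_vec, if_neg (by omega), if_pos rfl] at this
    linear_combination -this

lemma Stable.mem_add {S : Set ℤ} (h : ∀ n ∈ S, n + 1 ∈ S ∨ (n : ℂ) - χ.l + χ.ε = 0) {n : ℤ}
    (hn : n ∈ S) (k : ℕ) (hk : ∀ j : ℤ, n ≤ j → j < n + k → (j : ℂ) - χ.l + χ.ε ≠ 0) :
    n + k ∈ S := by
  induction k with
  | zero => simpa using hn
  | succ k ih =>
    have h1 := ih fun j hj hj' => hk j hj (by push_cast; omega)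
    have h2 := (h _ h1).resolve_right (hk _ (by omega) (by push_cast; omega))
    push_cast
    rwa [← add_assoc]

lemma Stable.mem_sub {S : Set ℤ} (h : ∀ n ∈ S, n - 1 ∈ S ∨ (n : ℂ) + χ.l + χ.ε = 0) {n : ℤ}
    (hn : n ∈ S) (k : ℕ) (hk : ∀ j : ℤ, j ≤ n → n - k < j → (j : ℂ) + χ.l + χ.ε ≠ 0) :
    n - k ∈ S := by
  induction k with
  | zero => simpa using hn
  | succ k ih =>
    have h1 := ih fun j hj hj' => hk j hj (by push_cast; omega)
    have h2 := (h _ h1).resolve_right (hk _ (by omega) (by push_cast; omega))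
    push_cast
    rwa [← sub_sub]

/-- Climbing from `n` to `k` can only stop at the upward barrier `j = l - ε`; `Stable.mem_of_ge` is
the descent, stopped only at `j = -(l + ε)`. -/
lemma Stable.mem_of_le {S : Set ℤ} (h : Stable χ S) {n k : ℤ} (hn : n ∈ S) (hnk : n ≤ k)
    (hk : ∀ j : ℤ, n ≤ j → j < k → (j : ℂ) - χ.l + χ.ε ≠ 0) : k ∈ S := by
  have := Stable.mem_add h.1 hn (k - n).toNat fun j h1 h2 => hk j h1 (by omega)
  rwa [Int.toNat_of_nonneg (by omega), add_sub_cancel] at this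

lemma Stable.mem_of_ge {S : Set ℤ} (h : Stable χ S) {n k : ℤ} (hn : n ∈ S) (hnk : k ≤ n)
    (hk : ∀ j : ℤ, j ≤ n → k < j → (j : ℂ) + χ.l + χ.ε ≠ 0) : k ∈ S := by
  have := Stable.mem_sub h.2 hn (n - k).toNat fun j h1 h2 => hk j h1 (by omega)
  rwa [Int.toNat_of_nonneg (by omega), sub_sub_cancel] at this

/-- Because `2ε` is an integer, `l - ε` is an integer exactly when `l + ε` is, so the two barriers
are present or absent together. -/
lemma sub_ne_zero_of_not_int (h : ¬ ∃ m : ℤ, χ.l + χ.ε = m) (j : ℤ) :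
    (j : ℂ) - χ.l + χ.ε ≠ 0 := fun hj => h ⟨j + ((χ.e : ℕ) : ℤ), by
  have := χ.two_ε
  push_cast at this ⊢
  linear_combination this - hj⟩

lemma add_ne_zero_of_not_int (h : ¬ ∃ m : ℤ, χ.l + χ.ε = m) (j : ℤ) :
    (j : ℂ) + χ.l + χ.ε ≠ 0 := fun hj => h ⟨-j, by
  push_cast
  linear_combination hj⟩

lemma Stable.eq_of_not_int (h : ¬ ∃ m : ℤ, χ.l + χ.ε = m) {S : Set ℤ} (hS : Stable χ S) :
    S = ∅ ∨ S = Set.univ := by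
  rcases S.eq_empty_or_nonempty with h0 | ⟨n, hn⟩
  · exact Or.inl h0
  · refine Or.inr (Set.eq_univ_of_forall fun k => ?_)
    rcases le_total n k with hk | hk
    · exact hS.mem_of_le hn hk fun j _ _ => sub_ne_zero_of_not_int h j
    · exact hS.mem_of_ge hn hk fun j _ _ => add_ne_zero_of_not_int h j

lemma stable_empty : Stable χ ∅ := ⟨fun _ h => h.elim, fun _ h => h.elim⟩
lemma stable_univ : Stable χ Set.univ := ⟨fun _ _ => Or.inl trivial, fun _ _ => Or.inl trivial⟩

/-- The weights of `M⁺`. -/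
def weightsPlus (m : ℤ) : Set ℤ := {n | -m ≤ n}

/-- The weights of `M⁻`. -/
def weightsMinus (χ : Param) (m : ℤ) : Set ℤ := {n | n ≤ m - ((χ.e : ℕ) : ℤ)}

lemma mem_weightsPlus {m n : ℤ} : n ∈ weightsPlus m ↔ -m ≤ n := Iff.rfl
lemma mem_weightsMinus {m n : ℤ} : n ∈ weightsMinus χ m ↔ n ≤ m - ((χ.e : ℕ) : ℤ) := Iff.rfl

lemma sub_eq_zero_iff_int {m : ℤ} (h : χ.l + χ.ε = m) (j : ℤ) :
    (j : ℂ) - χ.l + χ.ε = 0 ↔ j = m - ((χ.e : ℕ) : ℤ) := by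
  have h2 := χ.two_ε
  rw [← Int.cast_inj (α := ℂ), Int.cast_sub]
  constructor
  · intro h1; linear_combination h1 - h2 + h
  · intro h1; linear_combination h1 + h2 - h

lemma add_eq_zero_iff_int {m : ℤ} (h : χ.l + χ.ε = m) (j : ℤ) :
    (j : ℂ) + χ.l + χ.ε = 0 ↔ j = -m := by
  rw [← Int.cast_inj (α := ℂ), Int.cast_neg]
  constructor
  · intro h1; linear_combination h1 - h
  · intro h1; linear_combination h1 + h

/-- Write `p = m - 2ε` for the barrier that stops upward steps out of `p`, and `q = -m` for the one
that stops downward steps out of `q`. A stable set is a union of the intervals cut out by the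
barriers, subject to the implications that the unblocked steps impose. -/
lemma Stable.eq_of_int {m : ℤ} (h : χ.l + χ.ε = m) {S : Set ℤ} (hS : Stable χ S) :
    S = ∅ ∨ S = Set.univ ∨ S = weightsPlus m ∨ S = weightsMinus χ m ∨
      S = weightsPlus m ∪ weightsMinus χ m ∨ S = weightsPlus m ∩ weightsMinus χ m := by
  have hup : ∀ n k : ℤ, n ∈ S → n ≤ k → ¬ (n ≤ m - ((χ.e : ℕ) : ℤ) ∧ m - ((χ.e : ℕ) : ℤ) < k) →
      k ∈ S := fun n k hn hk h1 => hS.mem_of_le hn hk fun j h2 h3 h4 => h1 (by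
        rw [sub_eq_zero_iff_int h] at h4; omega)
  have hdown : ∀ n k : ℤ, n ∈ S → k ≤ n → ¬ (-m ≤ n ∧ k < -m) → k ∈ S :=
    fun n k hn hk h1 => hS.mem_of_ge hn hk fun j h2 h3 h4 => h1 (by
        rw [add_eq_zero_iff_int h] at h4; omega)
  simp only [Set.ext_iff, Set.mem_union, Set.mem_inter_iff, Set.mem_univ, Set.mem_empty_iff_false,
    mem_weightsPlus, mem_weightsMinus]
  generalize m - ((χ.e : ℕ) : ℤ) = p at hup hdown ⊢
  generalize -m = q at hup hdown ⊢
  clear hS h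
  rcases le_or_gt q p with hqp | hpq
  -- Case `q ≤ p`: the blocks are `n < q`, `q ≤ n ≤ p` and `n > p`. Either outer block leads into
  -- the middle one, which cannot be left.
  · have ha : ∀ n, n < q → (n ∈ S ↔ q - 1 ∈ S) := fun n hn =>
      ⟨fun h => hup n _ h (by omega) (by omega), fun h => hdown _ n h (by omega) (by omega)⟩
    have hb : ∀ n, q ≤ n → n ≤ p → (n ∈ S ↔ q ∈ S) := fun n hn hn' =>
      ⟨fun h => hdown n _ h (by omega) (by omega), fun h => hup _ n h (by omega) (by omega)⟩
    have hc : ∀ n, p < n → (n ∈ S ↔ p + 1 ∈ S) := fun n hn =>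
      ⟨fun h => hdown n _ h (by omega) (by omega), fun h => hup _ n h (by omega) (by omega)⟩
    have hab : q - 1 ∈ S → q ∈ S := fun h => hup _ _ h (by omega) (by omega)
    have hcb : p + 1 ∈ S → q ∈ S := fun h => hdown _ _ h (by omega) (by omega)
    clear hup hdown
    by_cases h1 : q - 1 ∈ S <;> by_cases h2 : q ∈ S <;> by_cases h3 : p + 1 ∈ S <;> grind
  -- Case `p < q`: the blocks are `n ≤ p`, `p < n < q` and `n ≥ q`. The middle block leads to both
  -- outer ones, which cannot be left; it is empty when `q = p + 1`, whence the condition `p + 1 <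
  -- q` below.
  · have ha : ∀ n, n ≤ p → (n ∈ S ↔ p ∈ S) := fun n hn =>
      ⟨fun h => hup n _ h (by omega) (by omega), fun h => hdown _ n h (by omega) (by omega)⟩
    have hb : ∀ n, p < n → n < q → (n ∈ S ↔ p + 1 ∈ S) := fun n hn hn' =>
      ⟨fun h => hdown n _ h (by omega) (by omega), fun h => hup _ n h (by omega) (by omega)⟩
    have hc : ∀ n, q ≤ n → (n ∈ S ↔ q ∈ S) := fun n hn =>
      ⟨fun h => hdown n _ h (by omega) (by omega), fun h => hup _ n h (by omega) (by omega)⟩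
    have hba : p + 1 < q → p + 1 ∈ S → p ∈ S := fun _ h => hdown _ _ h (by omega) (by omega)
    have hbc : p + 1 < q → p + 1 ∈ S → q ∈ S := fun _ h => hup _ _ h (by omega) (by omega)
    clear hup hdown
    by_cases h1 : p ∈ S <;> by_cases h2 : p + 1 ∈ S <;> by_cases h3 : q ∈ S <;> grind

lemma stable_weightsPlus {m : ℤ} (h : χ.l + χ.ε = m) : Stable χ (weightsPlus m) := by
  refine ⟨fun n hn => Or.inl ?_, fun n hn => ?_⟩
  · simp only [mem_weightsPlus] at *; omega
  · rw [add_eq_zero_iff_int h]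
    simp only [mem_weightsPlus] at *; omega

lemma stable_weightsMinus {m : ℤ} (h : χ.l + χ.ε = m) : Stable χ (weightsMinus χ m) := by
  refine ⟨fun n hn => ?_, fun n hn => Or.inl ?_⟩
  · rw [sub_eq_zero_iff_int h]
    simp only [mem_weightsMinus] at *; omega
  · simp only [mem_weightsMinus] at *; omega

lemma Stable.union {S T : Set ℤ} (hS : Stable χ S) (hT : Stable χ T) : Stable χ (S ∪ T) := by
  refine ⟨fun n hn => ?_, fun n hn => ?_⟩
  · rcases hn with hn | hn
    · exact (hS.1 n hn).imp_left Or.inl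
    · exact (hT.1 n hn).imp_left Or.inr
  · rcases hn with hn | hn
    · exact (hS.2 n hn).imp_left Or.inl
    · exact (hT.2 n hn).imp_left Or.inr

lemma Stable.inter {S T : Set ℤ} (hS : Stable χ S) (hT : Stable χ T) : Stable χ (S ∩ T) := by
  refine ⟨fun n hn => ?_, fun n hn => ?_⟩
  · have h1 := hS.1 n hn.1
    have h2 := hT.1 n hn.2
    rw [Set.mem_inter_iff]; tauto
  · have h1 := hS.2 n hn.1
    have h2 := hT.2 n hn.2
    rw [Set.mem_inter_iff]; tauto

/-! ### Invariance under the group -/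

lemma continuous_coef_rep (k : ℤ) (g : SU) : Continuous fun f : PS χ => coef k (rep χ g f) := by
  obtain ⟨C, hC⟩ := exists_norm_le (PS.mk (fun z => mult χ g z) (contDiff_mult g) : PS χ)
  refine continuous_of_bound (coef k ∘ₗ rep χ g) C fun f => norm_coef_le k _ fun z => ?_
  rw [rep_apply, norm_mul]
  exact mul_le_mul (hC z) (ContinuousMap.norm_coe_le_norm (toCont f) _) (norm_nonneg _)
    ((norm_nonneg _).trans (hC z))

/-- By continuity of `f ↦ coef k (π(g) f)` and convergence of Fourier series, invariance needs to be
checked on the `v_n` only. -/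
lemma isSubrep_coefSupported {S : Set ℤ}
    (h : ∀ g : SU, ∀ n ∈ S, ∀ k, k ∉ S → coef k (rep χ g (vec χ n)) = 0) :
    IsSubrep (rep χ) (coefSupported χ S) := by
  refine ⟨isClosed_coefSupported S, fun g f hf k hk => ?_⟩
  have hcl : IsClosed {f : PS χ | coef k (rep χ g f) = 0} :=
    isClosed_eq (continuous_coef_rep k g) continuous_const
  refine hcl.mem_of_tendsto (tendsto_partialSum f) (Eventually.of_forall fun s => ?_)
  change coef k (rep χ g (∑ n ∈ s, coef n f • vec χ n)) = 0
  simp only [map_sum, map_smul, smul_eq_mul]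
  refine Finset.sum_eq_zero fun n _ => ?_
  by_cases hn : n ∈ S
  · rw [h g n hn k hk, mul_zero]
  · rw [hf n hn, zero_mul]

/-- Cauchy's theorem on the unit circle; the factor `e^{iθ}` comes from `dz = i e^{iθ} dθ`. -/
lemma integral_circle_eq_zero {F : ℂ → ℂ} (hF : ∀ z, ‖z‖ ≤ 1 → DifferentiableAt ℂ F z) :
    ∫ θ in (0 : ℝ)..(2 * Real.pi), (Circle.exp θ : ℂ) * F (Circle.exp θ) = 0 := by
  have h := Complex.circleIntegral_eq_zero_of_differentiable_on_off_countable (R := 1) zero_le_one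
    (f := F) (c := 0) Set.countable_empty
    (fun z hz => (hF z (mem_closedBall_zero_iff.1 hz)).continuousAt.continuousWithinAt)
    (fun z hz => hF z (mem_ball_zero_iff.1 hz.1).le)
  rw [circleIntegral] at h
  have h2 : ∀ θ : ℝ, deriv (circleMap 0 1) θ • F (circleMap 0 1 θ) =
      Complex.I * ((Circle.exp θ : ℂ) * F (Circle.exp θ)) := by
    intro θ
    have : circleMap 0 1 θ = Circle.exp θ := by simp [circleMap]
    rw [deriv_circleMap, this, smul_eq_mul]
    ring
  simp only [h2, intervalIntegral.integral_const_mul] at h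
  exact (mul_eq_zero.1 h).resolve_left Complex.I_ne_zero

lemma avg_eq_zero_of_holomorphic {f : PS χ} {F : ℂ → ℂ}
    (hF : ∀ z, ‖z‖ ≤ 1 → DifferentiableAt ℂ F z) (hf : ∀ z : Circle, f z = z * F z) :
    avg f = 0 := by
  rw [avg_apply]
  refine mul_eq_zero_of_right _ ?_
  simp only [pull, hf]
  exact integral_circle_eq_zero hF

lemma avg_eq_zero_of_antiholomorphic {f : PS χ} {F : ℂ → ℂ}
    (hF : ∀ z, ‖z‖ ≤ 1 → DifferentiableAt ℂ F z)
    (hf : ∀ z : Circle, f z = ((z⁻¹ : Circle) : ℂ) * F ((z⁻¹ : Circle) : ℂ)) :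
    avg f = 0 := by
  have hper : Function.Periodic
      (fun θ : ℝ => (Circle.exp θ : ℂ) * F (Circle.exp θ)) (2 * Real.pi) := fun θ => by
    simp only [Circle.exp_add, Circle.exp_two_pi, mul_one]
  -- The substitution `θ ↦ -θ` turns `z⁻¹` into `z` and moves the integral to `[-2π, 0]`, which
  -- periodicity moves back.
  have h := hper.intervalIntegral_add_eq (-(2 * Real.pi)) 0
  rw [neg_add_cancel, zero_add, integral_circle_eq_zero hF] at h
  have h2 := intervalIntegral.integral_comp_neg (a := 0) (b := 2 * Real.pi)
    (fun θ : ℝ => (Circle.exp θ : ℂ) * F (Circle.exp θ))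
  rw [neg_zero, h] at h2
  rw [avg_apply]
  refine mul_eq_zero_of_right _ ?_
  simp only [pull, hf]
  simpa only [Circle.exp_neg] using h2

/-- With `w = a - b̄ z` the multiplier is `w^{l+ε} w̄^{l-ε}`, and in the integral case both
exponents are integers, so the complex power of `|w|` disappears. -/
lemma mult_eq_zpow {m : ℤ} (h : χ.l + χ.ε = m) (g : SU) (z : Circle) :
    mult χ g z = wfac g z ^ m * star (wfac g z) ^ (m - ((χ.e : ℕ) : ℤ)) := by
  have h0 := wfac_ne g z
  have h1 : 2 * χ.l - 2 * χ.ε = ((2 * (m - ((χ.e : ℕ) : ℤ)) : ℤ) : ℂ) := by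
    have := χ.two_ε
    push_cast at this ⊢
    linear_combination 2 * h - 2 * this
  have h2 : ((‖wfac g z‖ : ℝ) : ℂ) ^ (2 : ℤ) = wfac g z * star (wfac g z) := by
    rw [zpow_ofNat]
    exact (Complex.mul_conj' _).symm
  rw [mult, h1, Complex.cpow_intCast, zpow_mul, h2, mul_zpow, ← zpow_natCast, mul_right_comm,
    ← zpow_add₀ h0, sub_add_cancel]

lemma rep_vec_apply {m : ℤ} (h : χ.l + χ.ε = m) (g : SU) (n : ℤ) (z : Circle) :
    (rep χ g (vec χ n)) z = wfac g z ^ (m + n) * star (wfac g z) ^ (m - ((χ.e : ℕ) : ℤ) - n) *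
      (z : ℂ) ^ (-n) := by
  have h0 := wfac_ne g z
  have h1 : star (wfac g z) ≠ 0 := star_ne_zero.2 h0
  rw [rep_apply, mult_eq_zpow h, vec_apply, coe_mob, nfac_eq, div_zpow, mul_zpow, zpow_add₀ h0,
    zpow_sub₀ h1 _ n, zpow_neg, zpow_neg, zpow_neg]
  field_simp

/-- Follows from `|a|² - |b|² = 1`; it places the zeros of `a - b̄ z` and `ā - b z` outside the
closed disc, so their integer powers are holomorphic on it. -/
lemma norm_ent_lt (g : SU) : ‖ent g 0 1‖ < ‖ent g 0 0‖ := by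
  have h := ent_det g
  rw [ent_10, ent_11] at h
  have h1 : ent g 0 0 * star (ent g 0 0) = ((‖ent g 0 0‖ ^ 2 : ℝ) : ℂ) := by
    push_cast; exact Complex.mul_conj' _
  have h2 : ent g 0 1 * star (ent g 0 1) = ((‖ent g 0 1‖ ^ 2 : ℝ) : ℂ) := by
    push_cast; exact Complex.mul_conj' _
  rw [h1, h2] at h
  have h3 : ‖ent g 0 0‖ ^ 2 - ‖ent g 0 1‖ ^ 2 = 1 := by exact_mod_cast h
  exact lt_of_pow_lt_pow_left₀ 2 (norm_nonneg _) (by linarith)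

lemma sub_mul_ne_zero {a b z : ℂ} (h : ‖b‖ < ‖a‖) (hz : ‖z‖ ≤ 1) : a - b * z ≠ 0 := by
  intro h0
  rw [sub_eq_zero] at h0
  have h1 : ‖a‖ ≤ ‖b‖ := by
    rw [h0, norm_mul]
    exact mul_le_of_le_one_right (norm_nonneg _) hz
  linarith

/-- For `n ≥ -m` the exponent `m + n` of `w = z (a z⁻¹ - b̄)` is nonnegative, and `w̄ = ā - b z⁻¹`
is holomorphic without zeros in `z⁻¹` on the closed disc. The powers of `z` in `z^k π(g) v_n`
combine to `z^{k+m}`, so for `k < -m` the function is `z⁻¹` times a holomorphic function of `z⁻¹`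
and has mean zero. -/
lemma coef_rep_vec_weightsPlus {m : ℤ} (h : χ.l + χ.ε = m) (g : SU) {n k : ℤ}
    (hn : n ∈ weightsPlus m) (hk : k ∉ weightsPlus m) : coef k (rep χ g (vec χ n)) = 0 := by
  rw [mem_weightsPlus] at hn hk
  obtain ⟨j, hj⟩ := Int.eq_ofNat_of_zero_le (show 0 ≤ m + n by omega)
  -- The `-1` reserves one factor `z⁻¹` for the differential in Cauchy's theorem.
  obtain ⟨i, hi⟩ := Int.eq_ofNat_of_zero_le (show 0 ≤ -m - k - 1 by omega)
  have hlt : ‖ent g 0 1‖ < ‖ent g 1 1‖ := by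
    rw [ent_11, norm_star]; exact norm_ent_lt g
  rw [coef_apply]
  refine avg_eq_zero_of_antiholomorphic (F := fun w => w ^ i * (ent g 0 0 * w - ent g 1 0) ^ j *
    (ent g 1 1 - ent g 0 1 * w) ^ (m - ((χ.e : ℕ) : ℤ) - n)) (fun w hw => ?_) fun z => ?_
  · refine DifferentiableAt.mul (by fun_prop) (DifferentiableAt.zpow (by fun_prop) (Or.inl ?_))
    exact sub_mul_ne_zero hlt hw
  · have hz := Circle.coe_ne_zero z
    have hs : star (wfac g z) = ent g 1 1 - ent g 0 1 * ((z⁻¹ : Circle) : ℂ) := by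
      rw [wfac, star_sub, star_mul', ent_10, ent_11, star_star, Circle.coe_inv_eq_conj]; rfl
    have hw : wfac g z = z * (ent g 0 0 * ((z⁻¹ : Circle) : ℂ) - ent g 1 0) := by
      rw [wfac, Circle.coe_inv]; field_simp
    rw [zmul_apply, rep_vec_apply h, hs, hj, hw, zpow_natCast, mul_pow]
    have hpow : (z : ℂ) ^ k * z ^ j * z ^ (-n) = (z : ℂ)⁻¹ * (z : ℂ)⁻¹ ^ i := by
      rw [← zpow_natCast, ← zpow_natCast, ← hj, ← hi, inv_zpow', ← zpow_neg_one, ← zpow_add₀ hz,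
        ← zpow_add₀ hz, ← zpow_add₀ hz]
      congr 1; ring
    rw [Circle.coe_inv]
    linear_combination ((ent g 0 0 * (z : ℂ)⁻¹ - ent g 1 0) ^ j *
      (ent g 1 1 - ent g 0 1 * (z : ℂ)⁻¹) ^ (m - ((χ.e : ℕ) : ℤ) - n)) * hpow

/-- The mirror image: for `n ≤ m - 2ε` the exponent of `w̄ = z⁻¹ (ā z - b)` is nonnegative and `w`
has no zeros on the closed disc. The powers of `z` combine to `z^{k - (m - 2ε)}`, a positive power
when `k > m - 2ε`. -/
lemma coef_rep_vec_weightsMinus {m : ℤ} (h : χ.l + χ.ε = m) (g : SU) {n k : ℤ}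
    (hn : n ∈ weightsMinus χ m) (hk : k ∉ weightsMinus χ m) :
    coef k (rep χ g (vec χ n)) = 0 := by
  rw [mem_weightsMinus] at hn hk
  obtain ⟨j, hj⟩ := Int.eq_ofNat_of_zero_le (show 0 ≤ m - ((χ.e : ℕ) : ℤ) - n by omega)
  obtain ⟨i, hi⟩ := Int.eq_ofNat_of_zero_le (show 0 ≤ k - (m - ((χ.e : ℕ) : ℤ)) - 1 by omega)
  have hlt : ‖ent g 1 0‖ < ‖ent g 0 0‖ := by
    rw [ent_10, norm_star]; exact norm_ent_lt g
  rw [coef_apply]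
  refine avg_eq_zero_of_holomorphic (F := fun w => w ^ i * (ent g 1 1 * w - ent g 0 1) ^ j *
    (ent g 0 0 - ent g 1 0 * w) ^ (m + n)) (fun w hw => ?_) fun z => ?_
  · refine DifferentiableAt.mul (by fun_prop) (DifferentiableAt.zpow (by fun_prop) (Or.inl ?_))
    exact sub_mul_ne_zero hlt hw
  · have hz := Circle.coe_ne_zero z
    have hs : star (wfac g z) = (z : ℂ)⁻¹ * (ent g 1 1 * z - ent g 0 1) := by
      have := nfac_eq g z
      rw [← nfac, this]
      field_simp
    rw [zmul_apply, rep_vec_apply h, hs, hj, wfac, zpow_natCast, mul_pow]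
    have hpow : (z : ℂ) ^ k * (z : ℂ)⁻¹ ^ j * z ^ (-n) = z * (z : ℂ) ^ i := by
      rw [← zpow_natCast, ← zpow_natCast, ← hj, ← hi, inv_zpow', ← zpow_one_add₀ hz, ← zpow_add₀ hz,
        ← zpow_add₀ hz]
      congr 1; ring
    linear_combination ((ent g 1 1 * (z : ℂ) - ent g 0 1) ^ j *
      (ent g 0 0 - ent g 1 0 * (z : ℂ)) ^ (m + n)) * hpow

lemma IsSubrep.inf {V W : Submodule ℂ (PS χ)} (hV : IsSubrep (rep χ) V) (hW : IsSubrep (rep χ) W) :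
    IsSubrep (rep χ) (V ⊓ W) :=
  ⟨hV.1.inter hW.1, fun g f hf => ⟨hV.2 g f hf.1, hW.2 g f hf.2⟩⟩

lemma IsSubrep.union {S T : Set ℤ} (hS : IsSubrep (rep χ) (coefSupported χ S))
    (hT : IsSubrep (rep χ) (coefSupported χ T)) : IsSubrep (rep χ) (coefSupported χ (S ∪ T)) := by
  refine ⟨isClosed_coefSupported _, fun g f hf => ?_⟩
  rw [← coefSupported_sup] at hf ⊢
  obtain ⟨a, ha, b, hb, rfl⟩ := Submodule.mem_sup.1 hf
  rw [map_add]
  exact Submodule.add_mem_sup (hS.2 g a ha) (hT.2 g b hb)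

/-- Proved through the classification: only the weights of `M⁺` and `M⁻` need the integral
computation, the remaining stable sets being trivial or obtained by union and intersection. -/
lemma Stable.isSubrep {S : Set ℤ} (hS : Stable χ S) : IsSubrep (rep χ) (coefSupported χ S) := by
  have hempty : IsSubrep (rep χ) (coefSupported χ ∅) :=
    isSubrep_coefSupported fun _ _ h => h.elim
  have huniv : IsSubrep (rep χ) (coefSupported χ Set.univ) :=
    isSubrep_coefSupported fun _ _ _ k hk => absurd (Set.mem_univ k) hk
  by_cases h : ∃ m : ℤ, χ.l + χ.ε = m
  · obtain ⟨m, hm⟩ := h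
    have hp : IsSubrep (rep χ) (coefSupported χ (weightsPlus m)) :=
      isSubrep_coefSupported fun g n hn k hk => coef_rep_vec_weightsPlus hm g hn hk
    have hq : IsSubrep (rep χ) (coefSupported χ (weightsMinus χ m)) :=
      isSubrep_coefSupported fun g n hn k hk => coef_rep_vec_weightsMinus hm g hn hk
    rcases hS.eq_of_int hm with rfl | rfl | rfl | rfl | rfl | rfl
    · exact hempty
    · exact huniv
    · exact hp
    · exact hq
    · exact hp.union hq
    · rw [← coefSupported_inf]
      exact hp.inf hq
  · rcases hS.eq_of_not_int h with rfl | rfl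
    · exact hempty
    · exact huniv

/-- The subrepresentations correspond to the stable sets of weights. -/
lemma isSubrep_iff {W : Submodule ℂ (PS χ)} :
    IsSubrep (rep χ) W ↔ ∃ S, Stable χ S ∧ W = coefSupported χ S :=
  ⟨fun h => ⟨_, h.stable, h.eq_coefSupported⟩, by rintro ⟨S, hS, rfl⟩; exact hS.isSubrep⟩

/-! ### Generalities on Lie modules -/

lemma isIrreducible_of_atom {V : Type} [AddCommGroup V] [Module ℂ V] [LieRingModule sl2 V]
    {N : LieSubmodule ℂ sl2 V} (h : N ≠ ⊥)
    (hN : ∀ N' : LieSubmodule ℂ sl2 V, N' ≤ N → N' = ⊥ ∨ N' = N) :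
    LieModule.IsIrreducible ℂ sl2 N := by
  have : Nontrivial N := (LieSubmodule.nontrivial_iff_ne_bot ℂ sl2 V).2 h
  refine LieModule.IsIrreducible.mk fun Q hQ => ?_
  rcases hN (LieSubmodule.map N.incl Q) (by
    intro x hx
    obtain ⟨y, -, rfl⟩ := (LieSubmodule.mem_map _).1 hx
    exact y.2) with h1 | h1
  · refine absurd ?_ hQ
    rw [LieSubmodule.eq_bot_iff]
    intro q hq
    have := LieSubmodule.mem_map_of_mem (f := N.incl) hq
    rw [h1, LieSubmodule.mem_bot] at this
    exact Subtype.ext this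
  · rw [eq_top_iff]
    intro q _
    have : (q : V) ∈ LieSubmodule.map N.incl Q := by rw [h1]; exact q.2
    obtain ⟨y, hy, hyq⟩ := (LieSubmodule.mem_map _).1 this
    have : y = q := Subtype.ext hyq
    exact this ▸ hy

section LieGeneral

variable {V X : Type} [AddCommGroup V] [Module ℂ V] [LieRingModule sl2 V] [LieModule ℂ sl2 V]
  [AddCommGroup X] [Module ℂ X] [LieRingModule sl2 X] [LieModule ℂ sl2 X]

/-- A bijective homomorphism of Lie modules is an isomorphism. -/
def lieModuleEquivOfBijective (f : V →ₗ⁅ℂ, sl2⁆ X) (h : Function.Bijective f) :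
    V ≃ₗ⁅ℂ, sl2⁆ X :=
  { f with
    invFun := (LinearEquiv.ofBijective (f : V →ₗ[ℂ] X) h).symm
    left_inv := (LinearEquiv.ofBijective (f : V →ₗ[ℂ] X) h).left_inv
    right_inv := (LinearEquiv.ofBijective (f : V →ₗ[ℂ] X) h).right_inv }

lemma isIrreducible_subQuot {N₁ N₂ : LieSubmodule ℂ sl2 V} (h : N₁ < N₂)
    (hN : ∀ N : LieSubmodule ℂ sl2 V, N₁ ≤ N → N ≤ N₂ → N = N₁ ∨ N = N₂) :
    LieModule.IsIrreducible ℂ sl2 (SubQuot N₁ N₂) := by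
  set mk := LieSubmodule.Quotient.mk' (LieSubmodule.comap N₂.incl N₁) with hmk
  have hker : ∀ x : N₂, mk x = 0 ↔ (x : V) ∈ N₁ := fun x => by
    rw [hmk, LieSubmodule.Quotient.mk_eq_zero, LieSubmodule.mem_comap]
    rfl
  have hsurj : Function.Surjective mk := LieSubmodule.Quotient.surjective_mk' _
  have hnt : Nontrivial (SubQuot N₁ N₂) := by
    obtain ⟨x, hx, hx'⟩ := SetLike.exists_of_lt h
    exact ⟨mk ⟨x, hx⟩, 0, fun h0 => hx' ((hker _).1 h0)⟩
  refine LieModule.IsIrreducible.mk fun Q hQ => ?_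
  have hmem : ∀ x : N₂,
      (x : V) ∈ LieSubmodule.map N₂.incl (LieSubmodule.comap mk Q) ↔ mk x ∈ Q := by
    intro x
    constructor
    · intro hx
      obtain ⟨y, hy, hyx⟩ := (LieSubmodule.mem_map _).1 hx
      have : y = x := Subtype.ext hyx
      rw [← this]
      exact LieSubmodule.mem_comap.1 hy
    · intro hx
      exact LieSubmodule.mem_map_of_mem (LieSubmodule.mem_comap.2 hx)
  have hle₁ : N₁ ≤ LieSubmodule.map N₂.incl (LieSubmodule.comap mk Q) := by
    intro x hx
    refine (hmem ⟨x, h.le hx⟩).2 ?_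
    rw [(hker ⟨x, h.le hx⟩).2 hx]
    exact Q.zero_mem
  have hle₂ : LieSubmodule.map N₂.incl (LieSubmodule.comap mk Q) ≤ N₂ := by
    intro x hx
    obtain ⟨y, -, rfl⟩ := (LieSubmodule.mem_map _).1 hx
    exact y.2
  rcases hN _ hle₁ hle₂ with h1 | h1
  · refine absurd ?_ hQ
    rw [LieSubmodule.eq_bot_iff]
    intro q hq
    obtain ⟨x, rfl⟩ := hsurj q
    rw [hker, ← h1, hmem]
    exact hq
  · rw [eq_top_iff]
    intro q _
    obtain ⟨x, rfl⟩ := hsurj q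
    rw [← hmem, h1]
    exact x.2

/-- `N ≃ N / 0`. -/
def subQuotBot (N : LieSubmodule ℂ sl2 V) : N ≃ₗ⁅ℂ, sl2⁆ SubQuot ⊥ N :=
  lieModuleEquivOfBijective (LieSubmodule.Quotient.mk' (LieSubmodule.comap N.incl ⊥)) <| by
    refine ⟨(injective_iff_map_eq_zero _).2 fun x hx => ?_, LieSubmodule.Quotient.surjective_mk' _⟩
    rw [LieSubmodule.Quotient.mk_eq_zero, LieSubmodule.mem_comap, LieSubmodule.mem_bot] at hx
    exact Subtype.ext hx

lemma isCompl_subQuotIm {N₁ N₂ A B : LieSubmodule ℂ sl2 V} (hA : A ≤ N₂) (hB : B ≤ N₂)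
    (hinf : A ⊓ B ≤ N₁) (hN₁ : N₁ ≤ B) (hsup : N₂ ≤ A ⊔ B) :
    IsCompl (SubQuotIm N₁ N₂ A) (SubQuotIm N₁ N₂ B) := by
  constructor
  · rw [disjoint_iff, LieSubmodule.eq_bot_iff]
    rintro q ⟨hqa, hqb⟩
    obtain ⟨a, ha, rfl⟩ := (LieSubmodule.mem_map _).1 hqa
    obtain ⟨b, hb, hab⟩ := (LieSubmodule.mem_map _).1 hqb
    rw [LieSubmodule.mem_comap] at ha hb
    rw [LieSubmodule.Quotient.mk_eq_zero, LieSubmodule.mem_comap]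
    refine hinf ⟨ha, ?_⟩
    rw [← sub_eq_zero, ← map_sub, LieSubmodule.Quotient.mk_eq_zero, LieSubmodule.mem_comap] at hab
    -- The representatives differ by an element of `N₁ ≤ B`, so `a ∈ A ⊓ B ≤ N₁`.
    have := B.sub_mem hb (hN₁ hab)
    rw [map_sub, sub_sub_cancel] at this
    exact this
  · rw [codisjoint_iff, eq_top_iff]
    intro q _
    obtain ⟨x, rfl⟩ := LieSubmodule.Quotient.surjective_mk' _ q
    obtain ⟨a, ha, b, hb, hab⟩ := (LieSubmodule.mem_sup _ _ _).1 (hsup x.2)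
    have hx : x = ⟨a, hA ha⟩ + ⟨b, hB hb⟩ := Subtype.ext hab.symm
    rw [hx, map_add]
    refine add_mem ?_ ?_
    · exact (le_sup_left : SubQuotIm N₁ N₂ A ≤ _)
        (LieSubmodule.mem_map_of_mem (LieSubmodule.mem_comap.2 ha))
    · exact (le_sup_right : SubQuotIm N₁ N₂ B ≤ _)
        (LieSubmodule.mem_map_of_mem (LieSubmodule.mem_comap.2 hb))

end LieGeneral

/-! ### Lie submodules of the Harish-Chandra module -/

lemma coef_opH (n : ℤ) (f : PS χ) : coef n (opH χ f) = 2 * (n + χ.ε) * coef n f := by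
  simp only [opH, LinearMap.smul_apply, LinearMap.add_apply, Module.End.one_apply, map_add,
    map_smul, coef_ddθ, smul_eq_mul]
  linear_combination (-2 * (n : ℂ) * coef n f) * Complex.I_sq

lemma coef_opE (n : ℤ) (f : PS χ) :
    coef n (opE χ f) = (((n - 1 : ℤ) : ℂ) - χ.l + χ.ε) * coef (n - 1) f := by
  simp only [opE, Module.End.mul_apply, LinearMap.smul_apply, LinearMap.sub_apply,
    Module.End.one_apply, coef_zmul, map_sub, map_smul, coef_ddθ, smul_eq_mul, ← sub_eq_add_neg]
  linear_combination (-((n - 1 : ℤ) : ℂ) * coef (n - 1) f) * Complex.I_sq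

lemma coef_opF (n : ℤ) (f : PS χ) :
    coef n (opF χ f) = -(((n + 1 : ℤ) : ℂ) + χ.l + χ.ε) * coef (n + 1) f := by
  simp only [opF, Module.End.mul_apply, LinearMap.smul_apply, LinearMap.add_apply,
    LinearMap.neg_apply, map_neg, Module.End.one_apply, coef_zmul, map_add, map_smul, coef_ddθ,
    smul_eq_mul]
  linear_combination (((n + 1 : ℤ) : ℂ) * coef (n + 1) f) * Complex.I_sq

/-- Works on all smooth functions and not only on `K`-finite ones, because each coefficient of `E f`
or `F f` involves a single coefficient of `f`. -/
lemma Stable.lie_mem_coefSupported {S : Set ℤ} (hS : Stable χ S) (A : sl2) {f : PS χ}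
    (hf : f ∈ coefSupported χ S) : ⁅A, f⁆ ∈ coefSupported χ S := by
  intro n hn
  have h1 : coef n (opE χ f) = 0 := by
    rw [coef_opE]
    by_cases h : n - 1 ∈ S
    · rw [(hS.1 _ h).resolve_left (by rwa [sub_add_cancel]), zero_mul]
    · rw [hf _ h, mul_zero]
  have h2 : coef n (opF χ f) = 0 := by
    rw [coef_opF]
    by_cases h : n + 1 ∈ S
    · rw [(hS.2 _ h).resolve_left (by rwa [add_sub_cancel_right]), neg_zero, zero_mul]
    · rw [hf _ h, mul_zero]
  rw [lie_eq, map_add, map_add, map_smul, map_smul, map_smul, coef_opH, hf n hn, h1, h2]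
  simp

/-- The Lie algebra element with given action `h H + e E + f F`. -/
def sl2Elt (h e f : ℂ) : sl2 := ⟨!![h, e; f, -h], by
  change Matrix.trace (!![h, e; f, -h] : Matrix (Fin 2) (Fin 2) ℂ) = 0
  simp [Matrix.trace_fin_two]⟩

lemma sl2Elt_lie (h e f : ℂ) (u : PS χ) :
    ⁅sl2Elt h e f, u⁆ = h • opH χ u + e • opE χ u + f • opF χ u := rfl

lemma opH_mem (N : LieSubmodule ℂ sl2 (PS χ)) {f : PS χ} (hf : f ∈ N) : opH χ f ∈ N := by
  simpa [sl2Elt_lie] using N.lie_mem (x := sl2Elt 1 0 0) hf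

lemma opE_mem (N : LieSubmodule ℂ sl2 (PS χ)) {f : PS χ} (hf : f ∈ N) : opE χ f ∈ N := by
  simpa [sl2Elt_lie] using N.lie_mem (x := sl2Elt 0 1 0) hf

lemma opF_mem (N : LieSubmodule ℂ sl2 (PS χ)) {f : PS χ} (hf : f ∈ N) : opF χ f ∈ N := by
  simpa [sl2Elt_lie] using N.lie_mem (x := sl2Elt 0 0 1) hf

/-- The element is `∏ (H - 2(k + ε)) f`, which has lost the weights in `s`. -/
lemma exists_mem_coef_eq_prod (N : LieSubmodule ℂ sl2 (PS χ)) {f : PS χ} (hf : f ∈ N)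
    (s : Finset ℤ) :
    ∃ g ∈ N, ∀ n, coef n g = (∏ k ∈ s, (2 * ((n : ℂ) - k))) * coef n f := by
  induction s using Finset.induction_on with
  | empty => exact ⟨f, hf, by simp⟩
  | insert a s ha ih =>
    obtain ⟨g, hg, hgn⟩ := ih
    refine ⟨opH χ g - (2 * (a + χ.ε)) • g, N.sub_mem (opH_mem N hg) (N.smul_mem _ hg), fun n => ?_⟩
    rw [map_sub, map_smul, coef_opH, hgn, Finset.prod_insert ha, smul_eq_mul]
    ring

/-- Since `f` has finitely many weights with distinct `H`-eigenvalues, a polynomial in `H` kills all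
of them but `n`. This is the algebraic counterpart of averaging over `K_ℝ`. -/
lemma vec_mem_of_coef_ne_zero (N : LieSubmodule ℂ sl2 (PS χ)) (hN : N ≤ HC χ) {f : PS χ}
    (hf : f ∈ N) {n : ℤ} (hn : coef n f ≠ 0) : vec χ n ∈ N := by
  have hfin : {n | coef n f ≠ 0}.Finite := by
    refine finite_of_mem_vecSpan (S := Set.univ) ?_
    rw [← coe_HC]
    exact hN hf
  obtain ⟨g, hg, hgn⟩ := exists_mem_coef_eq_prod N hf (hfin.toFinset.erase n)
  set c := coef n g with hc
  have hc0 : c ≠ 0 := by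
    rw [hc, hgn]
    refine mul_ne_zero (Finset.prod_ne_zero_iff.2 fun k hk => ?_) hn
    refine mul_ne_zero two_ne_zero (sub_ne_zero.2 ?_)
    exact_mod_cast (Finset.ne_of_mem_erase hk).symm
  have hgc : g = c • vec χ n := by
    refine ext_coef fun k => ?_
    rw [map_smul, coef_vec, smul_eq_mul]
    split_ifs with h
    · rw [← h, mul_one]
    · rw [mul_zero, hgn]
      by_cases hk : coef k f = 0
      · rw [hk, mul_zero]
      · rw [Finset.prod_eq_zero (i := k) (Finset.mem_erase.2 ⟨Ne.symm h, by simpa using hk⟩)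
          (by ring), zero_mul]
  have := N.smul_mem c⁻¹ hg
  rwa [hgc, smul_smul, inv_mul_cancel₀ hc0, one_smul] at this

lemma toSubmodule_eq_vecSpan {N : LieSubmodule ℂ sl2 (PS χ)} (hN : N ≤ HC χ) :
    (N : Submodule ℂ (PS χ)) = vecSpan χ {n | vec χ n ∈ N} := by
  refine le_antisymm (fun f hf => ?_) (Submodule.span_le.2 ?_)
  · rw [mem_vecSpan_iff]
    refine ⟨finite_of_mem_vecSpan (S := Set.univ) (by rw [← coe_HC]; exact hN hf), fun n hn => ?_⟩
    by_contra h
    exact hn (vec_mem_of_coef_ne_zero N hN hf h)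
  · rintro _ ⟨n, hn, rfl⟩
    exact hn

lemma stable_of_lieSubmodule {N : LieSubmodule ℂ sl2 (PS χ)} (hN : N ≤ HC χ) :
    Stable χ {n | vec χ n ∈ N} := by
  refine ⟨fun n hn => ?_, fun n hn => ?_⟩
  · rw [or_iff_not_imp_right]
    intro h
    refine vec_mem_of_coef_ne_zero N hN (opE_mem N hn) (n := n + 1) ?_
    rw [opE_vec, map_smul, coef_vec, if_pos rfl, smul_eq_mul, mul_one]
    exact h
  · rw [or_iff_not_imp_right]
    intro h
    refine vec_mem_of_coef_ne_zero N hN (opF_mem N hn) (n := n - 1) ?_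
    rw [opF_vec, map_smul, coef_vec, if_pos rfl, smul_eq_mul, mul_one]
    exact neg_ne_zero.2 h

lemma exists_stable_of_le_HC {N : LieSubmodule ℂ sl2 (PS χ)} (hN : N ≤ HC χ) :
    ∃ S, Stable χ S ∧ (N : Submodule ℂ (PS χ)) = vecSpan χ S :=
  ⟨_, stable_of_lieSubmodule hN, toSubmodule_eq_vecSpan hN⟩

/-- Invariance under `K_ℝ` is automatic, because the submodule is spanned by weight vectors. -/
lemma isGK_of_le_HC {N : LieSubmodule ℂ sl2 (PS χ)} (hN : N ≤ HC χ) : IsGK N :=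
  ⟨hN, by rw [toSubmodule_eq_vecSpan hN]; exact kInvariant_vecSpan _⟩

lemma le_HC_of_eq_vecSpan {N : LieSubmodule ℂ sl2 (PS χ)} {S : Set ℤ}
    (hN : (N : Submodule ℂ (PS χ)) = vecSpan χ S) : N ≤ HC χ := by
  rw [← LieSubmodule.toSubmodule_le_toSubmodule, hN, coe_HC]
  exact vecSpan_mono (Set.subset_univ _)

/-! ### Covers of stable sets -/

/-- `S ⊂ T` are stable and there is no stable set strictly between. -/
def StableCover (χ : Param) (S T : Set ℤ) : Prop :=
  Stable χ S ∧ Stable χ T ∧ S ⊆ T ∧ S ≠ T ∧ ∀ R, Stable χ R → S ⊆ R → R ⊆ T → R = S ∨ R = T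

lemma StableCover.isIrredQuot {S T : Set ℤ} (h : StableCover χ S T) :
    IsIrredQuot (rep χ) (coefSupported χ S) (coefSupported χ T) := by
  obtain ⟨hS, hT, hle, hne, hR⟩ := h
  refine ⟨hS.isSubrep, hT.isSubrep,
    lt_of_le_of_ne (coefSupported_mono hle) fun h => hne (coefSupported_injective h), ?_⟩
  intro W hW h1 h2
  obtain ⟨R, hRs, rfl⟩ := isSubrep_iff.1 hW
  exact (hR R hRs (coefSupported_le_iff.1 h1) (coefSupported_le_iff.1 h2)).imp
    (congrArg _) (congrArg _)

lemma StableCover.eq_or_eq {S T : Set ℤ} (h : StableCover χ S T)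
    {N₁ N₂ N : LieSubmodule ℂ sl2 (PS χ)}
    (h₁ : (N₁ : Submodule ℂ (PS χ)) = vecSpan χ S) (h₂ : (N₂ : Submodule ℂ (PS χ)) = vecSpan χ T)
    (hN₁ : N₁ ≤ N) (hN₂ : N ≤ N₂) : N = N₁ ∨ N = N₂ := by
  obtain ⟨R, hR, hNR⟩ := exists_stable_of_le_HC (hN₂.trans (le_HC_of_eq_vecSpan h₂))
  simp only [← LieSubmodule.toSubmodule_inj, ← LieSubmodule.toSubmodule_le_toSubmodule, h₁, h₂, hNR,
    vecSpan_le_iff] at *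
  exact (h.2.2.2.2 R hR hN₁ hN₂).imp (congrArg _) (congrArg _)

lemma StableCover.isIrreducible_subQuot {S T : Set ℤ} (h : StableCover χ S T)
    {N₁ N₂ : LieSubmodule ℂ sl2 (PS χ)} (h₁ : (N₁ : Submodule ℂ (PS χ)) = vecSpan χ S)
    (h₂ : (N₂ : Submodule ℂ (PS χ)) = vecSpan χ T) :
    LieModule.IsIrreducible ℂ sl2 (SubQuot N₁ N₂) := by
  refine SU11.isIrreducible_subQuot (lt_of_le_of_ne ?_ fun h' => h.2.2.2.1 ?_)
    fun N => h.eq_or_eq h₁ h₂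
  · rw [← LieSubmodule.toSubmodule_le_toSubmodule, h₁, h₂]
    exact vecSpan_mono h.2.2.1
  · exact vecSpan_injective (χ := χ) (by rw [← h₁, ← h₂, h'])

lemma StableCover.isIrreducible {T : Set ℤ} (h : StableCover χ ∅ T)
    {N : LieSubmodule ℂ sl2 (PS χ)} (hN : (N : Submodule ℂ (PS χ)) = vecSpan χ T) :
    LieModule.IsIrreducible ℂ sl2 N := by
  refine isIrreducible_of_atom (fun h' => h.2.2.2.1 ?_)
    fun N' hN' => h.eq_or_eq ?_ hN bot_le hN'
  · refine vecSpan_injective (χ := χ) ?_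
    rw [← hN, h', vecSpan_empty, LieSubmodule.bot_toSubmodule]
  · rw [vecSpan_empty, LieSubmodule.bot_toSubmodule]

/-! ### Identification of subquotients with standard modules -/

lemma mem_of_basis {ι X : Type} [AddCommGroup X] [Module ℂ X] (b : Module.Basis ι ℂ X)
    (L : X →ₗ[ℂ] PS χ) (U : Submodule ℂ (PS χ)) (h : ∀ i, L (b i) ∈ U)
    (x : X) : L x ∈ U := by
  have : (⊤ : Submodule ℂ X) ≤ U.comap L := by
    rw [← b.span_eq, Submodule.span_le]
    rintro _ ⟨i, rfl⟩
    exact h i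
  exact this trivial

/-- Weight vectors `c_i v_{ν(i)}`, with `ν` enumerating `T \ S`, on which `sl(2, ℂ)` acts modulo the
span of the `v_n`, `n ∈ S`, as it does on the basis `b` of `X`. -/
structure WeightModel (χ : Param) (S T : Set ℤ) {ι X : Type} [AddCommGroup X] [Module ℂ X]
    [LieRingModule sl2 X] (b : Module.Basis ι ℂ X) where
  ν : ι → ℤ
  c : ι → ℂ
  injective : Function.Injective ν
  c_ne : ∀ i, c i ≠ 0
  mem : ∀ i, ν i ∈ T
  notMem : ∀ i, ν i ∉ S
  cover : ∀ n ∈ T, n ∈ S ∨ ∃ i, ν i = n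
  lie : ∀ (A : sl2) (i : ι), b.constr ℂ (fun i => c i • vec χ (ν i)) ⁅A, b i⁆ -
    ⁅A, c i • vec χ (ν i)⁆ ∈ vecSpan χ S

namespace WeightModel

variable {S T : Set ℤ} {ι X : Type} [AddCommGroup X] [Module ℂ X] [LieRingModule sl2 X]
  {b : Module.Basis ι ℂ X} (M : WeightModel χ S T b)

/-- The linear map with `b_i ↦ c_i v_{ν(i)}`. -/
def φ : X →ₗ[ℂ] PS χ := b.constr ℂ (fun i => M.c i • vec χ (M.ν i))

lemma φ_basis (i : ι) : M.φ (b i) = M.c i • vec χ (M.ν i) := b.constr_basis ℂ _ i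

lemma φ_mem (x : X) : M.φ x ∈ vecSpan χ T := mem_of_basis b _ _ (fun i => by
  rw [φ_basis]
  exact Submodule.smul_mem _ _ (vec_mem_vecSpan (M.mem i))) x

lemma φ_lie [LieModule ℂ sl2 X] (A : sl2) (x : X) : M.φ ⁅A, x⁆ - ⁅A, M.φ x⁆ ∈ vecSpan χ S := by
  refine mem_of_basis b (M.φ ∘ₗ (LieModule.toEnd ℂ sl2 X A) -
    (LieModule.toEnd ℂ sl2 (PS χ) A) ∘ₗ M.φ) _ (fun i => ?_) x
  have := M.lie A i
  rw [← φ_basis] at this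
  exact this

lemma coef_φ (i : ι) (x : X) : coef (M.ν i) (M.φ x) = M.c i * b.repr x i := by
  have : coef (M.ν i) ∘ₗ M.φ = (M.c i) • (b.coord i) := by
    classical
    refine b.ext fun j => ?_
    rw [LinearMap.comp_apply, φ_basis, map_smul, coef_vec, LinearMap.smul_apply, b.coord_apply,
      b.repr_self, Finsupp.single_apply, smul_eq_mul, smul_eq_mul]
    simp only [M.injective.eq_iff]
    split_ifs with h
    · rw [h]
    · rw [mul_zero, mul_zero]
  exact LinearMap.congr_fun this x

/-- The coefficients at the weights `ν i`, none of which lies in `S`, recover the coordinates of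
`x`. -/
lemma eq_zero_of_φ_mem {x : X} (hx : M.φ x ∈ coefSupported χ S) : x = 0 := by
  refine b.repr.injective (Finsupp.ext fun i => ?_)
  have := hx _ (M.notMem i)
  rw [coef_φ] at this
  rw [map_zero]
  exact (mul_eq_zero.1 this).resolve_left (M.c_ne i)

lemma vecSpan_le : vecSpan χ T ≤ LinearMap.range M.φ ⊔ vecSpan χ S := by
  refine Submodule.span_le.2 ?_
  rintro _ ⟨n, hn, rfl⟩
  rcases M.cover n hn with h | ⟨i, rfl⟩
  · exact Submodule.mem_sup_right (vec_mem_vecSpan h)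
  · refine Submodule.mem_sup_left ⟨(M.c i)⁻¹ • b i, ?_⟩
    rw [map_smul, φ_basis, smul_smul, inv_mul_cancel₀ (M.c_ne i), one_smul]

/-- The linear map `φ` is equivariant only modulo the span over `S`, which is what the quotient
divides out; it becomes bijective there because `ν` enumerates `T \ S`. -/
lemma nonempty_subQuot [LieModule ℂ sl2 X] (M : WeightModel χ S T b)
    {N₁ N₂ : LieSubmodule ℂ sl2 (PS χ)}
    (h₁ : (N₁ : Submodule ℂ (PS χ)) = vecSpan χ S) (h₂ : (N₂ : Submodule ℂ (PS χ)) = vecSpan χ T) :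
    Nonempty (SubQuot N₁ N₂ ≃ₗ⁅ℂ, sl2⁆ X) := by
  have hmem : ∀ x, M.φ x ∈ N₂ := fun x => by
    rw [← LieSubmodule.mem_toSubmodule, h₂]; exact M.φ_mem x
  set mk := LieSubmodule.Quotient.mk' (LieSubmodule.comap N₂.incl N₁) with hmk
  have hker : ∀ x : N₂, mk x = 0 ↔ (x : PS χ) ∈ vecSpan χ S := fun x => by
    rw [← h₁, hmk, LieSubmodule.Quotient.mk_eq_zero, LieSubmodule.mem_comap]
    rfl
  let φ' : X →ₗ[ℂ] N₂ := M.φ.codRestrict N₂.toSubmodule hmem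
  let ψ : X →ₗ⁅ℂ, sl2⁆ SubQuot N₁ N₂ :=
    { (mk : N₂ →ₗ[ℂ] SubQuot N₁ N₂) ∘ₗ φ' with
      map_lie' := by
        intro A x
        change mk (φ' ⁅A, x⁆) = ⁅A, mk (φ' x)⁆
        rw [← LieModuleHom.map_lie, ← sub_eq_zero, ← map_sub, hker]
        exact M.φ_lie A x }
  refine ⟨(lieModuleEquivOfBijective ψ ⟨(injective_iff_map_eq_zero _).2 fun x hx => ?_, ?_⟩).symm⟩
  · have := (hker (φ' x)).1 hx
    exact M.eq_zero_of_φ_mem (vecSpan_le_coefSupported S this)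
  · intro q
    obtain ⟨y, rfl⟩ := LieSubmodule.Quotient.surjective_mk' _ q
    have hy : (y : PS χ) ∈ vecSpan χ T := by rw [← h₂]; exact y.2
    obtain ⟨_, ⟨x, rfl⟩, r, hr, hxr⟩ := Submodule.mem_sup.1 (M.vecSpan_le hy)
    refine ⟨x, ?_⟩
    change mk (φ' x) = mk y
    rw [← sub_eq_zero, ← map_sub, hker]
    change M.φ x - (y : PS χ) ∈ vecSpan χ S
    rw [← hxr, sub_add_cancel_left]
    exact Submodule.neg_mem _ hr

lemma nonempty_equiv [LieModule ℂ sl2 X] (M : WeightModel χ ∅ T b) {N : LieSubmodule ℂ sl2 (PS χ)}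
    (h : (N : Submodule ℂ (PS χ)) = vecSpan χ T) : Nonempty (N ≃ₗ⁅ℂ, sl2⁆ X) := by
  obtain ⟨e⟩ := M.nonempty_subQuot (N₁ := ⊥)
    (by rw [vecSpan_empty, LieSubmodule.bot_toSubmodule]) h
  exact ⟨(subQuotBot N).trans e⟩

/-- The quotient map on all of `C^∞(S¹)` reads off the finitely many coefficients at the `ν i`. It
is a left inverse of `φ`, so `f` and `φ (p₀ f)` differ by an element of `coefSupported χ S`. That
space is Lie-stable and contains the defect of equivariance of `φ`, so `p₀` is equivariant. -/
lemma exists_hom [LieModule ℂ sl2 X] [Fintype ι] (M : WeightModel χ S Set.univ b)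
    (hS : Stable χ S) :
    ∃ p : PS χ →ₗ⁅ℂ, sl2⁆ X, Function.Surjective p ∧
      LinearMap.ker (p : PS χ →ₗ[ℂ] X) = coefSupported χ S := by
  let p₀ : PS χ →ₗ[ℂ] X := b.equivFun.symm.toLinearMap ∘ₗ
    LinearMap.pi fun i => (M.c i)⁻¹ • coef (M.ν i)
  have hp₀ : ∀ f i, b.repr (p₀ f) i = (M.c i)⁻¹ * coef (M.ν i) f := fun f i => by
    have := congrFun (b.equivFun.apply_symm_apply fun i => (M.c i)⁻¹ • coef (M.ν i) f) i
    rwa [b.equivFun_apply] at this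
  have hker : ∀ f, p₀ f = 0 ↔ f ∈ coefSupported χ S := by
    intro f
    constructor
    · intro h n hn
      obtain ⟨i, rfl⟩ := (M.cover n trivial).resolve_left hn
      have := hp₀ f i
      rw [h, map_zero] at this
      exact (mul_eq_zero.1 this.symm).resolve_left (inv_ne_zero (M.c_ne i))
    · intro h
      refine b.repr.injective (Finsupp.ext fun i => ?_)
      rw [hp₀, h _ (M.notMem i), mul_zero, map_zero]
      rfl
  have hφ : ∀ x, p₀ (M.φ x) = x := by
    intro x
    refine b.repr.injective (Finsupp.ext fun i => ?_)
    rw [hp₀, coef_φ, inv_mul_cancel_left₀ (M.c_ne i)]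
  refine ⟨{ p₀ with map_lie' := ?_ }, fun x => ⟨M.φ x, hφ x⟩, ?_⟩
  · intro A f
    change p₀ ⁅A, f⁆ = ⁅A, p₀ f⁆
    have h1 : f - M.φ (p₀ f) ∈ coefSupported χ S := by
      rw [← hker, map_sub, hφ, sub_self]
    have h2 := hS.lie_mem_coefSupported A h1
    have h3 := vecSpan_le_coefSupported S (M.φ_lie A (p₀ f))
    rw [← hker, lie_sub, map_sub, sub_eq_zero] at h2
    rw [← hker, map_sub, sub_eq_zero, hφ] at h3
    rw [h2, h3]
  · ext f
    exact hker f

end WeightModel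

lemma constr_lie_sub_mem {ι X : Type} [AddCommGroup X] [Module ℂ X] [LieRingModule sl2 X]
    (b : Module.Basis ι ℂ X) (u : ι → PS χ) (U : Submodule ℂ (PS χ)) {H E F : Module.End ℂ X}
    (hX : ∀ (A : sl2) (x : X), ⁅A, x⁆ = A.1 0 0 • H x + A.1 0 1 • E x + A.1 1 0 • F x)
    (hH : ∀ i, b.constr ℂ u (H (b i)) - opH χ (u i) ∈ U)
    (hE : ∀ i, b.constr ℂ u (E (b i)) - opE χ (u i) ∈ U)
    (hF : ∀ i, b.constr ℂ u (F (b i)) - opF χ (u i) ∈ U) (A : sl2) (i : ι) :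
    b.constr ℂ u ⁅A, b i⁆ - ⁅A, u i⁆ ∈ U := by
  have h := U.add_mem (U.add_mem (U.smul_mem (A.1 0 0) (hH i)) (U.smul_mem (A.1 0 1) (hE i)))
    (U.smul_mem (A.1 1 0) (hF i))
  rw [hX, lie_eq, map_add, map_add, map_smul, map_smul, map_smul]
  convert h using 1
  module

lemma smul_vec_mem_vecSpan {S : Set ℤ} {n : ℤ} {a : ℂ} (h : a = 0 ∨ n ∈ S) (c : ℂ) :
    (c * a) • vec χ n ∈ vecSpan χ S := by
  rcases h with h | h
  · rw [h, mul_zero, zero_smul]; exact Submodule.zero_mem _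
  · exact Submodule.smul_mem _ _ (vec_mem_vecSpan h)

/-- The coefficient of `E^k v_n` at `v_{n+k}`. -/
def raiseCoef (χ : Param) (n : ℤ) (k : ℕ) : ℂ :=
  ∏ j ∈ Finset.range k, (((n + j : ℤ) : ℂ) - χ.l + χ.ε)

/-- The coefficient of `F^k v_n` at `v_{n-k}`. -/
def lowerCoef (χ : Param) (n : ℤ) (k : ℕ) : ℂ :=
  ∏ j ∈ Finset.range k, (-(((n - j : ℤ) : ℂ) + χ.l + χ.ε))

lemma raiseCoef_succ (n : ℤ) (k : ℕ) :
    raiseCoef χ n (k + 1) = raiseCoef χ n k * (((n + k : ℤ) : ℂ) - χ.l + χ.ε) :=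
  Finset.prod_range_succ _ _

lemma lowerCoef_succ (n : ℤ) (k : ℕ) :
    lowerCoef χ n (k + 1) = lowerCoef χ n k * (-(((n - k : ℤ) : ℂ) + χ.l + χ.ε)) :=
  Finset.prod_range_succ _ _

namespace LowMod

/-- The basis `v_0, v_1, …`. -/
def basis (w : ℂ) : Module.Basis ℕ ℂ (LowMod w) :=
  (Finsupp.basisSingleOne : Module.Basis ℕ ℂ (ℕ →₀ ℂ))

lemma basis_apply (w : ℂ) (k : ℕ) : basis w k = v w k :=
  congrFun (Finsupp.coe_basisSingleOne (R := ℂ) (ι := ℕ)) k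

/-- The weights `n, n+1, …` form a lowest weight module modulo the span of `v_k`, `k ∈ S`. -/
def model {w : ℂ} {S T : Set ℤ} (n : ℤ) (hw : w = 2 * (n + χ.ε))
    (hx : ((n : ℂ) + χ.ε + χ.l) * (n + χ.ε - χ.l - 1) = 0)
    (hc : ∀ j : ℤ, n ≤ j → (j : ℂ) - χ.l + χ.ε ≠ 0)
    (hbot : (n : ℂ) + χ.l + χ.ε = 0 ∨ n - 1 ∈ S)
    (hT : ∀ k, k ∈ T ↔ k ∈ S ∨ n ≤ k) (hS : ∀ k, n ≤ k → k ∉ S) :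
    WeightModel χ S T (basis w) where
  ν k := n + k
  c := raiseCoef χ n
  injective i j hij := by simpa using hij
  c_ne k := Finset.prod_ne_zero_iff.2 fun j _ => hc _ (by omega)
  mem k := (hT _).2 (Or.inr (by omega))
  notMem k := hS _ (by omega)
  cover k hk := ((hT k).1 hk).imp_right fun h => ⟨(k - n).toNat, by omega⟩
  lie := by
    have hφ : ∀ k, (basis w).constr ℂ (fun k => raiseCoef χ n k • vec χ (n + k)) (v w k) =
        raiseCoef χ n k • vec χ (n + k) := fun k => by
      rw [← basis_apply, Module.Basis.constr_basis]
    refine constr_lie_sub_mem _ _ _ (H := H w) (E := E w) (F := F w) (fun _ _ => rfl) ?_ ?_ ?_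
    · intro k
      rw [basis_apply, H_v, map_smul, hφ, map_smul, opH_vec, hw, smul_comm, ← smul_sub, ← sub_smul]
      push_cast
      ring_nf
      simp
    · intro k
      rw [basis_apply, E_v, hφ, map_smul, opE_vec, raiseCoef_succ, smul_smul]
      push_cast
      rw [add_assoc (n : ℤ), sub_self]
      exact Submodule.zero_mem _
    · intro k
      rw [basis_apply, F_v, map_smul, hφ, map_smul, opF_vec]
      rcases k with _ | k
      -- At the bottom the model has `F v_0 = 0`, its factor `k = 0` making the truncated index `0 -
      -- 1` harmless; `hbot` says that `F v_n` vanishes or falls into the span over `S`.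
      · have := smul_vec_mem_vecSpan (χ := χ) hbot (raiseCoef χ n 0)
        simpa [smul_smul, -neg_add_rev] using this
      · have h1 : n + ((k + 1 : ℕ) : ℤ) - 1 = n + k := by push_cast; ring
        rw [h1, raiseCoef_succ, Nat.add_sub_cancel, smul_smul, smul_smul, ← sub_smul, hw]
        convert Submodule.zero_mem _
        refine smul_eq_zero_of_left ?_ _
        push_cast
        -- The two coefficients differ by `(n + ε + l)(n + ε - l - 1)` times `raiseCoef χ n k`. With
        -- `x = n + ε` this factor is `x(x - 1) - l(l + 1)`, independent of `k`: the Casimir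
        -- operator must take the same value on the lowest weight module and on the principal
        -- series.
        linear_combination (raiseCoef χ n k) * hx

end LowMod

namespace HighMod

/-- The basis `v_0, v_1, …`. -/
def basis (w : ℂ) : Module.Basis ℕ ℂ (HighMod w) :=
  (Finsupp.basisSingleOne : Module.Basis ℕ ℂ (ℕ →₀ ℂ))

lemma basis_apply (w : ℂ) (k : ℕ) : basis w k = v w k :=
  congrFun (Finsupp.coe_basisSingleOne (R := ℂ) (ι := ℕ)) k

/-- The weights `n, n-1, …` form a highest weight module modulo the span of `v_k`, `k ∈ S`. -/
def model {w : ℂ} {S T : Set ℤ} (n : ℤ) (hw : w = 2 * (n + χ.ε))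
    (hx : ((n : ℂ) + χ.ε - χ.l) * (n + χ.ε + χ.l + 1) = 0)
    (hc : ∀ j : ℤ, j ≤ n → (j : ℂ) + χ.l + χ.ε ≠ 0)
    (htop : (n : ℂ) - χ.l + χ.ε = 0 ∨ n + 1 ∈ S)
    (hT : ∀ k, k ∈ T ↔ k ∈ S ∨ k ≤ n) (hS : ∀ k, k ≤ n → k ∉ S) :
    WeightModel χ S T (basis w) where
  ν k := n - k
  c := lowerCoef χ n
  injective i j hij := by simpa using hij
  c_ne k := Finset.prod_ne_zero_iff.2 fun j _ => neg_ne_zero.2 (hc _ (by omega))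
  mem k := (hT _).2 (Or.inr (by omega))
  notMem k := hS _ (by omega)
  cover k hk := ((hT k).1 hk).imp_right fun h => ⟨(n - k).toNat, by omega⟩
  lie := by
    have hφ : ∀ k, (basis w).constr ℂ (fun k => lowerCoef χ n k • vec χ (n - k)) (v w k) =
        lowerCoef χ n k • vec χ (n - k) := fun k => by
      rw [← basis_apply, Module.Basis.constr_basis]
    refine constr_lie_sub_mem _ _ _ (H := H w) (E := E w) (F := F w) (fun _ _ => rfl) ?_ ?_ ?_
    · intro k
      rw [basis_apply, H_v, map_smul, hφ, map_smul, opH_vec, hw, smul_comm, ← smul_sub, ← sub_smul]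
      push_cast
      ring_nf
      simp
    · intro k
      rw [basis_apply, E_v, map_smul, hφ, map_smul, opE_vec]
      rcases k with _ | k
      · have := Submodule.neg_mem _ (smul_vec_mem_vecSpan (χ := χ) htop (lowerCoef χ n 0))
        simpa [smul_smul] using this
      · have h1 : n - ((k + 1 : ℕ) : ℤ) + 1 = n - k := by push_cast; ring
        rw [h1, lowerCoef_succ, Nat.add_sub_cancel, smul_smul, smul_smul, ← sub_smul, hw]
        convert Submodule.zero_mem _
        refine smul_eq_zero_of_left ?_ _
        push_cast
        -- With `x = n + ε`, the factor in `hx` is `x(x + 1) - l(l + 1)`, the Casimir condition for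
        -- highest weight `2x`.
        linear_combination (lowerCoef χ n k) * hx
    · intro k
      rw [basis_apply, F_v, hφ, map_smul, opF_vec, lowerCoef_succ, smul_smul]
      push_cast
      rw [← sub_sub, sub_self]
      exact Submodule.zero_mem _

end HighMod

namespace FMod

/-- The basis `v_0, …, v_d`. -/
def basis (d : ℕ) : Module.Basis (Fin (d + 1)) ℂ (FMod d) :=
  (Finsupp.basisSingleOne : Module.Basis (Fin (d + 1)) ℂ (Fin (d + 1) →₀ ℂ))

lemma basis_apply (d : ℕ) (k : Fin (d + 1)) : basis d k = v d k := by
  have h : v d k = Finsupp.single k (1 : ℂ) := dif_pos k.2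
  rw [h]
  exact congrFun (Finsupp.coe_basisSingleOne (R := ℂ) (ι := Fin (d + 1))) k

lemma finrank_eq (d : ℕ) : Module.finrank ℂ (FMod d) = d + 1 := by
  rw [Module.finrank_eq_card_basis (basis d), Fintype.card_fin]

/-- The weights `n, …, n + d` form a module `F_d` modulo the span of `v_k`, `k ∈ S`. -/
def model {d : ℕ} {S T : Set ℤ} (n : ℤ) (hw : -(d : ℂ) = 2 * (n + χ.ε))
    (hx : ((n : ℂ) + χ.ε + χ.l) * (n + χ.ε - χ.l - 1) = 0)
    (hc : ∀ j : ℤ, n ≤ j → j < n + d → (j : ℂ) - χ.l + χ.ε ≠ 0)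
    (hbot : (n : ℂ) + χ.l + χ.ε = 0 ∨ n - 1 ∈ S)
    (htop : ((n + d : ℤ) : ℂ) - χ.l + χ.ε = 0 ∨ n + d + 1 ∈ S)
    (hT : ∀ k, k ∈ T ↔ k ∈ S ∨ (n ≤ k ∧ k ≤ n + d)) (hS : ∀ k, n ≤ k → k ≤ n + d → k ∉ S) :
    WeightModel χ S T (basis d) where
  ν k := n + (k : ℕ)
  c k := raiseCoef χ n k
  injective i j hij := by simpa [Fin.ext_iff] using hij
  c_ne k := Finset.prod_ne_zero_iff.2 fun j hj => hc _ (by omega)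
    (by have := Finset.mem_range.1 hj; omega)
  mem k := (hT _).2 (Or.inr (by omega))
  notMem k := hS _ (by omega) (by omega)
  cover k hk := ((hT k).1 hk).imp_right fun h => ⟨⟨(k - n).toNat, by omega⟩, by simp; omega⟩
  lie := by
    have hφ : ∀ k, k < d + 1 → (basis d).constr ℂ
        (fun k : Fin (d + 1) => raiseCoef χ n k • vec χ (n + (k : ℕ))) (v d k) =
        raiseCoef χ n k • vec χ (n + k) := fun k hk => by
      have := (basis d).constr_basis ℂ
        (fun k : Fin (d + 1) => raiseCoef χ n k • vec χ (n + (k : ℕ))) ⟨k, hk⟩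
      rwa [basis_apply] at this
    refine constr_lie_sub_mem _ _ _ (H := H d) (E := E d) (F := F d) (fun _ _ => rfl) ?_ ?_ ?_
    · intro k
      rw [basis_apply, H_v, map_smul, hφ _ k.2, map_smul, opH_vec, hw, smul_comm, ← smul_sub,
        ← sub_smul]
      push_cast
      ring_nf
      simp
    · intro k
      rw [basis_apply, E_v, map_smul, opE_vec, smul_smul]
      by_cases hk : (k : ℕ) + 1 < d + 1
      · rw [hφ _ hk, raiseCoef_succ]
        push_cast
        rw [add_assoc (n : ℤ), sub_self]
        exact Submodule.zero_mem _
      -- At the top the model has `v_{d+1} = 0`, and `htop` makes `E v_{n+d}` zero modulo the span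
      -- over `S`.
      · have hk' : (k : ℕ) = d := by omega
        rw [v_ge d _ hk, map_zero, zero_sub, hk']
        exact Submodule.neg_mem _ (smul_vec_mem_vecSpan htop _)
    · intro k
      rw [basis_apply, F_v d _ k.2.le, map_smul, map_smul, opF_vec]
      obtain ⟨k, hk⟩ := k
      rcases k with _ | k
      · have := smul_vec_mem_vecSpan (χ := χ) hbot (raiseCoef χ n 0)
        simpa [smul_smul, -neg_add_rev] using this
      · have h1 : n + ((k + 1 : ℕ) : ℤ) - 1 = n + k := by push_cast; ring
        rw [Nat.add_sub_cancel, hφ _ (by omega), h1, raiseCoef_succ, smul_smul, smul_smul,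
          ← sub_smul]
        convert Submodule.zero_mem _
        refine smul_eq_zero_of_left ?_ _
        push_cast
        -- The Casimir condition as for lowest weight modules, with `hw` replacing the lowest weight
        -- `2(n + ε)` by `-d`.
        linear_combination (raiseCoef χ n k) * hx - (raiseCoef χ n k) * (k + 1) * hw

end FMod

/-! ### Covers when `l + ε` is an integer -/

/-- The condition `hconn` says that no barrier separates two weights of `T \ S`, so each can be
reached from any other. A stable set between `S` and `T` that contains one of them contains them
all. -/
lemma stableCover_of_int {m : ℤ} (h : χ.l + χ.ε = m) {S T : Set ℤ} (hS : Stable χ S)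
    (hT : Stable χ T) (hST : S ⊆ T) (hne : ∃ n ∈ T, n ∉ S)
    (hconn : ∀ n ∈ T, n ∉ S → ∀ k ∈ T, k ∉ S → n ≤ k →
      ¬ (n ≤ m - ((χ.e : ℕ) : ℤ) ∧ m - ((χ.e : ℕ) : ℤ) < k) ∧ ¬ (-m ≤ k ∧ n < -m)) :
    StableCover χ S T := by
  refine ⟨hS, hT, hST, ?_, fun R hR hSR hRT => ?_⟩
  · rintro rfl
    obtain ⟨n, h1, h2⟩ := hne
    exact h2 h1
  · by_cases hRS : R ⊆ S
    · exact Or.inl (hRS.antisymm hSR)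
    · obtain ⟨n, hn, hnS⟩ := Set.not_subset.1 hRS
      refine Or.inr (hRT.antisymm fun k hk => ?_)
      by_cases hkS : k ∈ S
      · exact hSR hkS
      · rcases le_total n k with hnk | hnk
        · have := hconn n (hRT hn) hnS k hk hkS hnk
          refine hR.mem_of_le hn hnk fun j h1 h2 h3 => ?_
          rw [sub_eq_zero_iff_int h] at h3
          omega
        · have := hconn k hk hkS n (hRT hn) hnS hnk
          refine hR.mem_of_ge hn hnk fun j h1 h2 h3 => ?_
          rw [add_eq_zero_iff_int h] at h3
          omega

lemma coe_Mplus {m : ℤ} (h : χ.l + χ.ε = m) :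
    (Mplus χ m h : Submodule ℂ (PS χ)) = vecSpan χ (weightsPlus m) := rfl

lemma coe_Mminus {m : ℤ} (h : χ.l + χ.ε = m) :
    (Mminus χ m h : Submodule ℂ (PS χ)) = vecSpan χ (weightsMinus χ m) := rfl

lemma coe_Fsub {m : ℤ} (h : χ.l + χ.ε = m) :
    (Fsub χ m h : Submodule ℂ (PS χ)) = vecSpan χ (weightsPlus m ∩ weightsMinus χ m) := by
  rw [Fsub, LieSubmodule.inf_toSubmodule, coe_Mplus, coe_Mminus, vecSpan_inf]

lemma coe_sup {m : ℤ} (h : χ.l + χ.ε = m) :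
    ((Mplus χ m h ⊔ Mminus χ m h : LieSubmodule ℂ sl2 (PS χ)) : Submodule ℂ (PS χ)) =
      vecSpan χ (weightsPlus m ∪ weightsMinus χ m) := by
  rw [LieSubmodule.sup_toSubmodule, coe_Mplus, coe_Mminus, vecSpan_sup]

lemma Dplus_eq {m : ℤ} (h : χ.l + χ.ε = m) : Dplus χ m h = coefSupported χ (weightsPlus m) :=
  topologicalClosure_vecSpan _

lemma Dminus_eq {m : ℤ} (h : χ.l + χ.ε = m) :
    Dminus χ m h = coefSupported χ (weightsMinus χ m) :=
  topologicalClosure_vecSpan _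

/-! ### Finite length and admissibility -/

/-- In a finite partially ordered set increasing chains break off, and the least and greatest
elements are joined by a chain of covering relations. -/
lemma hasFiniteLength_of_finite {G V : Type} [Group G] [AddCommGroup V] [Module ℂ V]
    [TopologicalSpace V] (ρ : Representation ℂ G V) (hfin : {W | IsSubrep ρ W}.Finite)
    (hbot : IsSubrep ρ ⊥) (htop : IsSubrep ρ ⊤) : HasFiniteLength ρ := by
  have : Finite {W // IsSubrep ρ W} := hfin
  constructor
  · intro c hc hmono
    let a : ℕ →o {W // IsSubrep ρ W} := ⟨fun n => ⟨c n, hc n⟩, fun i j hij => hmono hij⟩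
    obtain ⟨N, hN⟩ := WellFoundedGT.monotone_chain_condition a
    exact ⟨N, fun n hn => (congrArg Subtype.val (hN n hn)).symm⟩
  · obtain ⟨a, h0, N, hN, ha⟩ := exists_covBy_seq_of_wellFoundedLT_wellFoundedGT_of_le
      (x := (⟨⊥, hbot⟩ : {W // IsSubrep ρ W})) (y := ⟨⊤, htop⟩) (bot_le (a := (⊤ : Submodule ℂ V)))
    refine ⟨N, fun i => a i, congrArg Subtype.val h0, congrArg Subtype.val hN, fun i hi =>
      ⟨(a i).2, (a (i + 1)).2,
      (ha i hi).lt, fun W hW h1 h2 => ?_⟩⟩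
    exact ((ha i hi).eq_or_eq (c := ⟨W, hW⟩) h1 h2).imp (congrArg Subtype.val)
      (congrArg Subtype.val)

lemma finite_stable : {S | Stable χ S}.Finite := by
  by_cases h : ∃ m : ℤ, χ.l + χ.ε = m
  · obtain ⟨m, hm⟩ := h
    refine Set.Finite.subset (s := {∅, Set.univ, weightsPlus m, weightsMinus χ m,
      weightsPlus m ∪ weightsMinus χ m, weightsPlus m ∩ weightsMinus χ m}) (Set.toFinite _)
      fun S hS => ?_
    simpa using hS.eq_of_int hm
  · refine Set.Finite.subset (s := {∅, Set.univ}) (Set.toFinite _) fun S hS => ?_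
    simpa using hS.eq_of_not_int h

lemma hasFiniteLength_rep : HasFiniteLength (rep χ) := by
  refine hasFiniteLength_of_finite _ (((finite_stable (χ := χ)).image (coefSupported χ)).subset ?_)
    ?_ ?_
  · intro W hW
    obtain ⟨S, hS, rfl⟩ := isSubrep_iff.1 hW
    exact ⟨S, hS, rfl⟩
  · rw [← coefSupported_empty]; exact stable_empty.isSubrep
  · rw [← coefSupported_univ]; exact stable_univ.isSubrep

lemma isIrred_rep_iff : IsIrred (rep χ) ↔ ¬ ∃ m : ℤ, χ.l + χ.ε = m := by
  constructor
  · rintro ⟨-, hirr⟩ ⟨m, hm⟩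
    -- In the integral case the weights of `M⁺` always give a proper nonzero subrepresentation,
    -- whatever the sign of `l`.
    rcases hirr _ (stable_weightsPlus hm).isSubrep with h | h
    · rw [← coefSupported_empty] at h
      have := coefSupported_injective h
      exact (this ▸ (le_refl (-m) : -m ∈ weightsPlus m) : -m ∈ (∅ : Set ℤ))
    · rw [← coefSupported_univ] at h
      have := coefSupported_injective h
      have h1 : -m - 1 ∈ weightsPlus m := this ▸ trivial
      rw [mem_weightsPlus] at h1
      omega
  · intro h
    refine ⟨⟨vec χ 0, 0, linearIndependent_vec.ne_zero 0⟩, fun W hW => ?_⟩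
    obtain ⟨S, hS, rfl⟩ := isSubrep_iff.1 hW
    rw [← coefSupported_empty, ← coefSupported_univ]
    exact (hS.eq_of_not_int h).imp (congrArg _) (congrArg _)

/-- Frobenius reciprocity: as `K_ℝ` is transitive on the circle, an intertwining map `T` is
determined by the functional `u ↦ (T u)(1)`, so the intertwining maps embed in the dual of `U`. -/
lemma isAdmissible_rep : IsAdmissible (rep χ) KR := by
  intro U _ _ _ τ _
  let ev : PS χ →ₗ[ℂ] ℂ :=
    { toFun := fun f => f 1
      map_add' := fun _ _ => rfl
      map_smul' := fun _ _ => rfl }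
  let Φ : Representation.IntertwiningMap τ ((rep χ).comp KR.subtype) →ₗ[ℂ] (U →ₗ[ℂ] ℂ) :=
    { toFun := fun T => ev ∘ₗ T.toLinearMap
      map_add' := fun S T => by ext u; rfl
      map_smul' := fun c T => by ext u; rfl }
  refine FiniteDimensional.of_injective Φ ((injective_iff_map_eq_zero Φ).2 fun T hT => ?_)
  refine Representation.IntertwiningMap.toLinearMap_injective _ _ (LinearMap.ext fun u => ?_)
  change T.toLinearMap u = 0
  ext z
  obtain ⟨α, rfl⟩ : ∃ α, Circle.exp α = z := ⟨_, Circle.exp_arg z⟩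
  -- The half angle, because `diag(w, w⁻¹)` acts on the argument by `z ↦ z w⁻²`, which must carry
  -- `1` to `e^{iα}`.
  let w : Circle := Circle.exp (-(α / 2))
  have hw : w⁻¹ * w⁻¹ = Circle.exp α := by
    simp only [w, Circle.exp_neg, inv_inv]
    rw [← Circle.exp_add, add_halves]
  have h1 : (T.toLinearMap (τ ⟨diagK w, w, rfl⟩ u)) 1 = 0 := LinearMap.congr_fun hT _
  have h2 : T.toLinearMap (τ ⟨diagK w, w, rfl⟩ u) = rep χ (diagK w) (T.toLinearMap u) :=
    LinearMap.congr_fun (T.isIntertwining' ⟨diagK w, w, rfl⟩) u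
  rw [h2, rep_diagK, one_mul, hw] at h1
  exact (mul_eq_zero.1 h1).resolve_left (pow_ne_zero _ (Circle.coe_ne_zero w))

lemma two_mul_l_eq {m : ℤ} (h : χ.l + χ.ε = m) : 2 * χ.l = ((2 * m - ((χ.e : ℕ) : ℤ) : ℤ) : ℂ) := by
  have := χ.two_ε
  push_cast at this ⊢
  linear_combination 2 * h - this

lemma two_mul_l_re_eq {m : ℤ} (h : χ.l + χ.ε = m) :
    2 * χ.l.re = ((2 * m - ((χ.e : ℕ) : ℤ) : ℤ) : ℝ) := by
  have := congrArg Complex.re (two_mul_l_eq h)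
  simpa using this

/-- Here `2l = 2m - 2ε` is an integer, so conditions on `l` become integer inequalities between the
barriers. -/
lemma l_re_neg_iff {m : ℤ} (h : χ.l + χ.ε = m) : χ.l.re < 0 ↔ 2 * m - ((χ.e : ℕ) : ℤ) < 0 := by
  have h1 := two_mul_l_re_eq h
  rw [← Int.cast_lt (R := ℝ), ← h1, Int.cast_zero]
  constructor <;> intro h <;> linarith

lemma l_eq_neg_half_iff {m : ℤ} (h : χ.l + χ.ε = m) :
    χ.l = -1 / 2 ↔ 2 * m - ((χ.e : ℕ) : ℤ) = -1 := by
  rw [← Int.cast_inj (α := ℂ), ← two_mul_l_eq h]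
  push_cast
  constructor <;> intro h
  · rw [h]; ring
  · linear_combination h / 2

/-! ### `(𝔤, K)`-submodules -/

/-- Uniform in the sign of `l`. For `l < 0` the last alternative is `0`, and for `l ≥ -1/2` the
third is the whole module. -/
lemma gk_submodules {m : ℤ} (h : χ.l + χ.ε = m) {N : LieSubmodule ℂ sl2 (PS χ)} (hN : IsGK N)
    (h0 : N ≠ ⊥) (h1 : N ≠ HC χ) :
    N = Mplus χ m h ∨ N = Mminus χ m h ∨ N = Mplus χ m h ⊔ Mminus χ m h ∨ N = Fsub χ m h := by
  obtain ⟨S, hS, hNS⟩ := exists_stable_of_le_HC hN.1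
  simp only [← LieSubmodule.toSubmodule_inj, coe_Mplus, coe_Mminus, coe_sup, coe_Fsub, coe_HC,
    LieSubmodule.bot_toSubmodule, hNS, ne_eq] at *
  rcases hS.eq_of_int h with rfl | rfl | rfl | rfl | rfl | rfl
  · exact absurd vecSpan_empty h0
  · exact absurd rfl h1
  all_goals simp

lemma mem_gk_submodules {N : LieSubmodule ℂ sl2 (PS χ)} {S : Set ℤ}
    (hN : (N : Submodule ℂ (PS χ)) = vecSpan χ S) (h0 : ∃ n, n ∈ S) (h1 : ∃ n, n ∉ S) :
    N ∈ {N : LieSubmodule ℂ sl2 (PS χ) | IsGK N ∧ N ≠ ⊥ ∧ N ≠ HC χ} := by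
  refine ⟨isGK_of_le_HC (le_HC_of_eq_vecSpan hN), ?_, ?_⟩
  · rintro rfl
    rw [LieSubmodule.bot_toSubmodule, ← vecSpan_empty] at hN
    obtain ⟨n, hn⟩ := h0
    rw [← vecSpan_injective hN] at hn
    exact hn
  · rintro rfl
    rw [coe_HC] at hN
    obtain ⟨n, hn⟩ := h1
    rw [← vecSpan_injective hN] at hn
    exact hn trivial

lemma isSubrep_closures {m : ℤ} (h : χ.l + χ.ε = m) :
    IsSubrep (rep χ) (Dplus χ m h) ∧ IsSubrep (rep χ) (Dminus χ m h) ∧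
      (HC χ : Submodule ℂ (PS χ)) ⊓ Dplus χ m h = Mplus χ m h ∧
      (HC χ : Submodule ℂ (PS χ)) ⊓ Dminus χ m h = Mminus χ m h := by
  rw [Dplus_eq, Dminus_eq, coe_HC, vecSpan_univ_inf_coefSupported, vecSpan_univ_inf_coefSupported]
  exact ⟨(stable_weightsPlus h).isSubrep, (stable_weightsMinus h).isSubrep, rfl, rfl⟩

/-! ### The case `l < 0` -/

section Negative

variable {m : ℤ}

lemma inter_eq_empty (hl : 2 * m - ((χ.e : ℕ) : ℤ) < 0) : weightsPlus m ∩ weightsMinus χ m = ∅ := by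
  ext n
  simp only [Set.mem_inter_iff, mem_weightsPlus, mem_weightsMinus, Set.mem_empty_iff_false,
    iff_false]
  omega

lemma stableCover_empty_plus (h : χ.l + χ.ε = m) (hl : 2 * m - ((χ.e : ℕ) : ℤ) < 0) :
    StableCover χ ∅ (weightsPlus m) :=
  stableCover_of_int h stable_empty (stable_weightsPlus h) (Set.empty_subset _)
    ⟨-m, by simp [mem_weightsPlus]⟩ fun n hn _ k hk _ _ => by
      simp only [mem_weightsPlus] at hn hk; omega

lemma stableCover_empty_minus (h : χ.l + χ.ε = m) (hl : 2 * m - ((χ.e : ℕ) : ℤ) < 0) :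
    StableCover χ ∅ (weightsMinus χ m) :=
  stableCover_of_int h stable_empty (stable_weightsMinus h) (Set.empty_subset _)
    ⟨m - ((χ.e : ℕ) : ℤ), by simp [mem_weightsMinus]⟩ fun n hn _ k hk _ _ => by
      simp only [mem_weightsMinus] at hn hk; omega

/-- The gap between `M⁻` and `M⁺` consists of the weights `m - 2ε < n < -m`; it is nonempty exactly
when `2l < -1`, and it contains no barrier. -/
lemma stableCover_union_univ (h : χ.l + χ.ε = m) (hl : 2 * m - ((χ.e : ℕ) : ℤ) < -1) :
    StableCover χ (weightsPlus m ∪ weightsMinus χ m) Set.univ :=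
  stableCover_of_int h ((stable_weightsPlus h).union (stable_weightsMinus h)) stable_univ
    (Set.subset_univ _)
    ⟨-m - 1, trivial, by simp only [Set.mem_union, mem_weightsPlus, mem_weightsMinus]; omega⟩
    fun n _ hn k _ hk _ => by
      simp only [Set.mem_union, mem_weightsPlus, mem_weightsMinus] at hn hk; omega

lemma nonempty_Mplus_equiv (h : χ.l + χ.ε = m) (hl : 2 * m - ((χ.e : ℕ) : ℤ) < 0) :
    Nonempty (Mplus χ m h ≃ₗ⁅ℂ, sl2⁆ LowMod (-2 * χ.l)) := by
  refine (LowMod.model (χ := χ) (S := ∅) (T := weightsPlus m) (-m) ?_ ?_ ?_ ?_ ?_ ?_).nonempty_equiv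
    (coe_Mplus h)
  · push_cast; linear_combination (-2) * h
  · push_cast; linear_combination (χ.ε - χ.l - m - 1) * h
  · intro j hj
    rw [ne_eq, sub_eq_zero_iff_int h]; omega
  · left; rw [add_eq_zero_iff_int h]
  · intro k; simp [mem_weightsPlus]
  · simp

lemma nonempty_Mminus_equiv (h : χ.l + χ.ε = m) (hl : 2 * m - ((χ.e : ℕ) : ℤ) < 0) :
    Nonempty (Mminus χ m h ≃ₗ⁅ℂ, sl2⁆ HighMod (2 * χ.l)) := by
  have h2 := χ.two_ε
  push_cast at h2
  refine (HighMod.model (χ := χ) (S := ∅) (T := weightsMinus χ m) (m - ((χ.e : ℕ) : ℤ))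
    ?_ ?_ ?_ ?_ ?_ ?_).nonempty_equiv (coe_Mminus h)
  · push_cast; linear_combination 2 * h - 2 * h2
  · push_cast
    refine mul_eq_zero_of_left ?_ _
    linear_combination h2 - h
  · intro j hj
    rw [ne_eq, add_eq_zero_iff_int h]; omega
  · left; rw [sub_eq_zero_iff_int h]
  · intro k; simp [mem_weightsMinus]
  · simp

/-- The weights between `M⁻` and `M⁺` form the module `F_d` modulo `M⁺ ⊕ M⁻`. -/
def gapModel (h : χ.l + χ.ε = m) (d : ℕ)
    (hd : (d : ℤ) = ((χ.e : ℕ) : ℤ) - 2 * m - 2) :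
    WeightModel χ (weightsPlus m ∪ weightsMinus χ m) Set.univ (FMod.basis d) := by
  have h2 := χ.two_ε
  have hd' := congrArg (Int.cast (R := ℂ)) hd
  push_cast at h2 hd'
  -- The first weight above `M⁻`. The gap has `2ε - 2m - 1 = d + 1` weights, and its neighbours on
  -- both sides lie in the set that is divided out.
  refine FMod.model (m - ((χ.e : ℕ) : ℤ) + 1) ?_ ?_ ?_ ?_ ?_ ?_ ?_
  · push_cast; linear_combination -hd' - h2
  · push_cast
    refine mul_eq_zero_of_right _ ?_
    linear_combination h2 - h
  · intro j hj _
    rw [ne_eq, sub_eq_zero_iff_int h]; omega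
  · right; simp only [Set.mem_union, mem_weightsPlus, mem_weightsMinus]; omega
  · right; simp only [Set.mem_union, mem_weightsPlus, mem_weightsMinus]; omega
  · intro k; simp only [Set.mem_union, mem_weightsPlus, mem_weightsMinus, Set.mem_univ, true_iff]
    omega
  · intro k; simp only [Set.mem_union, mem_weightsPlus, mem_weightsMinus]; omega

end Negative

/-! ### The case `l ≥ 0` -/

section Nonnegative

variable {m : ℤ}

lemma stableCover_empty_inter (h : χ.l + χ.ε = m) (hl : 0 ≤ 2 * m - ((χ.e : ℕ) : ℤ)) :
    StableCover χ ∅ (weightsPlus m ∩ weightsMinus χ m) :=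
  stableCover_of_int h stable_empty ((stable_weightsPlus h).inter (stable_weightsMinus h))
    (Set.empty_subset _)
    ⟨-m, by simp only [Set.mem_inter_iff, mem_weightsPlus, mem_weightsMinus]; omega, by simp⟩
    fun n hn _ k hk _ _ => by
      simp only [Set.mem_inter_iff, mem_weightsPlus, mem_weightsMinus] at hn hk; omega

lemma stableCover_inter_plus (h : χ.l + χ.ε = m) (hl : 0 ≤ 2 * m - ((χ.e : ℕ) : ℤ)) :
    StableCover χ (weightsPlus m ∩ weightsMinus χ m) (weightsPlus m) :=
  stableCover_of_int h ((stable_weightsPlus h).inter (stable_weightsMinus h))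
    (stable_weightsPlus h) Set.inter_subset_left
    ⟨m - ((χ.e : ℕ) : ℤ) + 1, by rw [mem_weightsPlus]; omega, by
      simp only [Set.mem_inter_iff, mem_weightsPlus, mem_weightsMinus]; omega⟩
    fun n hn hn' k hk hk' _ => by
      simp only [Set.mem_inter_iff, mem_weightsPlus, mem_weightsMinus] at hn hn' hk hk'; omega

lemma stableCover_inter_minus (h : χ.l + χ.ε = m) (hl : 0 ≤ 2 * m - ((χ.e : ℕ) : ℤ)) :
    StableCover χ (weightsPlus m ∩ weightsMinus χ m) (weightsMinus χ m) :=
  stableCover_of_int h ((stable_weightsPlus h).inter (stable_weightsMinus h))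
    (stable_weightsMinus h) Set.inter_subset_right
    ⟨-m - 1, by rw [mem_weightsMinus]; omega, by
      simp only [Set.mem_inter_iff, mem_weightsPlus, mem_weightsMinus]; omega⟩
    fun n hn hn' k hk hk' _ => by
      simp only [Set.mem_inter_iff, mem_weightsPlus, mem_weightsMinus] at hn hn' hk hk'; omega

lemma union_eq_univ (hl : -1 ≤ 2 * m - ((χ.e : ℕ) : ℤ)) :
    weightsPlus m ∪ weightsMinus χ m = Set.univ := by
  ext n
  simp only [Set.mem_union, mem_weightsPlus, mem_weightsMinus, Set.mem_univ, iff_true]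
  omega

lemma nonempty_Fsub_equiv (h : χ.l + χ.ε = m) (d : ℕ) (hd : (d : ℤ) = 2 * m - ((χ.e : ℕ) : ℤ)) :
    Nonempty (Fsub χ m h ≃ₗ⁅ℂ, sl2⁆ FMod d) := by
  have h2 := χ.two_ε
  have hd' := congrArg (Int.cast (R := ℂ)) hd
  push_cast at h2 hd'
  refine (FMod.model (χ := χ) (S := ∅) (T := weightsPlus m ∩ weightsMinus χ m) (-m)
    ?_ ?_ ?_ ?_ ?_ ?_ ?_).nonempty_equiv (coe_Fsub h)
  · push_cast; linear_combination -hd' - h2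
  · push_cast
    refine mul_eq_zero_of_left ?_ _
    linear_combination h
  · intro j hj _
    rw [ne_eq, sub_eq_zero_iff_int h]; omega
  · left; rw [add_eq_zero_iff_int h]
  · left; rw [sub_eq_zero_iff_int h]; omega
  · intro k
    simp only [Set.mem_inter_iff, mem_weightsPlus, mem_weightsMinus, Set.mem_empty_iff_false,
      false_or]
    omega
  · simp

lemma nonempty_Mplus_quot_equiv (h : χ.l + χ.ε = m) (hl : 0 ≤ 2 * m - ((χ.e : ℕ) : ℤ)) :
    Nonempty (SubQuot (Fsub χ m h) (Mplus χ m h) ≃ₗ⁅ℂ, sl2⁆ LowMod (2 * χ.l + 2)) := by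
  have h2 := χ.two_ε
  push_cast at h2
  refine (LowMod.model (χ := χ) (S := weightsPlus m ∩ weightsMinus χ m) (T := weightsPlus m)
    -- The first weight of `M⁺` above `F`, at which `H` has eigenvalue `2(l - ε + 1) + 2ε = 2l + 2`.
    (m - ((χ.e : ℕ) : ℤ) + 1) ?_ ?_ ?_ ?_ ?_ ?_).nonempty_subQuot (coe_Fsub h) (coe_Mplus h)
  · push_cast; linear_combination 2 * h - 2 * h2
  · push_cast
    refine mul_eq_zero_of_right _ ?_
    linear_combination h2 - h
  · intro j hj
    rw [ne_eq, sub_eq_zero_iff_int h]; omega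
  · right; simp only [Set.mem_inter_iff, mem_weightsPlus, mem_weightsMinus]; omega
  · intro k; simp only [Set.mem_inter_iff, mem_weightsPlus, mem_weightsMinus]; omega
  · intro k; simp only [Set.mem_inter_iff, mem_weightsPlus, mem_weightsMinus]; omega

lemma nonempty_Mminus_quot_equiv (h : χ.l + χ.ε = m) (hl : 0 ≤ 2 * m - ((χ.e : ℕ) : ℤ)) :
    Nonempty (SubQuot (Fsub χ m h) (Mminus χ m h) ≃ₗ⁅ℂ, sl2⁆ HighMod (-(2 * χ.l + 2))) := by
  refine (HighMod.model (χ := χ) (S := weightsPlus m ∩ weightsMinus χ m) (T := weightsMinus χ m)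
    -- The first weight of `M⁻` below `F`, at which `H` has eigenvalue `2(-m - 1 + ε) = -(2l + 2)`.
    (-m - 1) ?_ ?_ ?_ ?_ ?_ ?_).nonempty_subQuot (coe_Fsub h) (coe_Mminus h)
  · push_cast; linear_combination (-2) * h
  · push_cast
    refine mul_eq_zero_of_right _ ?_
    linear_combination h
  · intro j hj
    rw [ne_eq, add_eq_zero_iff_int h]; omega
  · right; simp only [Set.mem_inter_iff, mem_weightsPlus, mem_weightsMinus]; omega
  · intro k; simp only [Set.mem_inter_iff, mem_weightsPlus, mem_weightsMinus]; omega
  · intro k; simp only [Set.mem_inter_iff, mem_weightsPlus, mem_weightsMinus]; omega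

end Nonnegative

end SU11

end

theorem mainTheorem3 (χ : Param) :
    -- irreducibility, finite length and admissibility
    (IsIrred (rep χ) ↔ ¬ ∃ m : ℤ, χ.l + χ.ε = m) ∧
    HasFiniteLength (rep χ) ∧
    IsAdmissible (rep χ) KR ∧
    -- the structure of the representation when `l + ε` is an integer `m`
    ∀ (m : ℤ) (h : χ.l + χ.ε = m),
      -- the closures of `M⁺` and `M⁻` are subrepresentations with `K`-finite vectors `M⁺`, `M⁻`
      (IsSubrep (rep χ) (Dplus χ m h) ∧ IsSubrep (rep χ) (Dminus χ m h) ∧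
        (HC χ : Submodule ℂ (PS χ)) ⊓ Dplus χ m h = Mplus χ m h ∧
        (HC χ : Submodule ℂ (PS χ)) ⊓ Dminus χ m h = Mminus χ m h) ∧
      -- the case `l < 0`
      (χ.l.re < 0 →
        LieModule.IsIrreducible ℂ sl2 (Mplus χ m h) ∧
        LieModule.IsIrreducible ℂ sl2 (Mminus χ m h) ∧
        Mplus χ m h ⊓ Mminus χ m h = ⊥ ∧
        Nonempty (Mplus χ m h ≃ₗ⁅ℂ, sl2⁆ LowMod (-2 * χ.l)) ∧
        Nonempty (Mminus χ m h ≃ₗ⁅ℂ, sl2⁆ HighMod (2 * χ.l)) ∧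
        IsIrredQuot (rep χ) ⊥ (Dplus χ m h) ∧
        IsIrredQuot (rep χ) ⊥ (Dminus χ m h) ∧
        Dplus χ m h ⊓ Dminus χ m h = ⊥ ∧
        Dplus χ m h ⊔ Dminus χ m h =
          ((Mplus χ m h ⊔ Mminus χ m h : LieSubmodule ℂ sl2 (PS χ)) :
            Submodule ℂ (PS χ)).topologicalClosure ∧
        -- the generic case `l ≤ -1`
        (χ.l ≠ -1 / 2 →
          {N : LieSubmodule ℂ sl2 (PS χ) | IsGK N ∧ N ≠ ⊥ ∧ N ≠ HC χ} =
            {Mplus χ m h, Mminus χ m h, Mplus χ m h ⊔ Mminus χ m h} ∧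
          LieModule.IsIrreducible ℂ sl2 (SubQuot (Mplus χ m h ⊔ Mminus χ m h) (HC χ)) ∧
          IsIrredQuot (rep χ) (Dplus χ m h ⊔ Dminus χ m h) ⊤ ∧
          ∃ d : ℕ, (d : ℂ) = -2 * (χ.l + 1) ∧
            (Module.finrank ℂ (SubQuot (Mplus χ m h ⊔ Mminus χ m h) (HC χ)) : ℂ) =
              -(2 * χ.l + 1) ∧
            Nonempty (SubQuot (Mplus χ m h ⊔ Mminus χ m h) (HC χ) ≃ₗ⁅ℂ, sl2⁆ FMod d) ∧
            ∃ p : PS χ →ₗ⁅ℂ, sl2⁆ FMod d, Function.Surjective p ∧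
              LinearMap.ker (p : PS χ →ₗ[ℂ] FMod d) = Dplus χ m h ⊔ Dminus χ m h) ∧
        -- the exceptional case `l = -1/2`
        (χ.l = -1 / 2 →
          {N : LieSubmodule ℂ sl2 (PS χ) | IsGK N ∧ N ≠ ⊥ ∧ N ≠ HC χ} =
            {Mplus χ m h, Mminus χ m h} ∧
          Mplus χ m h ⊔ Mminus χ m h = HC χ ∧
          Dplus χ m h ⊔ Dminus χ m h = ⊤)) ∧
      -- the case `l ≥ 0`
      (0 ≤ χ.l.re →
        LieModule.IsIrreducible ℂ sl2 (Fsub χ m h) ∧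
        (Module.finrank ℂ (Fsub χ m h) : ℂ) = 2 * χ.l + 1 ∧
        (∃ d : ℕ, (d : ℂ) = 2 * χ.l ∧ Nonempty (Fsub χ m h ≃ₗ⁅ℂ, sl2⁆ FMod d)) ∧
        {N : LieSubmodule ℂ sl2 (PS χ) | IsGK N ∧ N ≠ ⊥ ∧ N ≠ HC χ} =
          {Fsub χ m h, Mplus χ m h, Mminus χ m h} ∧
        Mplus χ m h ⊔ Mminus χ m h = HC χ ∧
        LieModule.IsIrreducible ℂ sl2 (SubQuot (Fsub χ m h) (Mplus χ m h)) ∧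
        LieModule.IsIrreducible ℂ sl2 (SubQuot (Fsub χ m h) (Mminus χ m h)) ∧
        Nonempty (SubQuot (Fsub χ m h) (Mplus χ m h) ≃ₗ⁅ℂ, sl2⁆ LowMod (2 * χ.l + 2)) ∧
        Nonempty (SubQuot (Fsub χ m h) (Mminus χ m h) ≃ₗ⁅ℂ, sl2⁆ HighMod (-(2 * χ.l + 2))) ∧
        IsCompl (SubQuotIm (Fsub χ m h) (HC χ) (Mplus χ m h))
          (SubQuotIm (Fsub χ m h) (HC χ) (Mminus χ m h)) ∧
        IsIrredQuot (rep χ) ⊥ (Fsub χ m h) ∧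
        Dplus χ m h ⊓ Dminus χ m h = Fsub χ m h ∧
        Dplus χ m h ⊔ Dminus χ m h = ⊤ ∧
        IsIrredQuot (rep χ) (Fsub χ m h) (Dplus χ m h) ∧
        IsIrredQuot (rep χ) (Fsub χ m h) (Dminus χ m h)) := by
  refine ⟨isIrred_rep_iff, hasFiniteLength_rep, isAdmissible_rep, fun m h =>
    ⟨isSubrep_closures h, fun hneg => ?_, fun hpos => ?_⟩⟩
  · rw [l_re_neg_iff h] at hneg
    have hP := stableCover_empty_plus h hneg
    have hM := stableCover_empty_minus h hneg
    have hFsub : Fsub χ m h = ⊥ := by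
      rw [← LieSubmodule.toSubmodule_inj, coe_Fsub, inter_eq_empty hneg, vecSpan_empty,
        LieSubmodule.bot_toSubmodule]
    have hPmem := mem_gk_submodules (coe_Mplus h) ⟨-m, by simp [mem_weightsPlus]⟩
      ⟨-m - 1, by simp [mem_weightsPlus]⟩
    have hMmem := mem_gk_submodules (coe_Mminus h) ⟨m - ((χ.e : ℕ) : ℤ), by
      simp [mem_weightsMinus]⟩ ⟨m - ((χ.e : ℕ) : ℤ) + 1, by simp [mem_weightsMinus]⟩
    rw [coe_sup, topologicalClosure_vecSpan]
    -- All statements about closures become statements about sets of weights.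
    simp only [Dplus_eq, Dminus_eq, coefSupported_inf, coefSupported_sup, ← coefSupported_empty]
    refine ⟨hP.isIrreducible (coe_Mplus h), hM.isIrreducible (coe_Mminus h), hFsub,
      nonempty_Mplus_equiv h hneg, nonempty_Mminus_equiv h hneg, hP.isIrredQuot, hM.isIrredQuot,
      by rw [inter_eq_empty hneg], trivial, fun hl => ?_, fun hl => ?_⟩
    · rw [ne_eq, l_eq_neg_half_iff h] at hl
      have hl' : 2 * m - ((χ.e : ℕ) : ℤ) < -1 := by omega
      have hU := stableCover_union_univ h hl'
      obtain ⟨d, hd⟩ := Int.eq_ofNat_of_zero_le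
        (show 0 ≤ ((χ.e : ℕ) : ℤ) - 2 * m - 2 by omega)
      have hdl : (d : ℂ) = -2 * (χ.l + 1) := by
        have h1 := congrArg (Int.cast (R := ℂ)) hd
        have h2 := two_mul_l_eq h
        push_cast at h1 h2
        linear_combination -h1 + h2
      have M := gapModel h d hd.symm
      obtain ⟨e⟩ := M.nonempty_subQuot (coe_sup h) (coe_HC (χ := χ))
      refine ⟨?_, hU.isIrreducible_subQuot (coe_sup h) coe_HC, ?_, d, hdl, ?_, ⟨e⟩,
        M.exists_hom hU.1⟩
      · refine Set.Subset.antisymm ?_ ?_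
        · rintro N ⟨hN, h0, h1⟩
          rcases gk_submodules h hN h0 h1 with h | h | h | h
          · exact Or.inl h
          · exact Or.inr (Or.inl h)
          · exact Or.inr (Or.inr h)
          · exact absurd (h.trans hFsub) h0
        · rintro N (rfl | rfl | rfl)
          · exact hPmem
          · exact hMmem
          · exact mem_gk_submodules (coe_sup h) ⟨-m, Or.inl (le_refl (-m))⟩ ⟨-m - 1, by
              simp only [Set.mem_union, mem_weightsPlus, mem_weightsMinus]; omega⟩
      · rw [← coefSupported_univ]
        exact hU.isIrredQuot
      · rw [(e : SubQuot (Mplus χ m h ⊔ Mminus χ m h) (HC χ) ≃ₗ[ℂ] FMod d).finrank_eq,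
          FMod.finrank_eq]
        push_cast
        linear_combination hdl
    · rw [l_eq_neg_half_iff h] at hl
      have hsup : Mplus χ m h ⊔ Mminus χ m h = HC χ := by
        rw [← LieSubmodule.toSubmodule_inj, coe_sup, coe_HC, union_eq_univ (by omega)]
      refine ⟨?_, hsup, by rw [union_eq_univ (by omega), coefSupported_univ]⟩
      refine Set.Subset.antisymm ?_ ?_
      · rintro N ⟨hN, h0, h1⟩
        rcases gk_submodules h hN h0 h1 with h | h | h | h
        · exact Or.inl h
        · exact Or.inr h
        · exact absurd (h.trans hsup) h1
        · exact absurd (h.trans hFsub) h0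
      · rintro N (rfl | rfl)
        · exact hPmem
        · exact hMmem
  · rw [← not_lt, l_re_neg_iff h, not_lt] at hpos
    have hF := stableCover_empty_inter h hpos
    have hP := stableCover_inter_plus h hpos
    have hM := stableCover_inter_minus h hpos
    have hsup : Mplus χ m h ⊔ Mminus χ m h = HC χ := by
      rw [← LieSubmodule.toSubmodule_inj, coe_sup, coe_HC, union_eq_univ (by omega)]
    obtain ⟨d, hd⟩ := Int.eq_ofNat_of_zero_le hpos
    have hdl : (d : ℂ) = 2 * χ.l := by
      rw [two_mul_l_eq h, hd]
      simp
    obtain ⟨e⟩ := nonempty_Fsub_equiv h d hd.symm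
    -- The weights of `F` form a finite interval, so `F` is already closed and can be compared with
    -- the closures of `M⁺` and `M⁻`.
    have hFcl : (Fsub χ m h : Submodule ℂ (PS χ)) =
        coefSupported χ (weightsPlus m ∩ weightsMinus χ m) := by
      rw [coe_Fsub, vecSpan_eq_coefSupported]
      exact Set.finite_Icc (-m) (m - ((χ.e : ℕ) : ℤ))
    rw [hFcl, ← coefSupported_empty, ← coefSupported_univ]
    simp only [Dplus_eq, Dminus_eq, coefSupported_inf, coefSupported_sup]
    refine ⟨hF.isIrreducible (coe_Fsub h), ?_, ⟨d, hdl, ⟨e⟩⟩, ?_, hsup,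
      hP.isIrreducible_subQuot (coe_Fsub h) (coe_Mplus h),
      hM.isIrreducible_subQuot (coe_Fsub h) (coe_Mminus h), nonempty_Mplus_quot_equiv h hpos,
      nonempty_Mminus_quot_equiv h hpos,
      isCompl_subQuotIm (hsup ▸ le_sup_left) (hsup ▸ le_sup_right) le_rfl inf_le_right hsup.ge,
      hF.isIrredQuot, trivial, by rw [union_eq_univ (by omega)], hP.isIrredQuot, hM.isIrredQuot⟩
    · rw [(e : Fsub χ m h ≃ₗ[ℂ] FMod d).finrank_eq, FMod.finrank_eq]
      push_cast
      rw [hdl]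
    · refine Set.Subset.antisymm ?_ ?_
      · rintro N ⟨hN, h0, h1⟩
        rcases gk_submodules h hN h0 h1 with h | h | h | h
        · exact Or.inr (Or.inl h)
        · exact Or.inr (Or.inr h)
        · exact absurd (h.trans hsup) h1
        · exact Or.inl h
      · rintro N (rfl | rfl | rfl)
        · exact mem_gk_submodules (coe_Fsub h) ⟨-m, by
            simp only [Set.mem_inter_iff, mem_weightsPlus, mem_weightsMinus]; omega⟩
            ⟨-m - 1, by simp [mem_weightsPlus]⟩
        · exact mem_gk_submodules (coe_Mplus h) ⟨-m, le_refl (-m)⟩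
            ⟨-m - 1, by simp [mem_weightsPlus]⟩
        · exact mem_gk_submodules (coe_Mminus h) ⟨m - ((χ.e : ℕ) : ℤ), by
            simp [mem_weightsMinus]⟩ ⟨m - ((χ.e : ℕ) : ℤ) + 1, by simp [mem_weightsMinus]⟩
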